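/- Let $E$ be a Lusin topological space (a homeomorph of a Borel subset of a compact metric space), $M_0(E)$ the set of Borel probability measures on $E$, $B^+(E)$ the set of bounded nonnegative Borel functions on $E$, and $B_a^+(E)=\{f\in B^+(E): f\le a\}$. For a measure $\nu$ write $\nu(f)=\int f\,d\nu$. Let $\xi=(\xi_t,\mathbf P_x)$ be a right continuous strong Markov process in $E$ with transition semigroup $(P_t)_{t\ge0}$, and let $G(x,d\pi)$ be a probability kernel from $E$ to $M_0(E)$. For $k=1,2,\dots$ let $\alpha_k,\beta_k\in B^+(E)$ with $\gamma_k:=\alpha_k+\beta_k>0$ everywhere. Let $(p^{(k)}_i(x))_{i\ge0}$ and $(q^{(k)}_i(x,\pi))_{i\ge0}$ be probability distributions on $\{0,1,2,\dots\}$ which depend measurably on $x\in E$ and on $(x,\pi)\in E\times M_0(E)$, with generating functions $g_k(x,z)=\sum_i p^{(k)}_i(x)z^i$ and $h_k(x,\pi,z)=\sum_i q^{(k)}_i(x,\pi)z^i$ and with $\sup_x\sum_i i\,p^{(k)}_i(x)<\infty$, $\sup_{x,\pi}\sum_i i\,q^{(k)}_i(x,\pi)<\infty$. In the $k$-th branching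 particle system, particles move independently according to $\xi$ and die at rate $\gamma_k(\xi_t)$. A particle dying at $x$ branches locally with probability $\alpha_k(x)/\gamma_k(x)$, and then has $i$ offspring, all at $x$, with probability $p_i^{(k)}(x)$. Otherwise it branches non-locally: $\pi$ is chosen according to $G(x,d\pi)$, and then, with probability $q_i^{(k)}(x,\pi)$, it has $i$ offspring at independent locations with law $\pi$. Let $X_t(k)$ be the sum of the unit masses at the positions of the particles alive at time $t$, let $\mathbf Q^{(k)}_{x}$ be its law when the system starts from one particle at $x$, and put $$u^{(k)}_t(x,f)=-\log \mathbf Q^{(k)}_{x}\exp\{-k^{-1}X_t(k)(f)\},\qquad v^{(k)}_t(x,f)=k\,[1-\exp\{-u^{(k)}_t(x,f)\}].$$ Let $$\phi_k(x,z)=k\alpha_k(x)[g_k(x,1-z/k)-(1-z/k)]\quad(0\le z\le k),$$ $$\zeta_k(x,f)=\int_{M_0(E)}k\,[1-h_k(x,\pi,1-\pi(f)/k)]\,G(x,d\pi)\quad(f\in B_k^+(E)).$$ **Lemma 3.3.** Suppose that 1. $\sum_i i\,q^{(k)}_i(x,\pi)\le1$ for all $k,x,\pi$, and $\zeta_k(x,f)\to\zeta(x,f)$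 uniformly on $E\times B_a^+(E)$ for each $a\ge0$; 2. for each $l\ge0$, the functions $\phi_k(x,z)$, $k\ge \max(l,1)$, are Lipschitz in $z\in[0,l]$ with a constant independent of $x\in E$ and $k$, and $\phi_k(x,z)\to\phi(x,z)$ uniformly on $E\times[0,l]$; 3. $\beta_k\to\beta\in B^+(E)$ uniformly on $E$. Put $\psi(x,f)=\beta(x)[f(x)-\zeta(x,f)]$. Then for each $f\in B^+(E)$ the evolution equation $$V_tf(x)+\int_0^t\Big\{\int_E[\phi(y,V_{t-s}f(y))+\psi(y,V_{t-s}f)]\,P_s(x,dy)\Big\}ds=P_tf(x),\qquad t\ge0,\ x\in E,$$ has exactly one solution $(t,x)\mapsto V_tf(x)$ that is nonnegative, jointly measurable, and bounded on $[0,T]\times E$ for every $T\ge0$. Moreover, for each $a\ge0$, both $v^{(k)}_t(x,f)$ and $k\,u^{(k)}_t(x,f)$ are bounded on $[0,a]\times E\times B_a^+(E)$ uniformly in $k\ge1$, and converge to $V_tf(x)$ as $k\to\infty$, uniformly on $[0,a]\times E\times B_a^+(E)$. -/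

import Mathlib

open MeasureTheory ProbabilityTheory Filter Topology Set
open scoped NNReal ENNReal

noncomputable section

namespace NonlocalBranching

universe u v

/-! ### State space and function spaces -/

/-- A Lusin topological space: a homeomorph of a Borel subset of some compact metric space. -/
def IsLusin (E : Type u) [TopologicalSpace E] : Prop :=
  ∃ (K : Type u) (_ : MetricSpace K) (_ : CompactSpace K) (e : E → K),
    IsEmbedding e ∧ MeasurableSet[borel K] (range e)

/-- `B_a^+(E)`: the measurable functions on `E` with values in `[0, a]`. -/
def BPlusBall (E : Type u) [MeasurableSpace E] (a : ℝ) : Set (E → ℝ) :=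
  {f | Measurable f ∧ ∀ x, 0 ≤ f x ∧ f x ≤ a}

/-- `B^+(E)`: the bounded positive measurable functions on `E`. -/
def BPlus (E : Type u) [MeasurableSpace E] : Set (E → ℝ) :=
  {f | ∃ a, f ∈ BPlusBall E a}

/-! ### The underlying Markov process -/

section MarkovProc

variable {E : Type u} [MeasurableSpace E] {Ω : Type v} [mΩ : MeasurableSpace Ω]

/-- `(Ω, ξ_t, 𝓕_t, P_x)` is a right continuous strong Markov process in `E`: the law of the path
after a stopping time `τ`, on events `A ∈ 𝓕_τ` included in `{τ < ∞}`, is that of the process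
started afresh from `ξ_τ`. -/
structure IsRightContStrongMarkov [TopologicalSpace E] (𝓕 : Filtration ℝ≥0 mΩ) (ξ : ℝ≥0 → Ω → E) (P : Kernel E Ω) :
    Prop where
  isMarkovKernel : IsMarkovKernel P
  adapted : ∀ t, Measurable[𝓕 t] (ξ t)
  rightCont : ∀ ω t, ContinuousWithinAt (fun s => ξ s ω) (Ici t) t
  start : ∀ x, ∀ᵐ ω ∂(P x), ξ 0 ω = x
  strongMarkov : ∀ (τ : Ω → WithTop ℝ≥0) (hτ : IsStoppingTime 𝓕 τ) (A : Set Ω),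
    MeasurableSet[hτ.measurableSpace] A → (∀ ω ∈ A, τ ω ≠ ⊤) →
    ∀ C : Set (ℝ≥0 → E), MeasurableSet C → ∀ x,
      P x {ω | ω ∈ A ∧ (fun s => ξ ((τ ω).untopD 0 + s) ω) ∈ C} =
        ∫⁻ ω in A, P (ξ ((τ ω).untopD 0) ω) {ω' | (fun s => ξ s ω') ∈ C} ∂(P x)

/-- The transition semigroup `P_t(x, dy)` of the process: the law of `ξ_t` under `P_x`. -/
def transition (ξ : ℝ≥0 → Ω → E) (P : Kernel E Ω) (t : ℝ≥0) (x : E) : Measure E :=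
  (P x).map (ξ t)

/-! ### Branching particle systems -/

/-- `ρ(0,t) = exp (-∫_0^t γ(ξ_s) ds)`: the conditional probability, given the path, that a particle
born at time `0` is still alive at time `t`. -/
def survival (ξ : ℝ≥0 → Ω → E) (γ : E → ℝ) (t : ℝ) (ω : Ω) : ℝ≥0∞ :=
  ENNReal.ofReal (Real.exp (-∫ s in (0 : ℝ)..t, γ (ξ s.toNNReal ω)))

/-- The particle system started from one particle at `x`. Particles move independently as `ξ`,
die at rate `γ(ξ_s)`, and a particle dying at `y` is replaced by `i` particles at the points
`y_1, …, y_i`, where `(i, (y_1, …, y_i))` has the law `F y`.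

`genLaw ξ P γ F n t x` is the law of the random measure `X_t` (the sum of the unit masses at the
positions of the particles alive at time `t`), restricted to the event that the genealogical tree
up to time `t` consists of at most `n` generations. Either the first particle is alive at time `t`,
and `X_t = δ_{ξ_t}`; or it died at some time `s ≤ t`, and `X_t` is then the sum of
the independent populations which descend from its offspring, of age `t - s` at time `t`. -/
def genLaw (ξ : ℝ≥0 → Ω → E) (P : Kernel E Ω) (γ : E → ℝ)
    (F : E → Measure (Σ i : ℕ, (Fin i → E))) : ℕ → ℝ≥0 → E → Measure (Measure E)
  | 0, _, _ => 0
  | n + 1, t, x =>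
    ((P x).withDensity (survival ξ γ t)).map (fun ω => Measure.dirac (ξ t ω)) +
    (((P x).prod (volume.restrict (Ioc (0 : ℝ) t))).withDensity
        (fun z => survival ξ γ z.2 z.1 * ENNReal.ofReal (γ (ξ z.2.toNNReal z.1)))).bind
      (fun z => (F (ξ z.2.toNNReal z.1)).bind
        (fun o => (Measure.pi (fun j => genLaw ξ P γ F n (t - z.2.toNNReal) (o.2 j))).map
          (fun η => ∑ j, η j)))

/-- The law of `X_t` for the particle system with parameters `(ξ, γ, F)` started from one particle
at `x`: the increasing limit of `genLaw` in the number of generations. -/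
def particleLaw (ξ : ℝ≥0 → Ω → E) (P : Kernel E Ω) (γ : E → ℝ)
    (F : E → Measure (Σ i : ℕ, (Fin i → E))) (t : ℝ≥0) (x : E) : Measure (Measure E) :=
  ⨆ n, genLaw ξ P γ F n t x

/-- `u_t(x,f) = -log Q_{δ_x} exp (-X_t(f))`. -/
def logLaplace (ξ : ℝ≥0 → Ω → E) (P : Kernel E Ω) (γ : E → ℝ)
    (F : E → Measure (Σ i : ℕ, (Fin i → E))) (t : ℝ≥0) (x : E) (f : E → ℝ) : ℝ :=
  -Real.log (∫ ν, Real.exp (-∫ y, f y ∂ν) ∂(particleLaw ξ P γ F t x))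

end MarkovProc

/-! ### Local and non-local branching -/

/-- Parameters of one particle system with local branching at rate `α` and non-local branching at
rate `β`: a particle which branches locally at `x` has `i` offspring with probability `p i x`, and
one which branches non-locally at `x` and has chosen the offspring-location-distribution `π` has `i`
offspring with probability `q i x π`. -/
structure BranchingData (E : Type u) [MeasurableSpace E] where
  α : E → ℝ
  β : E → ℝ
  p : ℕ → E → ℝ
  q : ℕ → E → ProbabilityMeasure E → ℝ
  α_mem : α ∈ BPlus E
  β_mem : β ∈ BPlus E
  rate_pos : ∀ x, 0 < α x + β x
  p_meas : ∀ i, Measurable (p i)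
  p_nonneg : ∀ i x, 0 ≤ p i x
  p_sum : ∀ x, HasSum (fun i => p i x) 1
  p_moment : ∃ C : ℝ≥0, ∀ x, ∑' i : ℕ, (i : ℝ≥0∞) * ENNReal.ofReal (p i x) ≤ C
  q_meas : ∀ i, Measurable (fun z : E × ProbabilityMeasure E => q i z.1 z.2)
  q_nonneg : ∀ i x π, 0 ≤ q i x π
  q_sum : ∀ x π, HasSum (fun i => q i x π) 1
  q_moment : ∃ C : ℝ≥0, ∀ x π, ∑' i : ℕ, (i : ℝ≥0∞) * ENNReal.ofReal (q i x π) ≤ C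

namespace BranchingData

variable {E : Type u} [MeasurableSpace E]

/-- The total branching rate `γ = α + β`. -/
def γ (D : BranchingData E) (x : E) : ℝ := D.α x + D.β x

/-- The generating function `g(x,z)` of the local offspring numbers. -/
def g (D : BranchingData E) (x : E) (z : ℝ) : ℝ := ∑' i, D.p i x * z ^ i

/-- The generating function `h(x,π,z)` of the non-local offspring numbers. -/
def h (D : BranchingData E) (x : E) (π : ProbabilityMeasure E) (z : ℝ) : ℝ :=
  ∑' i, D.q i x π * z ^ i

/-- Offspring law of local branching at `x`: all offspring are located at `x`. -/
def localOffspring (D : BranchingData E) (x : E) : Measure (Σ i : ℕ, (Fin i → E)) :=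
  Measure.sum (fun i => ENNReal.ofReal (D.p i x) • Measure.dirac ⟨i, fun _ => x⟩)

/-- Offspring law of non-local branching at `x`: `π` is chosen according to `G(x,dπ)`, then the
offspring number `i` according to `q · x π`, and then `i` independent locations with law `π`. -/
def nonlocalOffspring (D : BranchingData E) (G : Kernel E (ProbabilityMeasure E)) (x : E) :
    Measure (Σ i : ℕ, (Fin i → E)) :=
  (G x).bind (fun π => Measure.sum (fun i => ENNReal.ofReal (D.q i x π) •
    (Measure.pi (fun _ : Fin i => (π : Measure E))).map (Sigma.mk i)))

/-- The offspring law: local branching with probability `α/γ`, non-local with probability `β/γ`. -/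
def offspring (D : BranchingData E) (G : Kernel E (ProbabilityMeasure E)) (x : E) :
    Measure (Σ i : ℕ, (Fin i → E)) :=
  ENNReal.ofReal (D.α x / D.γ x) • D.localOffspring x +
    ENNReal.ofReal (D.β x / D.γ x) • D.nonlocalOffspring G x

/-- `φ_k(x,z) = k α_k(x) [g_k(x, 1 - z/k) - (1 - z/k)]`, for `0 ≤ z ≤ k`. -/
def phi (D : BranchingData E) (k : ℕ) (x : E) (z : ℝ) : ℝ :=
  k * D.α x * (D.g x (1 - z / k) - (1 - z / k))

/-- `ζ_k(x,f) = ∫ k [1 - h_k(x, π, 1 - π(f)/k)] G(x,dπ)`, for `0 ≤ f ≤ k`. -/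
def zeta (D : BranchingData E) (G : Kernel E (ProbabilityMeasure E)) (k : ℕ) (x : E)
    (f : E → ℝ) : ℝ :=
  ∫ π, k * (1 - D.h x π (1 - (∫ y, f y ∂(π : Measure E)) / k)) ∂(G x)

variable {Ω : Type v} [MeasurableSpace Ω]

/-- `u^{(k)}_t(x,f)`, where `Q exp (-k⁻¹ X_t(f)) = exp (-u^{(k)}_t(x,f))` for the particle system `X`
with parameters `D` started from one particle at `x`. -/
def uK (D : BranchingData E) (G : Kernel E (ProbabilityMeasure E)) (ξ : ℝ≥0 → Ω → E)
    (P : Kernel E Ω) (k : ℕ) (t : ℝ≥0) (x : E) (f : E → ℝ) : ℝ :=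
  logLaplace ξ P D.γ (D.offspring G) t x (fun y => f y / k)

/-- `v^{(k)}_t(x,f) = k [1 - exp (-u^{(k)}_t(x,f))]`. -/
def vK (D : BranchingData E) (G : Kernel E (ProbabilityMeasure E)) (ξ : ℝ≥0 → Ω → E)
    (P : Kernel E Ω) (k : ℕ) (t : ℝ≥0) (x : E) (f : E → ℝ) : ℝ :=
  k * (1 - Real.exp (-D.uK G ξ P k t x f))

end BranchingData

/-! ### The limiting equation and the mode of convergence -/

/-- The non-local branching term `ψ(x,f) = β(x) [f(x) - ζ(x,f)]`. -/
def psi {E : Type u} (β : E → ℝ) (ζ : E → (E → ℝ) → ℝ) (x : E) (f : E → ℝ) : ℝ :=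
  β x * (f x - ζ x f)

/-- `V` is a bounded positive solution, started from `f`, of
`V_t(x) + ∫_0^t {∫ [φ(y, V_{t-s}(y)) + ψ(y, V_{t-s})] P_s(x,dy)} ds = P_t f(x)`, `t ≥ 0`.
Here `V` is jointly measurable, and bounded on `[0,T] × E` for every `T`. -/
structure IsBoundedPositiveSolution {E : Type u} [MeasurableSpace E]
    {Ω : Type v} [MeasurableSpace Ω] (ξ : ℝ≥0 → Ω → E) (P : Kernel E Ω) (φ : E → ℝ → ℝ)
    (ψ : E → (E → ℝ) → ℝ) (f : E → ℝ) (V : ℝ≥0 → E → ℝ) : Prop where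
  measurable : Measurable (fun z : ℝ≥0 × E => V z.1 z.2)
  nonneg : ∀ t x, 0 ≤ V t x
  bounded : ∀ T : ℝ≥0, ∃ C : ℝ, ∀ t ≤ T, ∀ x, V t x ≤ C
  equation : ∀ t x,
    V t x + ∫ s in (0 : ℝ)..t,
        (∫ y, (φ y (V (t - s.toNNReal) y) + ψ y (V (t - s.toNNReal)))
          ∂(transition ξ P s.toNNReal x)) =
      ∫ y, f y ∂(transition ξ P t x)

/-- The functions `w k`, `k = 1, 2, …`, converge to `W` boundedly and uniformly on `S`. -/
def ConvergesBoundedlyUniformlyOn {S : Type*} (w : ℕ → S → ℝ) (W : S → ℝ) (s : Set S) : Prop :=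
  (∃ C : ℝ, ∀ k, 1 ≤ k → ∀ z ∈ s, |w k z| ≤ C) ∧ TendstoUniformlyOn w W atTop s

end NonlocalBranching

end

namespace NonlocalBranching

/-! ### Complements on product measures and on suprema of measures -/

/-! Let w be the Laplace functional of the k-th system at f/k, so that v = k(1 - w) and k u = -k
log(1 - v/k). The weight exp(-ν(f)) is multiplicative and siblings have independent descendants, so
conditioning on the first branching gives a renewal equation for w along an ancestor killed at rate
γ_k (`lintegral_particleLaw_eq`). The Markov property trades the killing for a potential term with
kernel γ_k (`IsRightContStrongMarkov.feynmanKac`). The substitution w = 1 - v/k then yields the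
evolution equation with mechanism H_k = φ_k + ψ_k and initial value k(1 - exp(-f/k))
(`BranchingData.vK_equation`). Only total mass at most one is needed of the particle law in all
this; non-explosion plays no part.

The rest is analysis of these equations. A priori one only knows 0 ≤ v ≤ k. However, H_k(·, w) ≥ -c
sup w with c independent of k. Indeed φ_k is convex in z and vanishes at 0, so its Lipschitz
constant on [0,1] bounds it from below on all of [0,k]; and a mean non-local offspring number of at
most one gives ζ_k(x, w) ≤ sup w. A one-sided Gronwall inequality (`le_mul_exp_of_le_potential`)
turns this into a bound for v on [0,T] that is uniform in k.

On the ball so obtained the H_k converge uniformly to a mechanism which is Lipschitz for the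
supremum norm (`convergentMechanisms`). The stability estimate `abs_sub_le_mul_exp` then shows that
the v^{(k)} are uniformly Cauchy; their limit solves the limit equation, and the same estimate gives
uniqueness.

Finally k u - v is of order 1/k once v is bounded (`BranchingData.abs_mul_uK_sub_vK_le`). The
finitely many small k, for which w may be close to 0, are covered by the probability that the
ancestor has not branched. -/

theorem lintegral_pi_prod {X : Type*} [MeasurableSpace X] :
    ∀ {n : ℕ} (μ : Fin n → Measure X) [∀ i, SigmaFinite (μ i)] (m : X → ℝ≥0∞),
      Measurable m → ∫⁻ x, ∏ i, m (x i) ∂(Measure.pi μ) = ∏ i, ∫⁻ x, m x ∂(μ i)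
  | 0, μ, _, m, hm => by simp
  | n + 1, μ, _, m, hm => by
    have hprod : AEMeasurable (fun x : Fin n → X => ∏ i, m (x i))
        (Measure.pi fun i => μ (Fin.succ i)) :=
      (Finset.measurable_fun_prod _ fun i _ => hm.comp (measurable_pi_apply i)).aemeasurable
    rw [Fin.prod_univ_succ, ← lintegral_pi_prod (fun i => μ (Fin.succ i)) m hm,
      ← lintegral_prod_mul hm.aemeasurable hprod,
      ← ((measurePreserving_piFinSuccAbove (fun i => μ i) 0).symm).lintegral_comp_emb
        (MeasurableEquiv.measurableEmbedding _)]
    refine lintegral_congr fun x => ?_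
    rw [Fin.prod_univ_succ]
    rfl

theorem measurable_pi_measure {A X ι : Type*} [Fintype ι] [MeasurableSpace A] [MeasurableSpace X]
    {μ : A → ι → Measure X} [∀ a i, IsFiniteMeasure (μ a i)]
    (h : ∀ i, Measurable fun a => μ a i) : Measurable fun a => Measure.pi (μ a) := by
  refine Measurable.measure_of_isPiSystem generateFrom_pi.symm isPiSystem_pi ?_ ?_
  · rintro _ ⟨s, hs, rfl⟩
    simp only [Measure.pi_pi]
    exact Finset.measurable_prod _ fun i _ =>
      (Measure.measurable_coe (hs i (mem_univ i))).comp (h i)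
  · simp only [Measure.pi_univ]
    exact Finset.measurable_prod _ fun i _ => (Measure.measurable_coe MeasurableSet.univ).comp (h i)

/-- The product measure is built from the largest outer measure below the product set function on
boxes, so it suffices to compare on boxes; no finiteness of ν is involved. -/
theorem pi_measure_mono {X ι : Type*} [Fintype ι] [MeasurableSpace X] {μ ν : ι → Measure X}
    [∀ i, SigmaFinite (μ i)] (h : ∀ i, μ i ≤ ν i) : Measure.pi μ ≤ Measure.pi ν := by
  have key : (Measure.pi μ).toOuterMeasure ≤ OuterMeasure.pi fun i => (ν i).toOuterMeasure := by
    rw [OuterMeasure.le_pi]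
    intro s _
    calc (Measure.pi μ) (univ.pi s) = ∏ i, μ i (s i) := Measure.pi_pi _ _
      _ ≤ ∏ i, ν i (s i) := Finset.prod_le_prod' fun i _ => h i (s i)
  refine Measure.le_iff.2 fun s hs => ?_
  rw [Measure.pi_def ν, toMeasure_apply _ _ hs]
  exact key s

/-- A supremum of measures is a lattice operation, not given setwise by definition. Finiteness makes
the differences of successive measures genuine, and the supremum is the telescoping series of these
differences; integration against a series of measures needs no measurability of f. -/
theorem lintegral_iSup_measure_of_monotone {X : Type*} [MeasurableSpace X] {μ : ℕ → Measure X}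
    [∀ n, IsFiniteMeasure (μ n)] (hμ : Monotone μ) (f : X → ℝ≥0∞) :
    ∫⁻ x, f x ∂(⨆ n, μ n) = ⨆ n, ∫⁻ x, f x ∂(μ n) := by
  set d : ℕ → Measure X := fun n => μ (n + 1) - μ n
  have hd : ∀ n, μ 0 + ∑ i ∈ Finset.range n, d i = μ n := by
    intro n
    induction n with
    | zero => simp
    | succ n ih =>
      rw [Finset.sum_range_succ, ← add_assoc, ih, add_comm]
      exact Measure.sub_add_cancel_of_le (hμ n.le_succ)
  have hint : ∀ g : X → ℝ≥0∞,
      ∫⁻ x, g x ∂(μ 0 + Measure.sum d) = ⨆ n, ∫⁻ x, g x ∂(μ n) := by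
    intro g
    rw [lintegral_add_measure, lintegral_sum_measure, ENNReal.tsum_eq_iSup_nat, ENNReal.add_iSup]
    refine iSup_congr fun n => ?_
    rw [← lintegral_finsetSum_measure, ← lintegral_add_measure, hd]
  have happ : ∀ s, MeasurableSet s → (μ 0 + Measure.sum d) s = ⨆ n, μ n s := by
    intro s hs
    simpa [lintegral_indicator_one hs] using hint (s.indicator 1)
  have : (⨆ n, μ n) = μ 0 + Measure.sum d := by
    apply le_antisymm
    · refine iSup_le fun n => Measure.le_iff.2 fun s hs => ?_
      rw [happ s hs]
      exact le_iSup (fun n => μ n s) n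
    · refine Measure.le_iff.2 fun s hs => ?_
      rw [happ s hs]
      exact iSup_le fun n => (le_iSup μ n) s
  rw [this, hint]

/-! ### Joint measurability of right continuous processes -/

/-- Time is discretised from the right: the approximating times take countably many values, and
right continuity gives pointwise convergence. -/
theorem measurable_uncurry_of_rightCont {E Ω : Type*} [TopologicalSpace E]
    [TopologicalSpace.PseudoMetrizableSpace E] [MeasurableSpace E] [BorelSpace E]
    [MeasurableSpace Ω] {X : ℝ≥0 → Ω → E} (hX : ∀ t, Measurable (X t))
    (hr : ∀ ω t, ContinuousWithinAt (fun s => X s ω) (Ici t) t) :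
    Measurable fun z : ℝ≥0 × Ω => X z.1 z.2 := by
  -- The summand 1 after the floor keeps the approximating time to the right of t.
  let r : ℕ → ℝ≥0 → ℝ≥0 := fun n t => ((⌊(n + 1) * t⌋₊ + 1 : ℕ) : ℝ≥0) / (n + 1)
  have hr1 : ∀ n t, t ≤ r n t := by
    intro n t
    rw [le_div_iff₀ (by positivity), mul_comm]
    push_cast
    exact (Nat.lt_floor_add_one _).le
  have hr2 : ∀ n t, r n t ≤ t + 1 / (n + 1) := by
    intro n t
    simp only [r]
    rw [div_le_iff₀ (by positivity), add_mul t, div_mul_cancel₀ _ (by positivity)]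
    push_cast
    gcongr
    rw [mul_comm t]
    exact Nat.floor_le (by positivity)
  have hlim : ∀ t, Tendsto (fun n => r n t) atTop (𝓝[≥] t) := by
    intro t
    refine tendsto_nhdsWithin_iff.2 ⟨?_, Eventually.of_forall fun n => hr1 n t⟩
    refine tendsto_of_tendsto_of_tendsto_of_le_of_le tendsto_const_nhds ?_
      (fun n => hr1 n t) (fun n => hr2 n t)
    have h1 : Tendsto (fun n : ℕ => 1 / ((n : ℝ≥0) + 1)) atTop (𝓝 0) :=
      tendsto_one_div_add_atTop_nhds_zero_nat
    simpa using h1.const_add t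
  refine measurable_of_tendsto_metrizable (f := fun n (z : ℝ≥0 × Ω) => X (r n z.1) z.2) ?_ ?_
  · intro n
    have : Measurable fun z : ℕ × Ω => X (((z.1 + 1 : ℕ) : ℝ≥0) / (n + 1)) z.2 :=
      measurable_from_prod_countable_right fun k => hX (((k + 1 : ℕ) : ℝ≥0) / (n + 1))
    refine this.comp (Measurable.prodMk ?_ measurable_snd)
    exact Nat.measurable_floor.comp (measurable_fst.const_mul _)
  · rw [tendsto_pi_nhds]
    rintro ⟨t, ω⟩
    exact (hr ω t).tendsto.comp (hlim t)

/-! ### The exponential of an indefinite integral -/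

section PathCalculus

variable {a : ℝ → ℝ} {C : ℝ}

theorem intervalIntegrable_of_bdd (ha : Measurable a) (h0 : ∀ r, 0 ≤ a r) (hC : ∀ r, a r ≤ C)
    (s u : ℝ) : IntervalIntegrable a volume s u := by
  rw [intervalIntegrable_iff]
  refine Measure.integrableOn_of_bounded (M := C) (by simp) ha.aestronglyMeasurable ?_
  exact Eventually.of_forall fun r => by rw [Real.norm_of_nonneg (h0 r)]; exact hC r

/-- Since a is only bounded and measurable, the exponential is differentiable merely almost
everywhere. It is Lipschitz on the interval, hence absolutely continuous, and the fundamental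
theorem applies in that form. -/
theorem integral_mul_exp_integral (ha : Measurable a) (h0 : ∀ r, 0 ≤ a r) (hC : ∀ r, a r ≤ C)
    (σ s u : ℝ) :
    ∫ r in s..u, σ * a r * Real.exp (σ * ∫ x in s..r, a x) =
      Real.exp (σ * ∫ x in s..u, a x) - 1 := by
  have hint := intervalIntegrable_of_bdd ha h0 hC
  obtain ⟨K, hK⟩ : ∃ K : ℝ≥0, LipschitzOnWith K (fun r => Real.exp (σ * ∫ x in s..r, a x))
      (uIcc s u) := by
    have hC0 : 0 ≤ C := (h0 0).trans (hC 0)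
    have hL : LipschitzWith C.toNNReal (fun r => ∫ x in s..r, a x) := by
      refine LipschitzWith.of_dist_le_mul fun x y => ?_
      rw [Real.dist_eq, Real.dist_eq, intervalIntegral.integral_interval_sub_left (hint _ _)
        (hint _ _), Real.coe_toNNReal _ hC0]
      have hn : ∀ r ∈ uIoc y x, ‖a r‖ ≤ C := fun r _ => by
        rw [Real.norm_of_nonneg (h0 r)]
        exact hC r
      exact intervalIntegral.norm_integral_le_of_norm_le_const hn
    have hc : ContinuousOn (fun r => σ * ∫ x in s..r, a x) (uIcc s u) :=
      (hL.continuous.const_mul σ |>.continuousOn) |>.congr fun _ _ => by simp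
    obtain ⟨B, hB⟩ := (isCompact_uIcc.image_of_continuousOn hc).bddAbove
    have hexp : LipschitzOnWith (Real.exp B).toNNReal Real.exp (Iic B) := by
      refine Convex.lipschitzOnWith_of_nnnorm_deriv_le
        (fun _ _ => Real.differentiableAt_exp) (fun x hx => ?_) (convex_Iic B)
      rw [Real.deriv_exp, ← NNReal.coe_le_coe, coe_nnnorm, Real.norm_of_nonneg (Real.exp_nonneg _),
        Real.coe_toNNReal _ (Real.exp_nonneg _)]
      exact Real.exp_le_exp.2 hx
    refine ⟨_, hexp.comp (((lipschitzWith_smul σ).comp hL).lipschitzOnWith) fun r hr => ?_⟩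
    exact hB (mem_image_of_mem _ hr)
  have hFTC := hK.absolutelyContinuousOnInterval.integral_deriv_eq_sub
  simp only [intervalIntegral.integral_same, mul_zero, Real.exp_zero] at hFTC
  rw [← hFTC]
  refine intervalIntegral.integral_congr_ae ?_
  filter_upwards [(hint s u).ae_hasDerivAt_integral] with r hr hru
  have := (((hr (uIoc_subset_uIcc hru)) s (by simp)).const_mul σ).exp.deriv
  rw [this]
  ring

theorem lintegral_Ioc_ofReal {f : ℝ → ℝ} (hf : Measurable f)
    (h0 : ∀ r, 0 ≤ f r) {s u K : ℝ} (hK : ∀ r ∈ Ioc s u, f r ≤ K) (hsu : s ≤ u) :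
    ∫⁻ r in Ioc s u, ENNReal.ofReal (f r) = ENNReal.ofReal (∫ r in s..u, f r) := by
  rw [intervalIntegral.integral_of_le hsu, ofReal_integral_eq_lintegral_ofReal]
  · refine Measure.integrableOn_of_bounded (M := K) (by simp) hf.aestronglyMeasurable ?_
    filter_upwards [ae_restrict_mem measurableSet_Ioc] with r hr
    rw [Real.norm_of_nonneg (h0 r)]
    exact hK r hr
  · exact Eventually.of_forall h0

theorem continuous_primitive_of_bdd (ha : Measurable a) (h0 : ∀ r, 0 ≤ a r) (hC : ∀ r, a r ≤ C)
    (s : ℝ) : Continuous fun r => ∫ x in s..r, a x :=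
  intervalIntegral.continuous_primitive (intervalIntegrable_of_bdd ha h0 hC) s

/-- A particle killed at rate `a` either survives up to time `u` or is killed before. -/
theorem survival_add_killed (ha : Measurable a) (h0 : ∀ r, 0 ≤ a r) (hC : ∀ r, a r ≤ C)
    {s u : ℝ} (hsu : s ≤ u) :
    ENNReal.ofReal (Real.exp (-∫ x in s..u, a x)) +
      ∫⁻ r in Ioc s u, ENNReal.ofReal (Real.exp (-∫ x in s..r, a x)) * ENNReal.ofReal (a r) =
      1 := by
  have hpos : ∀ r, s ≤ r → 0 ≤ ∫ x in s..r, a x := fun r hr =>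
    intervalIntegral.integral_nonneg hr fun _ _ => h0 _
  have h1 : ∫⁻ r in Ioc s u, ENNReal.ofReal (Real.exp (-∫ x in s..r, a x)) * ENNReal.ofReal (a r) =
      ENNReal.ofReal (∫ r in s..u, Real.exp (-∫ x in s..r, a x) * a r) := by
    simp_rw [← ENNReal.ofReal_mul (Real.exp_nonneg _)]
    refine lintegral_Ioc_ofReal (K := C) ?_ (fun r => mul_nonneg (Real.exp_nonneg _) (h0 r))
      (fun r hr => ?_) hsu
    · exact ((continuous_primitive_of_bdd ha h0 hC s).measurable.neg.exp).mul ha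
    · calc _ ≤ 1 * C := by
            refine mul_le_mul (Real.exp_le_one_iff.2 ?_) (hC r) (h0 r) zero_le_one
            exact neg_nonpos.2 (hpos r hr.1.le)
        _ = C := one_mul C
  have h2 : ∫ r in s..u, Real.exp (-∫ x in s..r, a x) * a r = 1 - Real.exp (-∫ x in s..u, a x) := by
    have := integral_mul_exp_integral ha h0 hC (-1) s u
    simp only [neg_mul, one_mul, intervalIntegral.integral_neg] at this
    simp_rw [mul_comm (Real.exp _) (a _)]
    linarith
  rw [h1, h2, ← ENNReal.ofReal_add (Real.exp_nonneg _)]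
  · simp
  · rw [sub_nonneg, Real.exp_le_one_iff]
    exact neg_nonpos.2 (hpos u hsu)

/-- The same balance, read backwards in time. -/
theorem survival_add_killed_backward (ha : Measurable a) (h0 : ∀ r, 0 ≤ a r) (hC : ∀ r, a r ≤ C)
    {s u : ℝ} (hsu : s ≤ u) :
    ENNReal.ofReal (Real.exp (-∫ x in s..u, a x)) +
      ∫⁻ r in Ioc s u, ENNReal.ofReal (a r) * ENNReal.ofReal (Real.exp (-∫ x in r..u, a x)) =
      1 := by
  have hint := intervalIntegrable_of_bdd ha h0 hC
  have hpos : ∀ r r', r ≤ r' → 0 ≤ ∫ x in r..r', a x := fun r r' hr =>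
    intervalIntegral.integral_nonneg hr fun _ _ => h0 _
  have h1 : ∫⁻ r in Ioc s u, ENNReal.ofReal (a r) * ENNReal.ofReal (Real.exp (-∫ x in r..u, a x)) =
      ENNReal.ofReal (∫ r in s..u, a r * Real.exp (-∫ x in r..u, a x)) := by
    simp_rw [← ENNReal.ofReal_mul (h0 _)]
    refine lintegral_Ioc_ofReal (K := C) ?_ (fun r => mul_nonneg (h0 r) (Real.exp_nonneg _))
      (fun r hr => ?_) hsu
    · have hsymm : ∀ r, -∫ x in r..u, a x = ∫ x in u..r, a x := fun r =>
        (intervalIntegral.integral_symm r u).symm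
      simp_rw [hsymm]
      exact ha.mul (continuous_primitive_of_bdd ha h0 hC u).measurable.exp
    · calc _ ≤ C * 1 := by
            refine mul_le_mul (hC r) (Real.exp_le_one_iff.2 ?_) (Real.exp_nonneg _)
              ((h0 r).trans (hC r))
            exact neg_nonpos.2 (hpos _ _ hr.2)
        _ = C := mul_one C
  have h2 : ∫ r in s..u, a r * Real.exp (-∫ x in r..u, a x) = 1 - Real.exp (-∫ x in s..u, a x) := by
    have := integral_mul_exp_integral ha h0 hC 1 s u
    simp only [one_mul] at this
    -- Factoring out the survival over the whole interval leaves an integral from the fixed base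
    -- point s, to which the forward formula applies with σ = 1.
    have h3 : ∀ r, Real.exp (-∫ x in r..u, a x) =
        Real.exp (-∫ x in s..u, a x) * Real.exp (∫ x in s..r, a x) := by
      intro r
      rw [← Real.exp_add, ← intervalIntegral.integral_add_adjacent_intervals (hint s r) (hint r u)]
      congr 1; ring
    have h4 : ∀ r, a r * Real.exp (-∫ x in r..u, a x) =
        Real.exp (-∫ x in s..u, a x) * (a r * Real.exp (∫ x in s..r, a x)) := by
      intro r
      rw [h3]
      ring
    simp_rw [h4]
    rw [intervalIntegral.integral_const_mul, this, mul_sub, ← Real.exp_add]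
    simp
  rw [h1, h2, ← ENNReal.ofReal_add (Real.exp_nonneg _)]
  · simp
  · rw [sub_nonneg, Real.exp_le_one_iff]
    exact neg_nonpos.2 (hpos _ _ hsu)

theorem measurable_exp_neg_integral (ha : Measurable a) (h0 : ∀ r, 0 ≤ a r) (hC : ∀ r, a r ≤ C) :
    Measurable fun z : ℝ × ℝ => ENNReal.ofReal (Real.exp (-∫ x in z.1..z.2, a x)) := by
  have hint := intervalIntegrable_of_bdd ha h0 hC
  have hA := (continuous_primitive_of_bdd ha h0 hC 0).measurable
  have : ∀ z : ℝ × ℝ, ∫ x in z.1..z.2, a x = (∫ x in (0 : ℝ)..z.2, a x) - ∫ x in (0 : ℝ)..z.1, a x :=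
    fun z => (intervalIntegral.integral_interval_sub_left (hint _ _) (hint _ _)).symm
  simp_rw [this]
  exact (((hA.comp measurable_snd).sub (hA.comp measurable_fst)).neg.exp).ennreal_ofReal

theorem lintegral_triangle_swap {b h : ℝ → ℝ≥0∞} {R : ℝ → ℝ → ℝ≥0∞} (haE : Measurable b)
    (hh : Measurable h) (hR : Measurable fun z : ℝ × ℝ => R z.1 z.2) (t : ℝ) :
    ∫⁻ s in Ioc 0 t, b s * ∫⁻ u in Ioc s t, R s u * h u =
      ∫⁻ u in Ioc 0 t, (∫⁻ s in Ioc 0 u, b s * R s u) * h u := by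
  have hR' : ∀ u, Measurable fun s => R s u := fun u =>
    hR.comp (measurable_id.prodMk measurable_const)
  have hR'' : ∀ s, Measurable fun u => R s u := fun s =>
    hR.comp (measurable_const.prodMk measurable_id)
  -- Both sides are integrals of this function over the square (0,t]². The diagonal is null, so
  -- half-open and open intervals may be exchanged.
  let k : ℝ → ℝ → ℝ≥0∞ := fun s u =>
    {z : ℝ × ℝ | z.1 < z.2}.indicator (fun z => b z.1 * (R z.1 z.2 * h z.2)) (s, u)
  have hk : Measurable (Function.uncurry k) :=
    ((haE.comp measurable_fst).mul (hR.mul (hh.comp measurable_snd))).indicator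
      (measurableSet_lt measurable_fst measurable_snd)
  have e1 : ∀ s ∈ Ioc 0 t, b s * ∫⁻ u in Ioc s t, R s u * h u =
      ∫⁻ u in Ioc 0 t, k s u := by
    intro s hs
    rw [← lintegral_const_mul _ ((hR'' s).fun_mul hh)]
    have : (fun u => k s u) = (Ioi s).indicator fun u => b s * (R s u * h u) := by
      ext u
      simp [k, indicator_apply]
    rw [this, setLIntegral_indicator measurableSet_Ioi]
    congr 2
    ext u
    simp only [mem_Ioc, mem_inter_iff, mem_Ioi]
    exact ⟨fun hu => ⟨hu.1, hs.1.trans hu.1, hu.2⟩, fun hu => ⟨hu.1, hu.2.2⟩⟩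
  have e2 : ∀ u ∈ Ioc 0 t, ∫⁻ s in Ioc 0 t, k s u =
      (∫⁻ s in Ioc 0 u, b s * R s u) * h u := by
    intro u hu
    rw [← lintegral_mul_const _ (haE.fun_mul (hR' u)), ← restrict_Ioo_eq_restrict_Ioc]
    have : (fun s => k s u) = (Iio u).indicator fun s => b s * R s u * h u := by
      ext s
      simp [k, indicator_apply, mul_assoc]
    rw [this, setLIntegral_indicator measurableSet_Iio, ← restrict_Ioo_eq_restrict_Ioc]
    congr 2
    ext s
    simp only [mem_Ioo, mem_inter_iff, mem_Iio]
    exact ⟨fun hs => ⟨hs.2.1, hs.1⟩, fun hs => ⟨hs.2, hs.1, hs.2.trans_le hu.2⟩⟩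
  rw [setLIntegral_congr_fun measurableSet_Ioc e1, lintegral_lintegral_swap hk.aemeasurable,
    setLIntegral_congr_fun measurableSet_Ioc e2]

/-- Along one path, killing at rate `a` is compensated by the potential term with kernel `a`. -/
theorem path_feynmanKac (ha : Measurable a) (h0 : ∀ r, 0 ≤ a r) (hC : ∀ r, a r ≤ C)
    {h : ℝ → ℝ≥0∞} (hh : Measurable h) (e : ℝ≥0∞) {t : ℝ} (ht : 0 ≤ t) :
    (ENNReal.ofReal (Real.exp (-∫ x in (0 : ℝ)..t, a x)) * e +
      ∫⁻ u in Ioc 0 t, ENNReal.ofReal (Real.exp (-∫ x in (0 : ℝ)..u, a x)) * h u) +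
      ∫⁻ s in Ioc 0 t, ENNReal.ofReal (a s) *
        (ENNReal.ofReal (Real.exp (-∫ x in s..t, a x)) * e +
          ∫⁻ u in Ioc s t, ENNReal.ofReal (Real.exp (-∫ x in s..u, a x)) * h u) =
      e + ∫⁻ u in Ioc 0 t, h u := by
  have hR := measurable_exp_neg_integral ha h0 hC
  have hback := fun (u : ℝ) => survival_add_killed_backward (s := 0) (u := u) ha h0 hC
  generalize hRdef : (fun s u => ENNReal.ofReal (Real.exp (-∫ x in s..u, a x))) = R at *
  have hRe : ∀ s u, ENNReal.ofReal (Real.exp (-∫ x in s..u, a x)) = R s u := fun s u => by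
    rw [← hRdef]
  simp only [hRe] at hR hback ⊢
  have hR' : ∀ u, Measurable fun s => R s u := fun u =>
    hR.comp (measurable_id.prodMk measurable_const)
  have hR'' : ∀ s, Measurable fun u => R s u := fun s =>
    hR.comp (measurable_const.prodMk measurable_id)
  have haE : Measurable fun s => ENNReal.ofReal (a s) := ha.ennreal_ofReal
  have hswap := lintegral_triangle_swap haE hh hR t
  have hsum : ∫⁻ s in Ioc 0 t, ENNReal.ofReal (a s) * (R s t * e + ∫⁻ u in Ioc s t, R s u * h u) =
      (∫⁻ s in Ioc 0 t, ENNReal.ofReal (a s) * R s t) * e +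
        ∫⁻ u in Ioc 0 t, (∫⁻ s in Ioc 0 u, ENNReal.ofReal (a s) * R s u) * h u := by
    rw [← hswap, ← lintegral_mul_const _ (haE.fun_mul (hR' t)),
      ← lintegral_add_left ((haE.fun_mul (hR' t)).mul_const e)]
    simp_rw [mul_add, mul_assoc]
  -- For each death time u, the backward balance collapses R 0 u plus the integral of a(s) R s u
  -- over (0,u] to 1.
  have hcol : (∫⁻ u in Ioc 0 t, R 0 u * h u) +
      ∫⁻ u in Ioc 0 t, (∫⁻ s in Ioc 0 u, ENNReal.ofReal (a s) * R s u) * h u =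
      ∫⁻ u in Ioc 0 t, h u := by
    rw [← lintegral_add_left ((hR'' 0).fun_mul hh)]
    refine setLIntegral_congr_fun measurableSet_Ioc fun u hu => ?_
    rw [← add_mul, hback u hu.1.le, one_mul]
  rw [hsum, add_add_add_comm, ← add_mul, hback t ht, one_mul, hcol]

end PathCalculus

/-! ### Laws of branching populations -/

/-- The σ-algebra of the sum is defined by its components, that of its product with A is not. The
inclusions of the components are measurable embeddings, so a preimage is a countable union of
measurable images. -/
theorem measurable_of_measurable_prod_sigma {A B : Type*} {X : ℕ → Type*} [MeasurableSpace A]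
    [MeasurableSpace B] [∀ i, MeasurableSpace (X i)] {f : A × (Σ i, X i) → B}
    (hf : ∀ i, Measurable fun z : A × X i => f (z.1, ⟨i, z.2⟩)) : Measurable f := by
  have hemb : ∀ i, MeasurableEmbedding (Sigma.mk i : X i → Σ i, X i) := fun i =>
    { injective := sigma_mk_injective
      measurable := Measurable.of_le_map (iInf_le _ i)
      measurableSet_image' := by
        intro s hs
        refine MeasurableSpace.measurableSet_iInf.2 fun j => ?_
        change MeasurableSet (Sigma.mk j ⁻¹' (Sigma.mk i '' s))
        by_cases hij : i = j
        · subst hij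
          rwa [preimage_image_eq _ sigma_mk_injective]
        · convert MeasurableSet.empty
          ext x
          simp only [mem_preimage, mem_image, Sigma.mk.inj_iff, mem_empty_iff_false, iff_false]
          rintro ⟨y, _, h, _⟩
          exact hij h }
  intro s hs
  have : f ⁻¹' s = ⋃ i, Prod.map id (Sigma.mk i) ''
      ((fun z : A × X i => f (z.1, ⟨i, z.2⟩)) ⁻¹' s) := by
    ext ⟨a, i, x⟩
    simp only [mem_preimage, mem_iUnion, mem_image, Prod.exists, Prod.map_apply, id]
    constructor
    · exact fun h => ⟨i, a, x, h, rfl⟩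
    · rintro ⟨j, b, y, h, he⟩
      rw [← he]
      exact h
  rw [this]
  exact MeasurableSet.iUnion fun i =>
    (MeasurableEmbedding.id.prodMap (hemb i)).measurableSet_image.2 (hf i hs)

theorem measurable_sum_measure {E : Type*} [MeasurableSpace E] (i : ℕ) :
    Measurable fun η : Fin i → Measure E => ∑ j, η j := by
  refine Measure.measurable_of_measurable_coe _ fun s hs => ?_
  simp only [Measure.finsetSum_apply]
  exact Finset.measurable_fun_sum _ fun j _ => (Measure.measurable_coe hs).comp (measurable_pi_apply j)

section Population

variable {E : Type*} [MeasurableSpace E]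

/-- The law of the sum of the independent populations with laws `Λ r (o_j)` descending from the
individuals `o`. -/
noncomputable def populationLaw (Λ : ℝ≥0 → E → Measure (Measure E)) (r : ℝ≥0)
    (o : Σ i : ℕ, (Fin i → E)) : Measure (Measure E) :=
  (Measure.pi fun j => Λ r (o.2 j)).map fun η => ∑ j, η j

/-- The law of the population which descends from the offspring of an individual dying at `y`. -/
noncomputable def offspringPopulationLaw (F : E → Measure (Σ i : ℕ, (Fin i → E)))
    (Λ : ℝ≥0 → E → Measure (Measure E)) (r : ℝ≥0) (y : E) : Measure (Measure E) :=
  (F y).bind (populationLaw Λ r)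

variable {Λ : ℝ≥0 → E → Measure (Measure E)} [∀ r y, IsFiniteMeasure (Λ r y)]
  {F : Kernel E (Σ i : ℕ, (Fin i → E))}

theorem measurable_populationLaw (hΛ : Measurable fun z : ℝ≥0 × E => Λ z.1 z.2) :
    Measurable fun z : ℝ≥0 × (Σ i : ℕ, (Fin i → E)) => populationLaw Λ z.1 z.2 := by
  refine measurable_of_measurable_prod_sigma fun i => ?_
  refine (Measure.measurable_map _ (measurable_sum_measure i)).comp ?_
  refine measurable_pi_measure
    (μ := fun (z : ℝ≥0 × (Fin i → E)) j => Λ z.1 (z.2 j)) fun j => ?_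
  exact hΛ.comp (measurable_fst.prodMk ((measurable_pi_apply j).comp measurable_snd))

theorem measurable_populationLaw_right (hΛ : Measurable fun z : ℝ≥0 × E => Λ z.1 z.2) (r : ℝ≥0) :
    Measurable (populationLaw Λ r) :=
  (measurable_populationLaw hΛ).comp (measurable_const.prodMk measurable_id)

theorem measurable_offspringPopulationLaw [IsMarkovKernel F]
    (hΛ : Measurable fun z : ℝ≥0 × E => Λ z.1 z.2) :
    Measurable fun z : ℝ≥0 × E => offspringPopulationLaw F Λ z.1 z.2 := by
  have hpop := measurable_populationLaw hΛ
  refine Measure.measurable_of_measurable_coe _ fun s hs => ?_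
  have : ∀ z : ℝ≥0 × E, offspringPopulationLaw F Λ z.1 z.2 s =
      ∫⁻ o, populationLaw Λ z.1 o s ∂(F z.2) := fun z =>
    Measure.bind_apply hs (measurable_populationLaw_right hΛ z.1).aemeasurable
  simp_rw [this]
  refine Measurable.lintegral_kernel_prod_right (κ := F.comap Prod.snd measurable_snd)
    (f := fun z o => populationLaw Λ z.1 o s) ?_
  exact (Measure.measurable_coe hs).comp
    (hpop.comp ((measurable_fst.comp measurable_fst).prodMk measurable_snd))

/-- `m` turns sums of measures into products. -/
structure IsMultiplicative (m : Measure E → ℝ≥0∞) : Prop where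
  measurable : Measurable m
  map_sum : ∀ (i : ℕ) (η : Fin i → Measure E), m (∑ j, η j) = ∏ j, m (η j)

theorem isMultiplicative_one : IsMultiplicative (fun _ : Measure E => 1) :=
  ⟨measurable_const, fun _ _ => by simp⟩

/-- This is the branching property: multiplicativity splits the weight over siblings, and
independence turns the integral of the product into the product of the integrals. -/
theorem lintegral_offspringPopulationLaw (hΛ : Measurable fun z : ℝ≥0 × E => Λ z.1 z.2)
    {m : Measure E → ℝ≥0∞} (hm : IsMultiplicative m) (r : ℝ≥0) (y : E) :
    ∫⁻ ν, m ν ∂(offspringPopulationLaw F Λ r y) =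
      ∫⁻ o, ∏ j, ∫⁻ ν, m ν ∂(Λ r (o.2 j)) ∂(F y) := by
  rw [offspringPopulationLaw, Measure.lintegral_bind
    (measurable_populationLaw_right hΛ r).aemeasurable
    hm.measurable.aemeasurable]
  refine lintegral_congr fun o => ?_
  rw [populationLaw, lintegral_map hm.measurable (measurable_sum_measure _)]
  simp_rw [hm.map_sum]
  exact lintegral_pi_prod _ m hm.measurable

theorem offspringPopulationLaw_mono {Λ' : ℝ≥0 → E → Measure (Measure E)}
    [∀ r y, IsFiniteMeasure (Λ' r y)] (hΛ : Measurable fun z : ℝ≥0 × E => Λ z.1 z.2)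
    (hΛ' : Measurable fun z : ℝ≥0 × E => Λ' z.1 z.2) (h : ∀ r y, Λ r y ≤ Λ' r y) (r : ℝ≥0) (y : E) :
    offspringPopulationLaw F Λ r y ≤ offspringPopulationLaw F Λ' r y := by
  refine Measure.le_iff.2 fun s hs => ?_
  rw [offspringPopulationLaw, offspringPopulationLaw, Measure.bind_apply hs
    (measurable_populationLaw_right hΛ r).aemeasurable,
    Measure.bind_apply hs
    (measurable_populationLaw_right hΛ' r).aemeasurable]
  refine lintegral_mono fun o => ?_
  exact Measure.map_mono (pi_measure_mono fun j => h r (o.2 j)) (measurable_sum_measure _) s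

end Population

/-! ### Decomposition at the first branching. -/

section GenLaw

variable {E Ω : Type*} [MeasurableSpace E] [MeasurableSpace Ω] {ξ : ℝ≥0 → Ω → E}
  {P : Kernel E Ω} {γ : E → ℝ} {C : ℝ}
  {F : Kernel E (Σ i : ℕ, (Fin i → E))} [IsMarkovKernel F]

theorem measurable_survival (hξ : Measurable fun z : ℝ≥0 × Ω => ξ z.1 z.2) (hγ : Measurable γ) :
    Measurable fun z : ℝ × Ω => survival ξ γ z.1 z.2 := by
  have hg : Measurable fun z : ℝ × Ω => γ (ξ z.1.toNNReal z.2) :=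
    hγ.comp (hξ.comp ((measurable_real_toNNReal.comp measurable_fst).prodMk measurable_snd))
  have hI : ∀ S : Set (ℝ × ℝ), MeasurableSet S →
      Measurable fun z : ℝ × Ω => ∫ s, S.indicator (fun _ => γ (ξ s.toNNReal z.2)) (z.1, s) := by
    intro S hS
    refine StronglyMeasurable.measurable (StronglyMeasurable.integral_prod_right
      (f := fun (z : ℝ × Ω) s => S.indicator (fun _ => γ (ξ s.toNNReal z.2)) (z.1, s)) ?_)
    refine Measurable.stronglyMeasurable ?_
    have h1 : MeasurableSet {w : (ℝ × Ω) × ℝ | (w.1.1, w.2) ∈ S} :=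
      ((measurable_fst.comp measurable_fst).prodMk measurable_snd) hS
    have h2 := (hg.comp (measurable_snd.prodMk (measurable_snd.comp measurable_fst) :
      Measurable fun w : (ℝ × Ω) × ℝ => (w.2, w.1.2))).indicator h1
    exact h2
  -- The variable endpoint is moved into an indicator, so that both pieces of the oriented integral
  -- are parameter integrals over the whole line.
  have e : ∀ z : ℝ × Ω, ∫ s in (0 : ℝ)..z.1, γ (ξ s.toNNReal z.2) =
      (∫ s, {w : ℝ × ℝ | 0 < w.2 ∧ w.2 ≤ w.1}.indicator
        (fun _ => γ (ξ s.toNNReal z.2)) (z.1, s)) -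
      ∫ s, {w : ℝ × ℝ | w.1 < w.2 ∧ w.2 ≤ 0}.indicator
        (fun _ => γ (ξ s.toNNReal z.2)) (z.1, s) := by
    intro z
    rw [intervalIntegral, ← integral_indicator measurableSet_Ioc,
      ← integral_indicator measurableSet_Ioc]
    rfl
  unfold survival
  simp_rw [e]
  refine (Measurable.sub (hI _ ?_) (hI _ ?_)).neg.exp.ennreal_ofReal
  · exact (measurableSet_lt measurable_const measurable_snd).inter
      (measurableSet_le measurable_snd measurable_fst)
  · exact (measurableSet_lt measurable_fst measurable_snd).inter
      (measurableSet_le measurable_snd measurable_const)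

theorem measurable_survival_right (hξ : Measurable fun z : ℝ≥0 × Ω => ξ z.1 z.2)
    (hγ : Measurable γ) (t : ℝ) : Measurable (survival ξ γ t) :=
  (measurable_survival hξ hγ).comp (measurable_prodMk_left (x := t))

theorem measurable_path (hξ : Measurable fun z : ℝ≥0 × Ω => ξ z.1 z.2) :
    Measurable fun z : ℝ × Ω => ξ z.1.toNNReal z.2 :=
  hξ.comp ((measurable_real_toNNReal.comp measurable_fst).prodMk measurable_snd)

/-- Integrals over the time of death are measurable in all the parameters. -/
theorem measurable_lintegral_Ioc (hξ : Measurable fun z : ℝ≥0 × Ω => ξ z.1 z.2)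
    {w : ℝ × Ω → ℝ≥0∞} (hw : Measurable w) {h : ℝ≥0 × E → ℝ≥0∞} (hh : Measurable h) :
    Measurable fun z : ℝ≥0 × Ω => ∫⁻ s in Ioc (0 : ℝ) z.1,
      w (s, z.2) * h (z.1 - s.toNNReal, ξ s.toNNReal z.2) := by
  have e : ∀ z : ℝ≥0 × Ω, ∫⁻ s in Ioc (0 : ℝ) z.1,
      w (s, z.2) * h (z.1 - s.toNNReal, ξ s.toNNReal z.2) =
      ∫⁻ s : ℝ, {y : (ℝ≥0 × Ω) × ℝ | 0 < y.2 ∧ y.2 ≤ y.1.1}.indicator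
        (fun y => w (y.2, y.1.2) * h (y.1.1 - y.2.toNNReal, ξ y.2.toNNReal y.1.2)) (z, s) := by
    intro z
    rw [← lintegral_indicator measurableSet_Ioc]
    rfl
  simp_rw [e]
  have hs : Measurable fun y : (ℝ≥0 × Ω) × ℝ => (y.2, y.1.2) :=
    measurable_snd.prodMk (measurable_snd.comp measurable_fst)
  have h1 : Measurable fun y : (ℝ≥0 × Ω) × ℝ =>
      w (y.2, y.1.2) * h (y.1.1 - y.2.toNNReal, ξ y.2.toNNReal y.1.2) := by
    refine (hw.comp hs).mul (hh.comp (Measurable.prodMk ?_ ((measurable_path hξ).comp hs)))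
    exact (measurable_fst.comp measurable_fst).sub (measurable_real_toNNReal.comp measurable_snd)
  refine (h1.indicator ?_).lintegral_prod_right'
  exact (measurableSet_lt measurable_const measurable_snd).inter
    (measurableSet_le measurable_snd
      (measurable_coe_nnreal_real.comp (measurable_fst.comp measurable_fst)))

/-- The law of the population at time `t` which descends from one individual at `x`, when the
populations descending from its offspring have the laws `Λ`. -/
noncomputable def firstBranchLaw (ξ : ℝ≥0 → Ω → E) (P : Kernel E Ω) (γ : E → ℝ)
    (F : E → Measure (Σ i : ℕ, (Fin i → E))) (Λ : ℝ≥0 → E → Measure (Measure E)) (t : ℝ≥0) (x : E) :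
    Measure (Measure E) :=
  ((P x).withDensity (survival ξ γ t)).map (fun ω => Measure.dirac (ξ t ω)) +
    (((P x).prod (volume.restrict (Ioc (0 : ℝ) t))).withDensity
      (fun z => survival ξ γ z.2 z.1 * ENNReal.ofReal (γ (ξ z.2.toNNReal z.1)))).bind
    (fun z => offspringPopulationLaw F Λ (t - z.2.toNNReal) (ξ z.2.toNNReal z.1))

theorem genLaw_succ (F : E → Measure (Σ i : ℕ, (Fin i → E))) (n : ℕ) :
    genLaw ξ P γ F (n + 1) = firstBranchLaw ξ P γ F (genLaw ξ P γ F n) := rfl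

variable {Λ : ℝ≥0 → E → Measure (Measure E)} [∀ r y, IsFiniteMeasure (Λ r y)]

theorem lintegral_firstBranchLaw (hξ : Measurable fun z : ℝ≥0 × Ω => ξ z.1 z.2) (hγ : Measurable γ)
    (hΛ : Measurable fun z : ℝ≥0 × E => Λ z.1 z.2) {m : Measure E → ℝ≥0∞} (hm : Measurable m)
    (t : ℝ≥0) (x : E) :
    ∫⁻ ν, m ν ∂(firstBranchLaw ξ P γ F Λ t x) =
      ∫⁻ ω, (survival ξ γ t ω * m (Measure.dirac (ξ t ω)) +
        ∫⁻ s in Ioc (0 : ℝ) t, survival ξ γ s ω * ENNReal.ofReal (γ (ξ s.toNNReal ω)) *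
          ∫⁻ ν, m ν ∂(offspringPopulationLaw F Λ (t - s.toNNReal)
            (ξ s.toNNReal ω))) ∂(P x) := by
  have hpop := measurable_offspringPopulationLaw (F := F) hΛ
  have hsurv := measurable_survival hξ hγ
  have hξt : Measurable (ξ t) := hξ.comp (measurable_const.prodMk measurable_id)
  have hsurvt : Measurable (survival ξ γ t) := measurable_survival_right hξ hγ _
  have hdens : Measurable fun z : Ω × ℝ =>
      survival ξ γ z.2 z.1 * ENNReal.ofReal (γ (ξ z.2.toNNReal z.1)) :=
    (hsurv.comp measurable_swap).mul
      (hγ.comp ((measurable_path hξ).comp measurable_swap)).ennreal_ofReal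
  have harg : Measurable fun z : Ω × ℝ => (t - z.2.toNNReal, ξ z.2.toNNReal z.1) :=
    (measurable_const.sub (measurable_real_toNNReal.comp measurable_snd)).prodMk
      ((measurable_path hξ).comp measurable_swap)
  have hker : Measurable fun z : Ω × ℝ => offspringPopulationLaw F Λ
      (t - z.2.toNNReal) (ξ z.2.toNNReal z.1) :=
    (hpop.comp harg :)
  have hdirac : Measurable fun ω => Measure.dirac (ξ t ω) :=
    (Measure.measurable_dirac.comp hξt :)
  have hm' : Measurable fun z : Ω × ℝ => ∫⁻ ν, m ν ∂(offspringPopulationLaw F Λ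
      (t - z.2.toNNReal) (ξ z.2.toNNReal z.1)) := ((Measure.measurable_lintegral hm).comp hker :)
  have hmd : Measurable fun ω => m (Measure.dirac (ξ t ω)) := (hm.comp hdirac :)
  have e1 : ∫⁻ ν, m ν ∂(((P x).withDensity (survival ξ γ t)).map
      (fun ω => Measure.dirac (ξ t ω))) =
      ∫⁻ ω, survival ξ γ t ω * m (Measure.dirac (ξ t ω)) ∂(P x) := by
    rw [lintegral_map hm hdirac, lintegral_withDensity_eq_lintegral_mul _ hsurvt hmd]
    rfl
  have e2 : ∫⁻ ν, m ν ∂((((P x).prod (volume.restrict (Ioc (0 : ℝ) t))).withDensity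
        (fun z => survival ξ γ z.2 z.1 * ENNReal.ofReal (γ (ξ z.2.toNNReal z.1)))).bind
      (fun z => offspringPopulationLaw F Λ
        (t - z.2.toNNReal) (ξ z.2.toNNReal z.1))) =
      ∫⁻ ω, (∫⁻ s in Ioc (0 : ℝ) t, survival ξ γ s ω * ENNReal.ofReal (γ (ξ s.toNNReal ω)) *
          ∫⁻ ν, m ν ∂(offspringPopulationLaw F Λ (t - s.toNNReal)
            (ξ s.toNNReal ω))) ∂(P x) := by
    rw [Measure.lintegral_bind hker.aemeasurable hm.aemeasurable,
      lintegral_withDensity_eq_lintegral_mul _ hdens hm',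
      lintegral_prod _ (hdens.mul hm').aemeasurable]
    rfl
  unfold firstBranchLaw
  rw [lintegral_add_measure, e1, e2,
    ← lintegral_add_left (hsurvt.fun_mul hmd)]

end GenLaw

/-! ### Generation laws, their limit and the renewal equation. -/

section ParticleLaw

variable {E Ω : Type*} [MeasurableSpace E] [MeasurableSpace Ω] {ξ : ℝ≥0 → Ω → E}
  {P : Kernel E Ω} {γ : E → ℝ} {C : ℝ}
  {F : Kernel E (Σ i : ℕ, (Fin i → E))} [IsMarkovKernel F]

theorem measurable_rate_path (hξ : Measurable fun z : ℝ≥0 × Ω => ξ z.1 z.2) (hγ : Measurable γ) :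
    Measurable fun z : ℝ × Ω => survival ξ γ z.1 z.2 * ENNReal.ofReal (γ (ξ z.1.toNNReal z.2)) :=
  (measurable_survival hξ hγ).mul (hγ.comp (measurable_path hξ)).ennreal_ofReal

/-- Averages over the time and place of the first branching are measurable in time and place. -/
theorem measurable_lintegral_firstBranch [IsMarkovKernel P]
    (hξ : Measurable fun z : ℝ≥0 × Ω => ξ z.1 z.2)
    (hγ : Measurable γ) {e : E → ℝ≥0∞} (he : Measurable e) {h : ℝ≥0 × E → ℝ≥0∞}
    (hh : Measurable h) :
    Measurable fun z : ℝ≥0 × E => ∫⁻ ω, (survival ξ γ z.1 ω * e (ξ z.1 ω) +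
      ∫⁻ s in Ioc (0 : ℝ) z.1, survival ξ γ s ω * ENNReal.ofReal (γ (ξ s.toNNReal ω)) *
        h (z.1 - s.toNNReal, ξ s.toNNReal ω)) ∂(P z.2) := by
  have h1 := measurable_lintegral_Ioc hξ (measurable_rate_path hξ hγ) hh
  have hcoe : Measurable fun z : ℝ≥0 × Ω => ((z.1 : ℝ), z.2) :=
    (measurable_coe_nnreal_real.comp measurable_fst).prodMk measurable_snd
  have h2 : Measurable fun z : ℝ≥0 × Ω => survival ξ γ z.1 z.2 * e (ξ z.1 z.2) :=
    ((measurable_survival hξ hγ).comp hcoe).mul (he.comp hξ)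
  have h3 := (h2.add h1).comp ((measurable_fst.comp measurable_fst).prodMk measurable_snd :
    Measurable fun z : (ℝ≥0 × E) × Ω => (z.1.1, z.2))
  exact h3.lintegral_kernel_prod_right' (κ := P.comap Prod.snd measurable_snd)

section FirstBranch

variable {Λ : ℝ≥0 → E → Measure (Measure E)} [∀ r y, IsFiniteMeasure (Λ r y)]

theorem firstBranchLaw_apply (hξ : Measurable fun z : ℝ≥0 × Ω => ξ z.1 z.2) (hγ : Measurable γ)
    (hΛ : Measurable fun z : ℝ≥0 × E => Λ z.1 z.2) {S : Set (Measure E)} (hS : MeasurableSet S)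
    (t : ℝ≥0) (x : E) :
    firstBranchLaw ξ P γ F Λ t x S =
      ∫⁻ ω, (survival ξ γ t ω * S.indicator 1 (Measure.dirac (ξ t ω)) +
        ∫⁻ s in Ioc (0 : ℝ) t, survival ξ γ s ω * ENNReal.ofReal (γ (ξ s.toNNReal ω)) *
          offspringPopulationLaw F Λ (t - s.toNNReal) (ξ s.toNNReal ω) S) ∂(P x) := by
  rw [← lintegral_indicator_one hS,
    lintegral_firstBranchLaw hξ hγ hΛ (measurable_one.indicator hS) t x]
  simp_rw [lintegral_indicator_one hS]

theorem measurable_firstBranchLaw [IsMarkovKernel P] (hξ : Measurable fun z : ℝ≥0 × Ω => ξ z.1 z.2)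
    (hγ : Measurable γ) (hΛ : Measurable fun z : ℝ≥0 × E => Λ z.1 z.2) :
    Measurable fun z : ℝ≥0 × E => firstBranchLaw ξ P γ F Λ z.1 z.2 := by
  refine Measure.measurable_of_measurable_coe _ fun S hS => ?_
  simp_rw [firstBranchLaw_apply hξ hγ hΛ hS]
  have he : Measurable fun y : E => S.indicator (1 : Measure E → ℝ≥0∞) (Measure.dirac y) :=
    (measurable_one.indicator hS).comp Measure.measurable_dirac
  have hh : Measurable fun z : ℝ≥0 × E => offspringPopulationLaw F Λ z.1 z.2 S :=
    ((Measure.measurable_coe hS).comp (measurable_offspringPopulationLaw (F := F) hΛ) :)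
  exact measurable_lintegral_firstBranch hξ hγ he hh

theorem firstBranchLaw_mono {Λ' : ℝ≥0 → E → Measure (Measure E)}
    [∀ r y, IsFiniteMeasure (Λ' r y)] (hξ : Measurable fun z : ℝ≥0 × Ω => ξ z.1 z.2)
    (hγ : Measurable γ) (hΛ : Measurable fun z : ℝ≥0 × E => Λ z.1 z.2)
    (hΛ' : Measurable fun z : ℝ≥0 × E => Λ' z.1 z.2) (h : ∀ r y, Λ r y ≤ Λ' r y) (t : ℝ≥0) (x : E) :
    firstBranchLaw ξ P γ F Λ t x ≤ firstBranchLaw ξ P γ F Λ' t x := by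
  refine Measure.le_iff.2 fun S hS => ?_
  rw [firstBranchLaw_apply (F := F) hξ hγ hΛ hS, firstBranchLaw_apply (F := F) hξ hγ hΛ' hS]
  gcongr
  exact offspringPopulationLaw_mono (F := F) hΛ hΛ' h _ _

theorem lintegral_firstBranchLaw_of_isMultiplicative
    (hξ : Measurable fun z : ℝ≥0 × Ω => ξ z.1 z.2) (hγ : Measurable γ)
    (hΛ : Measurable fun z : ℝ≥0 × E => Λ z.1 z.2) {m : Measure E → ℝ≥0∞}
    (hm : IsMultiplicative m) (t : ℝ≥0) (x : E) :
    ∫⁻ ν, m ν ∂(firstBranchLaw ξ P γ F Λ t x) =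
      ∫⁻ ω, (survival ξ γ t ω * m (Measure.dirac (ξ t ω)) +
        ∫⁻ s in Ioc (0 : ℝ) t, survival ξ γ s ω * ENNReal.ofReal (γ (ξ s.toNNReal ω)) *
          ∫⁻ o, ∏ j, ∫⁻ ν, m ν ∂(Λ (t - s.toNNReal) (o.2 j)) ∂(F (ξ s.toNNReal ω))) ∂(P x) := by
  rw [lintegral_firstBranchLaw hξ hγ hΛ hm.measurable t x]
  simp_rw [lintegral_offspringPopulationLaw hΛ hm]

variable [IsMarkovKernel P]

/-- Along each path, survival up to t and death before t have total probability one; total masses at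
most one for the descendants can only decrease this. -/
theorem firstBranchLaw_univ_le (hξ : Measurable fun z : ℝ≥0 × Ω => ξ z.1 z.2) (hγ : Measurable γ)
    (h0 : ∀ x, 0 ≤ γ x) (hC : ∀ x, γ x ≤ C)
    (hΛ : Measurable fun z : ℝ≥0 × E => Λ z.1 z.2) (h1 : ∀ r y, Λ r y univ ≤ 1) (t : ℝ≥0) (x : E) :
    firstBranchLaw ξ P γ F Λ t x univ ≤ 1 := by
  have := lintegral_firstBranchLaw_of_isMultiplicative (P := P) (F := F) hξ hγ hΛ
    isMultiplicative_one t x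
  simp only [lintegral_const, one_mul, mul_one] at this
  rw [this]
  calc _ ≤ ∫⁻ ω, 1 ∂(P x) := lintegral_mono fun ω => ?_
    _ = 1 := by simp
  have hpath : Measurable fun s : ℝ => γ (ξ s.toNNReal ω) :=
    hγ.comp ((measurable_path hξ).comp measurable_prodMk_right)
  have hbal := survival_add_killed (s := 0) (u := t) hpath (fun _ => h0 _) (fun _ => hC _)
    t.coe_nonneg
  rw [← hbal]
  refine add_le_add le_rfl (lintegral_mono fun s => ?_)
  calc _ ≤ survival ξ γ s ω * ENNReal.ofReal (γ (ξ s.toNNReal ω)) * 1 := by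
        gcongr
        calc _ ≤ ∫⁻ o, 1 ∂(F (ξ s.toNNReal ω)) :=
              lintegral_mono fun o => Finset.prod_le_one' fun j _ => h1 _ _
          _ = 1 := by simp
    _ = _ := mul_one _

end FirstBranch

variable [IsMarkovKernel P]

/-- The two claims are proved together, because measurability of one generation uses finiteness of
the laws of the previous one. -/
theorem measurable_genLaw_and_univ_le (hξ : Measurable fun z : ℝ≥0 × Ω => ξ z.1 z.2)
    (hγ : Measurable γ) (h0 : ∀ x, 0 ≤ γ x) (hC : ∀ x, γ x ≤ C) (n : ℕ) :
    (Measurable fun z : ℝ≥0 × E => genLaw ξ P γ F n z.1 z.2) ∧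
      ∀ t x, genLaw ξ P γ F n t x univ ≤ 1 := by
  induction n with
  | zero => exact ⟨measurable_const, fun t x => by simp [genLaw]⟩
  | succ n ih =>
    have : ∀ t x, IsFiniteMeasure (genLaw ξ P γ F n t x) := fun t x =>
      ⟨(ih.2 t x).trans_lt ENNReal.one_lt_top⟩
    rw [genLaw_succ]
    exact ⟨measurable_firstBranchLaw hξ hγ ih.1, firstBranchLaw_univ_le hξ hγ h0 hC ih.1 ih.2⟩

theorem isFiniteMeasure_genLaw (hξ : Measurable fun z : ℝ≥0 × Ω => ξ z.1 z.2)
    (hγ : Measurable γ) (h0 : ∀ x, 0 ≤ γ x) (hC : ∀ x, γ x ≤ C) (n : ℕ) (t : ℝ≥0) (x : E) :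
    IsFiniteMeasure (genLaw ξ P γ F n t x) :=
  ⟨((measurable_genLaw_and_univ_le hξ hγ h0 hC n).2 t x).trans_lt ENNReal.one_lt_top⟩

theorem genLaw_monotone (hξ : Measurable fun z : ℝ≥0 × Ω => ξ z.1 z.2)
    (hγ : Measurable γ) (h0 : ∀ x, 0 ≤ γ x) (hC : ∀ x, γ x ≤ C) (t : ℝ≥0) (x : E) :
    Monotone fun n => genLaw ξ P γ F n t x := by
  have := isFiniteMeasure_genLaw (P := P) (F := F) hξ hγ h0 hC
  have hmeas := fun n => (measurable_genLaw_and_univ_le (P := P) (F := F) hξ hγ h0 hC n).1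
  refine monotone_nat_of_le_succ fun n => ?_
  induction n generalizing t x with
  | zero => exact Measure.zero_le _
  | succ n ih =>
    rw [genLaw_succ, genLaw_succ]
    exact firstBranchLaw_mono hξ hγ (hmeas n) (hmeas (n + 1)) ih t x

theorem lintegral_particleLaw (hξ : Measurable fun z : ℝ≥0 × Ω => ξ z.1 z.2)
    (hγ : Measurable γ) (h0 : ∀ x, 0 ≤ γ x) (hC : ∀ x, γ x ≤ C) (m : Measure E → ℝ≥0∞)
    (t : ℝ≥0) (x : E) :
    ∫⁻ ν, m ν ∂(particleLaw ξ P γ F t x) = ⨆ n, ∫⁻ ν, m ν ∂(genLaw ξ P γ F n t x) := by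
  have := fun n => isFiniteMeasure_genLaw (P := P) (F := F) hξ hγ h0 hC n t x
  exact lintegral_iSup_measure_of_monotone (genLaw_monotone hξ hγ h0 hC t x) m

theorem measurable_lintegral_genLaw (hξ : Measurable fun z : ℝ≥0 × Ω => ξ z.1 z.2)
    (hγ : Measurable γ) (h0 : ∀ x, 0 ≤ γ x) (hC : ∀ x, γ x ≤ C) {m : Measure E → ℝ≥0∞}
    (hm : Measurable m) (n : ℕ) :
    Measurable fun z : ℝ≥0 × E => ∫⁻ ν, m ν ∂(genLaw ξ P γ F n z.1 z.2) :=
  ((Measure.measurable_lintegral hm).comp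
    (measurable_genLaw_and_univ_le (P := P) (F := F) hξ hγ h0 hC n).1 :)

theorem measurable_lintegral_particleLaw (hξ : Measurable fun z : ℝ≥0 × Ω => ξ z.1 z.2)
    (hγ : Measurable γ) (h0 : ∀ x, 0 ≤ γ x) (hC : ∀ x, γ x ≤ C) {m : Measure E → ℝ≥0∞}
    (hm : Measurable m) :
    Measurable fun z : ℝ≥0 × E => ∫⁻ ν, m ν ∂(particleLaw ξ P γ F z.1 z.2) := by
  simp_rw [lintegral_particleLaw hξ hγ h0 hC]
  exact Measurable.iSup fun n => measurable_lintegral_genLaw hξ hγ h0 hC hm n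

theorem lintegral_particleLaw_le_one (hξ : Measurable fun z : ℝ≥0 × Ω => ξ z.1 z.2)
    (hγ : Measurable γ) (h0 : ∀ x, 0 ≤ γ x) (hC : ∀ x, γ x ≤ C) {m : Measure E → ℝ≥0∞}
    (hm : ∀ ν, m ν ≤ 1) (t : ℝ≥0) (x : E) : ∫⁻ ν, m ν ∂(particleLaw ξ P γ F t x) ≤ 1 := by
  rw [lintegral_particleLaw hξ hγ h0 hC]
  refine iSup_le fun n => ?_
  calc _ ≤ ∫⁻ ν, 1 ∂(genLaw ξ P γ F n t x) := lintegral_mono hm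
    _ ≤ 1 := by simpa using (measurable_genLaw_and_univ_le hξ hγ h0 hC n).2 t x

/-- The bound by 1 excludes the discontinuity of multiplication at 0 · ∞. -/
theorem iSup_finset_prod {ι : Type*} {f : ℕ → ι → ℝ≥0∞} (hf : Monotone f) (h1 : ∀ n i, f n i ≤ 1)
    (s : Finset ι) : ⨆ n, ∏ i ∈ s, f n i = ∏ i ∈ s, ⨆ n, f n i := by
  have hlim : Tendsto (fun n => ∏ i ∈ s, f n i) atTop (𝓝 (∏ i ∈ s, ⨆ n, f n i)) := by
    refine ENNReal.tendsto_finsetProd_of_ne_top s (fun i _ => ?_) fun i _ => ?_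
    · exact tendsto_atTop_iSup fun a b hab => hf hab i
    · exact ((iSup_le fun n => h1 n i).trans_lt ENNReal.one_lt_top).ne
  refine tendsto_nhds_unique (tendsto_atTop_iSup fun a b hab => ?_) hlim
  exact Finset.prod_le_prod' fun i _ => hf hab i

theorem measurable_lintegral_prod_offspring {w : ℝ≥0 × E → ℝ≥0∞} (hw : Measurable w) :
    Measurable fun z : ℝ≥0 × E => ∫⁻ o, ∏ j, w (z.1, o.2 j) ∂(F z.2) := by
  have h1 : Measurable fun z : ℝ≥0 × (Σ i : ℕ, (Fin i → E)) => ∏ j, w (z.1, z.2.2 j) := by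
    refine measurable_of_measurable_prod_sigma fun i => ?_
    change Measurable fun z : ℝ≥0 × (Fin i → E) => ∏ j, w (z.1, z.2 j)
    refine Finset.measurable_fun_prod (f := fun j (z : ℝ≥0 × (Fin i → E)) => w (z.1, z.2 j)) _
      fun j _ => ?_
    have h3 : Measurable fun z : ℝ≥0 × (Fin i → E) => (z.1, z.2 j) :=
      measurable_fst.prodMk ((measurable_pi_apply j).comp measurable_snd)
    exact hw.comp h3
  have h2 := h1.comp ((measurable_fst.comp measurable_fst).prodMk measurable_snd :
    Measurable fun z : (ℝ≥0 × E) × (Σ i : ℕ, (Fin i → E)) => (z.1.1, z.2))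
  exact h2.lintegral_kernel_prod_right' (κ := F.comap Prod.snd measurable_snd)

/-- The integral equation obtained by conditioning on the first branching. -/
theorem lintegral_particleLaw_eq (hξ : Measurable fun z : ℝ≥0 × Ω => ξ z.1 z.2)
    (hγ : Measurable γ) (h0 : ∀ x, 0 ≤ γ x) (hC : ∀ x, γ x ≤ C) {m : Measure E → ℝ≥0∞}
    (hm : IsMultiplicative m) (h1 : ∀ ν, m ν ≤ 1) (t : ℝ≥0) (x : E) :
    ∫⁻ ν, m ν ∂(particleLaw ξ P γ F t x) =
      ∫⁻ ω, (survival ξ γ t ω * m (Measure.dirac (ξ t ω)) +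
        ∫⁻ s in Ioc (0 : ℝ) t, survival ξ γ s ω * ENNReal.ofReal (γ (ξ s.toNNReal ω)) *
          ∫⁻ o, ∏ j, ∫⁻ ν, m ν ∂(particleLaw ξ P γ F (t - s.toNNReal) (o.2 j))
            ∂(F (ξ s.toNNReal ω))) ∂(P x) := by
  have := isFiniteMeasure_genLaw (P := P) (F := F) hξ hγ h0 hC
  simp_rw [lintegral_particleLaw hξ hγ h0 hC]
  let w : ℕ → ℝ≥0 × E → ℝ≥0∞ := fun n z => ∫⁻ ν, m ν ∂(genLaw ξ P γ F n z.1 z.2)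
  have hw : ∀ n, Measurable (w n) := fun n =>
    measurable_lintegral_genLaw hξ hγ h0 hC hm.measurable n
  have hmono : Monotone w := fun a b hab z =>
    lintegral_mono' (genLaw_monotone hξ hγ h0 hC z.1 z.2 hab) le_rfl
  have hle : ∀ n z, w n z ≤ 1 := fun n z =>
    calc w n z ≤ ∫⁻ ν, 1 ∂(genLaw ξ P γ F n z.1 z.2) := lintegral_mono h1
      _ ≤ 1 := by simpa using (measurable_genLaw_and_univ_le hξ hγ h0 hC n).2 z.1 z.2
  let h : ℕ → ℝ≥0 × E → ℝ≥0∞ := fun n z => ∫⁻ o, ∏ j, w n (z.1, o.2 j) ∂(F z.2)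
  have hh : ∀ n, Measurable (h n) := fun n => measurable_lintegral_prod_offspring (hw n)
  have hhmono : Monotone h := fun a b hab z =>
    lintegral_mono fun o => Finset.prod_le_prod' fun j _ => hmono hab _
  -- The supremum over generations passes through the finite product and, by monotone convergence,
  -- through the offspring law.
  have hhsup : ∀ (r : ℝ≥0) (y : E), ∫⁻ o, ∏ j, ⨆ n, w n (r, o.2 j) ∂(F y) = ⨆ n, h n (r, y) := by
    intro r y
    have e1 : ∀ o : Σ i : ℕ, (Fin i → E), ∏ j, ⨆ n, w n (r, o.2 j) = ⨆ n, ∏ j, w n (r, o.2 j) :=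
      fun o => (iSup_finset_prod (f := fun n j => w n (r, o.2 j)) (fun a b hab j => hmono hab _)
        (fun n j => hle _ _) _).symm
    simp_rw [e1]
    refine lintegral_iSup (fun n => ?_) fun a b hab o =>
      Finset.prod_le_prod' fun j _ => hmono hab _
    have h1 : Measurable fun z : Unit × (Σ i : ℕ, (Fin i → E)) => ∏ j, w n (r, z.2.2 j) := by
      refine measurable_of_measurable_prod_sigma fun i => ?_
      change Measurable fun z : Unit × (Fin i → E) => ∏ j, w n (r, z.2 j)
      refine Finset.measurable_fun_prod (f := fun j (z : Unit × (Fin i → E)) => w n (r, z.2 j)) _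
        fun j _ => ?_
      have h3 : Measurable fun z : Unit × (Fin i → E) => (r, z.2 j) :=
        measurable_const.prodMk ((measurable_pi_apply j).comp measurable_snd)
      exact (hw n).comp h3
    exact h1.comp (measurable_prodMk_left (x := ()))
  have hrate := measurable_rate_path hξ hγ
  let B : ℕ → Ω → ℝ≥0∞ := fun n ω => ∫⁻ s in Ioc (0 : ℝ) t,
    survival ξ γ s ω * ENNReal.ofReal (γ (ξ s.toNNReal ω)) * h n (t - s.toNNReal, ξ s.toNNReal ω)
  have hB : ∀ n, Measurable (B n) := fun n =>
    ((measurable_lintegral_Ioc hξ hrate (hh n)).comp (measurable_prodMk_left (x := t)) :)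
  have hBmono : Monotone B := fun a b hab ω => lintegral_mono fun s => by
    gcongr
    exact hhmono hab _
  let A : Ω → ℝ≥0∞ := fun ω => survival ξ γ t ω * m (Measure.dirac (ξ t ω))
  have hA : Measurable A := by
    have hξt : Measurable (ξ t) := hξ.comp measurable_prodMk_left
    have h2 : Measurable fun ω => m (Measure.dirac (ξ t ω)) :=
      (hm.measurable.comp (Measure.measurable_dirac.comp hξt) :)
    exact (measurable_survival_right hξ hγ t).mul h2
  have hstep : ∀ n, w (n + 1) (t, x) = ∫⁻ ω, (A ω + B n ω) ∂(P x) := by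
    intro n
    have hn := (measurable_genLaw_and_univ_le (P := P) (F := F) hξ hγ h0 hC n).1
    simp only [w]
    rw [genLaw_succ]
    exact lintegral_firstBranchLaw_of_isMultiplicative hξ hγ hn hm t x
  -- The recursion expresses generation n + 1 through generation n; shifting the index leaves the
  -- supremum unchanged and makes the same limit appear on both sides.
  have hshift : ⨆ n, w n (t, x) = ⨆ n, w (n + 1) (t, x) :=
    (Monotone.iSup_nat_add (f := fun n => w n (t, x)) (fun a b hab => hmono hab _) 1).symm
  have hBsup : ∀ ω, ⨆ n, B n ω = ∫⁻ s in Ioc (0 : ℝ) t,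
      survival ξ γ s ω * ENNReal.ofReal (γ (ξ s.toNNReal ω)) *
        ⨆ n, h n (t - s.toNNReal, ξ s.toNNReal ω) := by
    intro ω
    simp only [B]
    rw [← lintegral_iSup]
    · simp_rw [ENNReal.mul_iSup]
    · intro n
      have h3 : Measurable fun s : ℝ => (s, ω) := measurable_prodMk_right
      have h4 : Measurable fun s : ℝ => (t - s.toNNReal, ξ s.toNNReal ω) :=
        (measurable_const.sub measurable_real_toNNReal).prodMk ((measurable_path hξ).comp h3 :)
      exact (hrate.comp h3).mul ((hh n).comp h4)
    · intro a b hab s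
      dsimp only
      gcongr
      exact hhmono hab _
  change ⨆ n, w n (t, x) = _
  rw [hshift]
  simp_rw [hstep]
  rw [← lintegral_iSup (fun n => hA.fun_add (hB n)) fun a b hab ω => add_le_add le_rfl (hBmono hab ω)]
  refine lintegral_congr fun ω => ?_
  rw [← ENNReal.add_iSup, hBsup]
  refine congrArg (A ω + ·) (lintegral_congr fun s => ?_)
  rw [← hhsup]

theorem isMultiplicative_indicator_finite :
    IsMultiplicative ({ν : Measure E | ν univ < ∞}.indicator 1) := by
  constructor
  · exact measurable_one.indicator
      (measurableSet_lt (Measure.measurable_coe MeasurableSet.univ) measurable_const)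
  · intro i η
    by_cases h : ∀ j, η j univ < ∞
    · have : (∑ j, η j) univ < ∞ := by
        rw [Measure.finsetSum_apply]
        exact ENNReal.sum_lt_top.2 fun j _ => h j
      rw [indicator_of_mem (s := {ν : Measure E | ν univ < ∞}) this, Finset.prod_eq_one fun j _ => ?_]
      · rfl
      · exact indicator_of_mem (s := {ν : Measure E | ν univ < ∞}) (h j) _
    · have : ¬ (∑ j, η j) univ < ∞ := by
        rw [Measure.finsetSum_apply, ENNReal.sum_lt_top]
        simpa using h
      rw [indicator_of_notMem (s := {ν : Measure E | ν univ < ∞}) this]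
      push Not at h
      obtain ⟨j, hj⟩ := h
      exact (Finset.prod_eq_zero (Finset.mem_univ j)
        (indicator_of_notMem (s := {ν : Measure E | ν univ < ∞}) (by simpa using hj) _)).symm

/-- Populations are finite. -/
theorem ae_particleLaw_finite (hξ : Measurable fun z : ℝ≥0 × Ω => ξ z.1 z.2)
    (hγ : Measurable γ) (h0 : ∀ x, 0 ≤ γ x) (hC : ∀ x, γ x ≤ C) (t : ℝ≥0) (x : E) :
    ∀ᵐ ν ∂(particleLaw ξ P γ F t x), ν univ < ∞ := by
  have := isFiniteMeasure_genLaw (P := P) (F := F) hξ hγ h0 hC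
  set S : Set (Measure E) := {ν | ν univ < ∞}
  have hS : MeasurableSet S :=
    measurableSet_lt (Measure.measurable_coe MeasurableSet.univ) measurable_const
  -- The mass on finite measures and the total mass obey the same recursion: the constant 1 and the
  -- indicator of finiteness are both multiplicative, and they agree on Dirac masses.
  have hmass : ∀ n t x, genLaw ξ P γ F n t x S = genLaw ξ P γ F n t x univ := by
    intro n
    induction n with
    | zero => intro t x; simp [genLaw]
    | succ n ih =>
      intro t x
      have hn := (measurable_genLaw_and_univ_le (P := P) (F := F) hξ hγ h0 hC n).1
      have e1 := lintegral_firstBranchLaw_of_isMultiplicative (P := P) (F := F) hξ hγ hn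
        isMultiplicative_one t x
      have e2 := lintegral_firstBranchLaw_of_isMultiplicative (P := P) (F := F) hξ hγ hn
        isMultiplicative_indicator_finite t x
      have e3 : ∀ y : E, S.indicator (1 : Measure E → ℝ≥0∞) (Measure.dirac y) = 1 := fun y =>
        indicator_of_mem (by simp [S]) _
      simp only [lintegral_const, one_mul] at e1
      simp only [lintegral_indicator_one hS, S, ← ih] at e1 e2 e3
      simp only [e3] at e2
      rw [genLaw_succ, e1, ← e2]
  have hnull : ∀ n, genLaw ξ P γ F n t x Sᶜ = 0 := fun n => by
    rw [measure_compl hS (measure_ne_top _ _), hmass, tsub_self]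
  rw [ae_iff]
  change particleLaw ξ P γ F t x Sᶜ = 0
  rw [← lintegral_indicator_one hS.compl, lintegral_particleLaw hξ hγ h0 hC]
  simp_rw [lintegral_indicator_one hS.compl, hnull]
  simp

end ParticleLaw

/-! ### The Markov property on the space of right continuous paths -/

/-- The space of right continuous paths. -/
abbrev RCPath (E : Type*) [TopologicalSpace E] : Type _ :=
  {c : ℝ≥0 → E // ∀ t, ContinuousWithinAt c (Ici t) t}

section Path

variable {E : Type*} [TopologicalSpace E]

/-- The coordinate process. -/
def RCPath.eval (s : ℝ≥0) (c : RCPath E) : E := c.1 s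

/-- The path after time `s`. -/
def RCPath.shift (s : ℝ≥0) (c : RCPath E) : RCPath E :=
  ⟨fun r => c.1 (s + r), fun t => by
    refine ContinuousWithinAt.comp (t := Ici (s + t)) (c.2 (s + t)) ?_ ?_
    · exact (continuous_const.add continuous_id).continuousWithinAt
    · exact fun r hr => by simpa using mem_Ici.1 hr⟩

/-- Killed at rate `γ`, a path `c` earns `H` when it is killed and `e` at the terminal time. -/
noncomputable def killedPayoff (γ : E → ℝ) (e : E → ℝ≥0∞) (H : ℝ≥0 × E → ℝ≥0∞) (t : ℝ≥0)
    (c : RCPath E) : ℝ≥0∞ :=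
  survival RCPath.eval γ t c * e (c.eval t) +
    ∫⁻ s in Ioc (0 : ℝ) t, survival RCPath.eval γ s c * H (t - s.toNNReal, c.eval s.toNNReal)

variable {γ : E → ℝ} {C : ℝ} {e : E → ℝ≥0∞} {H : ℝ≥0 × E → ℝ≥0∞}

/-- Translation of time by s: the survival factors then start at s and refer to the original path,
which is the form required by `path_feynmanKac`. -/
theorem killedPayoff_shift {s t : ℝ≥0} (hst : s ≤ t) (c : RCPath E) :
    killedPayoff γ e H (t - s) (c.shift s) =
      ENNReal.ofReal (Real.exp (-∫ x in (s : ℝ)..t, γ (c.eval x.toNNReal))) * e (c.eval t) +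
        ∫⁻ u in Ioc (s : ℝ) t,
          ENNReal.ofReal (Real.exp (-∫ x in (s : ℝ)..u, γ (c.eval x.toNNReal))) *
            H (t - u.toNNReal, c.eval u.toNNReal) := by
  have hsurv : ∀ r : ℝ, 0 ≤ r → survival RCPath.eval γ r (c.shift s) =
      ENNReal.ofReal (Real.exp (-∫ x in (s : ℝ)..(s + r), γ (c.eval x.toNNReal))) := by
    intro r hr
    have : ∫ x in (0 : ℝ)..r, γ ((c.shift s).eval x.toNNReal) =
        ∫ x in (s : ℝ)..(s + r), γ (c.eval x.toNNReal) := by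
      have h1 := intervalIntegral.integral_comp_add_left (a := 0) (b := r)
        (fun x => γ (c.eval x.toNNReal)) (s : ℝ)
      rw [add_zero] at h1
      rw [← h1]
      refine intervalIntegral.integral_congr fun x hx => ?_
      rw [uIcc_of_le hr] at hx
      simp only [RCPath.eval, RCPath.shift]
      rw [Real.toNNReal_add s.coe_nonneg hx.1, Real.toNNReal_coe]
    rw [survival, this]
  have hts : ((t - s : ℝ≥0) : ℝ) = t - s := NNReal.coe_sub hst
  unfold killedPayoff
  rw [hsurv _ (NNReal.coe_nonneg _), hts, add_sub_cancel]
  congr 1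
  · simp only [RCPath.eval, RCPath.shift]
    rw [add_tsub_cancel_of_le hst]
  · let g : ℝ → ℝ≥0∞ := (Ioc (s : ℝ) t).indicator fun u =>
      ENNReal.ofReal (Real.exp (-∫ x in (s : ℝ)..u, γ (c.eval x.toNNReal))) *
        H (t - u.toNNReal, c.eval u.toNNReal)
    rw [← lintegral_indicator measurableSet_Ioc, ← lintegral_indicator measurableSet_Ioc]
    change _ = ∫⁻ u, g u
    rw [← lintegral_add_left_eq_self g (s : ℝ)]
    refine lintegral_congr fun r => ?_
    by_cases hr : r ∈ Ioc (0 : ℝ) (t - s)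
    · have hr' : (s : ℝ) + r ∈ Ioc (s : ℝ) t := ⟨by linarith [hr.1], by linarith [hr.2]⟩
      simp only [g]
      rw [indicator_of_mem hr, indicator_of_mem hr', hsurv r hr.1.le,
        Real.toNNReal_add s.coe_nonneg hr.1.le, Real.toNNReal_coe, tsub_add_eq_tsub_tsub]
      rfl
    · have hr' : (s : ℝ) + r ∉ Ioc (s : ℝ) t := fun h =>
        hr ⟨by linarith [h.1], by linarith [h.2]⟩
      simp only [g]
      rw [indicator_of_notMem hr, indicator_of_notMem hr']

variable [MeasurableSpace E]

theorem RCPath.measurable_eval (s : ℝ≥0) : Measurable (RCPath.eval s : RCPath E → E) :=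
  (measurable_pi_apply s).comp measurable_subtype_coe

theorem RCPath.measurable_uncurry_eval [TopologicalSpace.PseudoMetrizableSpace E] [BorelSpace E] :
    Measurable fun z : ℝ≥0 × RCPath E => RCPath.eval z.1 z.2 :=
  measurable_uncurry_of_rightCont RCPath.measurable_eval fun c t => c.2 t

theorem RCPath.measurable_shift [TopologicalSpace.PseudoMetrizableSpace E] [BorelSpace E] :
    Measurable fun z : ℝ≥0 × RCPath E => RCPath.shift z.1 z.2 := by
  refine Measurable.subtype_mk (measurable_pi_iff.2 fun r => ?_)
  have h : Measurable fun z : ℝ≥0 × RCPath E => (z.1 + r, z.2) :=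
    (measurable_fst.add_const r).prodMk measurable_snd
  exact (RCPath.measurable_uncurry_eval.comp h :)

variable [TopologicalSpace.PseudoMetrizableSpace E] [BorelSpace E]

theorem measurable_killedPayoff (hγ : Measurable γ) (he : Measurable e) (hH : Measurable H) :
    Measurable fun z : ℝ≥0 × RCPath E => killedPayoff γ e H z.1 z.2 := by
  have hX := RCPath.measurable_uncurry_eval (E := E)
  have hcoe : Measurable fun z : ℝ≥0 × RCPath E => ((z.1 : ℝ), z.2) :=
    (measurable_coe_nnreal_real.comp measurable_fst).prodMk measurable_snd
  have h1 : Measurable fun z : ℝ≥0 × RCPath E => survival RCPath.eval γ z.1 z.2 :=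
    ((measurable_survival hX hγ).comp hcoe :)
  exact (h1.mul (he.comp hX)).add (measurable_lintegral_Ioc hX (measurable_survival hX hγ) hH)

/-- Pathwise form of the exchange of killing for a potential term; no probability is involved until
the payoff of the shifted path is averaged by the Markov property. -/
theorem killedPayoff_add (hγ : Measurable γ) (h0 : ∀ x, 0 ≤ γ x) (hC : ∀ x, γ x ≤ C)
    (hH : Measurable H) (t : ℝ≥0) (c : RCPath E) :
    killedPayoff γ e H t c + ∫⁻ s in Ioc (0 : ℝ) t, ENNReal.ofReal (γ (c.eval s.toNNReal)) *
        killedPayoff γ e H (t - s.toNNReal) (c.shift s.toNNReal) =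
      e (c.eval t) + ∫⁻ s in Ioc (0 : ℝ) t, H (t - s.toNNReal, c.eval s.toNNReal) := by
  have hc : Measurable fun s : ℝ => c.eval s.toNNReal :=
    ((measurable_path RCPath.measurable_uncurry_eval).comp (measurable_prodMk_right (y := c)) :)
  have hh : Measurable fun s : ℝ => H (t - s.toNNReal, c.eval s.toNNReal) :=
    hH.comp ((measurable_const.sub measurable_real_toNNReal).prodMk hc)
  have key := path_feynmanKac (hγ.comp hc) (fun _ => h0 _) (fun _ => hC _) hh (e (c.eval t))
    t.coe_nonneg
  rw [← key]
  refine congrArg (killedPayoff γ e H t c + ·)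
    (setLIntegral_congr_fun measurableSet_Ioc fun s hs => ?_)
  have hst : s.toNNReal ≤ t := Real.toNNReal_le_iff_le_coe.2 hs.2
  rw [killedPayoff_shift hst c, Real.coe_toNNReal s hs.1.le]
  rfl

end Path

/-! ### Averaging the pathwise identity by the Markov property. -/

section Markov

variable {E Ω : Type*} [TopologicalSpace E] [MeasurableSpace E]
  {mΩ : MeasurableSpace Ω} {𝓕 : Filtration ℝ≥0 mΩ} {ξ : ℝ≥0 → Ω → E} {P : Kernel E Ω}

/-- The path of a right continuous process. -/
def IsRightContStrongMarkov.path (hξ : IsRightContStrongMarkov 𝓕 ξ P) (ω : Ω) : RCPath E :=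
  ⟨fun s => ξ s ω, hξ.rightCont ω⟩

theorem IsRightContStrongMarkov.measurable_coord (hξ : IsRightContStrongMarkov 𝓕 ξ P) (t : ℝ≥0) :
    Measurable (ξ t) := (hξ.adapted t).mono (𝓕.le t) le_rfl

theorem IsRightContStrongMarkov.measurable_path (hξ : IsRightContStrongMarkov 𝓕 ξ P) :
    Measurable hξ.path :=
  Measurable.subtype_mk (measurable_pi_iff.2 hξ.measurable_coord)

variable [TopologicalSpace.PseudoMetrizableSpace E] [BorelSpace E]

theorem IsRightContStrongMarkov.measurable_uncurry (hξ : IsRightContStrongMarkov 𝓕 ξ P) :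
    Measurable fun z : ℝ≥0 × Ω => ξ z.1 z.2 :=
  measurable_uncurry_of_rightCont hξ.measurable_coord hξ.rightCont

/-- The Markov property. -/
theorem IsRightContStrongMarkov.lintegral_shift (hξ : IsRightContStrongMarkov 𝓕 ξ P) (s : ℝ≥0)
    {Φ : RCPath E → ℝ≥0∞} (hΦ : Measurable Φ) (x : E) :
    ∫⁻ ω, Φ ((hξ.path ω).shift s) ∂(P x) =
      ∫⁻ ω, ∫⁻ ω', Φ (hξ.path ω') ∂(P (ξ s ω)) ∂(P x) := by
  have hshift : Measurable fun ω => (hξ.path ω).shift s :=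
    (RCPath.measurable_shift.comp (measurable_const.prodMk hξ.measurable_path) :)
  have hker : Measurable fun ω => (P (ξ s ω)).map hξ.path :=
    ((Measure.measurable_map _ hξ.measurable_path).comp (P.measurable.comp (hξ.measurable_coord s)) :)
  have hlaw : (P x).map (fun ω => (hξ.path ω).shift s) =
      (P x).bind fun ω => (P (ξ s ω)).map hξ.path := by
    ext S hS
    -- Measurable sets of right continuous paths are traces of sets of the product σ-algebra, and
    -- for those the Markov property is assumed; the constant time s serves as stopping time.
    -- Passing to the subspace is what makes time integrals along the path measurable.
    obtain ⟨C, hC, rfl⟩ := hS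
    have hm := hξ.strongMarkov (fun _ => (s : WithTop ℝ≥0)) (isStoppingTime_const 𝓕 s) univ
      MeasurableSet.univ (fun _ _ => WithTop.coe_ne_top) C hC x
    simp only [mem_univ, true_and, WithTop.untopD_coe, Measure.restrict_univ] at hm
    rw [Measure.map_apply hshift (measurable_subtype_coe hC),
      Measure.bind_apply (measurable_subtype_coe hC) hker.aemeasurable]
    simp_rw [Measure.map_apply hξ.measurable_path (measurable_subtype_coe hC)]
    exact hm
  rw [← lintegral_map hΦ hshift, hlaw, Measure.lintegral_bind hker.aemeasurable hΦ.aemeasurable]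
  simp_rw [lintegral_map hΦ hξ.measurable_path]

variable {γ : E → ℝ} {C : ℝ} {e : E → ℝ≥0∞} {H : ℝ≥0 × E → ℝ≥0∞} {W : ℝ≥0 × E → ℝ≥0∞}

/-- An equation with killing is turned into one with a potential term. -/
theorem IsRightContStrongMarkov.feynmanKac (hξ : IsRightContStrongMarkov 𝓕 ξ P)
    (hγ : Measurable γ) (h0 : ∀ x, 0 ≤ γ x) (hC : ∀ x, γ x ≤ C) (he : Measurable e)
    (hH : Measurable H)
    (hW : ∀ t x, W (t, x) = ∫⁻ ω, (survival ξ γ t ω * e (ξ t ω) +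
      ∫⁻ s in Ioc (0 : ℝ) t, survival ξ γ s ω * H (t - s.toNNReal, ξ s.toNNReal ω)) ∂(P x))
    (t : ℝ≥0) (x : E) :
    W (t, x) + ∫⁻ s in Ioc (0 : ℝ) t, ∫⁻ ω, ENNReal.ofReal (γ (ξ s.toNNReal ω)) *
        W (t - s.toNNReal, ξ s.toNNReal ω) ∂(P x) =
      ∫⁻ ω, e (ξ t ω) ∂(P x) +
        ∫⁻ s in Ioc (0 : ℝ) t, ∫⁻ ω, H (t - s.toNNReal, ξ s.toNNReal ω) ∂(P x) := by
  have := hξ.isMarkovKernel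
  have hξm := hξ.measurable_uncurry
  have hpay := measurable_killedPayoff hγ he hH
  have hW' : ∀ t x, W (t, x) = ∫⁻ ω, killedPayoff γ e H t (hξ.path ω) ∂(P x) := hW
  have hmarkov : ∀ s : ℝ≥0, ∫⁻ ω, ENNReal.ofReal (γ (ξ s ω)) * W (t - s, ξ s ω) ∂(P x) =
      ∫⁻ ω, ENNReal.ofReal (γ (ξ s ω)) *
        killedPayoff γ e H (t - s) ((hξ.path ω).shift s) ∂(P x) := by
    intro s
    -- The factor γ(ξ_s) is carried inside the path functional as γ(c(0)). After the Markov
    -- property, the initial condition ξ_0 = ξ_s(ω) makes it constant again.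
    have hΦ : Measurable fun c : RCPath E =>
        ENNReal.ofReal (γ (c.eval 0)) * killedPayoff γ e H (t - s) c :=
      (hγ.comp (RCPath.measurable_eval 0)).ennreal_ofReal.mul
        (hpay.comp (measurable_prodMk_left (x := t - s)) :)
    have h1 := hξ.lintegral_shift s hΦ x
    have h2 : ∀ ω, ENNReal.ofReal (γ (((hξ.path ω).shift s).eval 0)) =
        ENNReal.ofReal (γ (ξ s ω)) := fun ω => by
      simp [RCPath.eval, RCPath.shift, IsRightContStrongMarkov.path]
    simp_rw [h2] at h1
    rw [h1]
    refine lintegral_congr fun ω => ?_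
    rw [hW', ← lintegral_const_mul]
    · refine lintegral_congr_ae ?_
      filter_upwards [hξ.start (ξ s ω)] with ω' hω'
      change _ = ENNReal.ofReal (γ (ξ 0 ω')) * _
      rw [hω']
    · exact ((hpay.comp (measurable_prodMk_left (x := t - s))).comp hξ.measurable_path :)
  have hpathm : Measurable fun z : ℝ × Ω => ξ z.1.toNNReal z.2 := NonlocalBranching.measurable_path hξm
  have hsub : Measurable fun z : ℝ × Ω => t - z.1.toNNReal :=
    measurable_const.sub (measurable_real_toNNReal.comp measurable_fst)
  have hshift : Measurable fun z : ℝ × Ω => (hξ.path z.2).shift z.1.toNNReal :=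
    (RCPath.measurable_shift.comp ((measurable_real_toNNReal.comp measurable_fst).prodMk
      (hξ.measurable_path.comp measurable_snd)) :)
  have hjoint : Measurable fun z : ℝ × Ω => ENNReal.ofReal (γ (ξ z.1.toNNReal z.2)) *
      killedPayoff γ e H (t - z.1.toNNReal) ((hξ.path z.2).shift z.1.toNNReal) :=
    (hγ.comp hpathm).ennreal_ofReal.mul (hpay.comp (hsub.prodMk hshift) :)
  have hHj : Measurable fun z : ℝ × Ω => H (t - z.1.toNNReal, ξ z.1.toNNReal z.2) :=
    (hH.comp (hsub.prodMk hpathm) :)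
  have hξt : Measurable (ξ t) := hξ.measurable_coord t
  have hpt : Measurable fun ω => killedPayoff γ e H t (hξ.path ω) :=
    ((hpay.comp (measurable_prodMk_left (x := t))).comp hξ.measurable_path :)
  have het : Measurable fun ω => e (ξ t ω) := he.comp hξt
  simp_rw [hmarkov]
  rw [lintegral_lintegral_swap (f := fun (s : ℝ) ω => ENNReal.ofReal (γ (ξ s.toNNReal ω)) *
      killedPayoff γ e H (t - s.toNNReal) ((hξ.path ω).shift s.toNNReal)) hjoint.aemeasurable,
    lintegral_lintegral_swap (f := fun (s : ℝ) ω => H (t - s.toNNReal, ξ s.toNNReal ω))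
      hHj.aemeasurable, hW',
    ← lintegral_add_left hpt, ← lintegral_add_left het]
  exact lintegral_congr fun ω => killedPayoff_add hγ h0 hC hH t (hξ.path ω)

end Markov

/-! ### The potential of a time dependent source -/

section Potential

variable {E Ω : Type*} [MeasurableSpace E] [MeasurableSpace Ω] {ξ : ℝ≥0 → Ω → E} {P : Kernel E Ω}

/-- `∫_0^t P_s R_{t-s} (x) ds`. -/
noncomputable def potential (ξ : ℝ≥0 → Ω → E) (P : Kernel E Ω) (R : ℝ≥0 → E → ℝ) (t : ℝ≥0) (x : E) :
    ℝ :=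
  ∫ s in (0 : ℝ)..t, ∫ y, R (t - s.toNNReal) y ∂(transition ξ P s.toNNReal x)

variable {R R' : ℝ≥0 → E → ℝ} {K K' : ℝ} {t : ℝ≥0} {x : E}

theorem measurable_section (hR : Measurable fun z : ℝ≥0 × E => R z.1 z.2) (r : ℝ≥0) :
    Measurable (R r) := hR.comp (measurable_prodMk_left (x := r))

theorem integrable_of_abs_le {X : Type*} [MeasurableSpace X] {μ : Measure X} [IsFiniteMeasure μ]
    {f : X → ℝ} (hf : Measurable f) (hK : ∀ y, |f y| ≤ K) : Integrable f μ :=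
  Integrable.of_bound hf.aestronglyMeasurable K (Eventually.of_forall hK)

theorem abs_integral_le_of_abs_le {X : Type*} [MeasurableSpace X] {μ : Measure X}
    [IsProbabilityMeasure μ] {f : X → ℝ} (hK : ∀ y, |f y| ≤ K) : |∫ y, f y ∂μ| ≤ K := by
  simpa using norm_integral_le_of_norm_le_const (μ := μ) (f := f) (C := K)
    (Eventually.of_forall hK)

theorem integral_transition (hξ : Measurable fun z : ℝ≥0 × Ω => ξ z.1 z.2) {f : E → ℝ}
    (hf : Measurable f) (t : ℝ≥0) (x : E) :
    ∫ y, f y ∂(transition ξ P t x) = ∫ ω, f (ξ t ω) ∂(P x) :=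
  integral_map (hξ.comp (measurable_prodMk_left (x := t)) :).aemeasurable hf.aestronglyMeasurable

theorem potential_const_mul (c : ℝ) :
    potential ξ P (fun r y => c * R r y) t x = c * potential ξ P R t x := by
  unfold potential
  simp_rw [integral_const_mul]
  exact intervalIntegral.integral_const_mul _ _

variable [IsMarkovKernel P]

theorem isProbabilityMeasure_transition (hξ : Measurable fun z : ℝ≥0 × Ω => ξ z.1 z.2) (t : ℝ≥0)
    (x : E) : IsProbabilityMeasure (transition ξ P t x) :=
  Measure.isProbabilityMeasure_map (hξ.comp (measurable_prodMk_left (x := t)) :).aemeasurable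

theorem measurable_integral_transition (hξ : Measurable fun z : ℝ≥0 × Ω => ξ z.1 z.2)
    (hR : Measurable fun z : ℝ≥0 × E => R z.1 z.2) (t : ℝ≥0) (x : E) :
    Measurable fun s : ℝ => ∫ y, R (t - s.toNNReal) y ∂(transition ξ P s.toNNReal x) := by
  have e : ∀ s : ℝ, ∫ y, R (t - s.toNNReal) y ∂(transition ξ P s.toNNReal x) =
      ∫ ω, R (t - s.toNNReal) (ξ s.toNNReal ω) ∂(P x) := fun s =>
    integral_transition hξ (measurable_section hR _) _ _
  simp_rw [e]
  have h : Measurable fun z : ℝ × Ω => R (t - z.1.toNNReal) (ξ z.1.toNNReal z.2) :=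
    (hR.comp ((measurable_const.sub (measurable_real_toNNReal.comp measurable_fst)).prodMk
      (measurable_path hξ)) :)
  exact h.stronglyMeasurable.integral_prod_right'.measurable

theorem abs_integral_transition_le (hξ : Measurable fun z : ℝ≥0 × Ω => ξ z.1 z.2)
    {f : E → ℝ} (hK : ∀ y, |f y| ≤ K) : |∫ y, f y ∂(transition ξ P t x)| ≤ K := by
  have := isProbabilityMeasure_transition (P := P) hξ t x
  exact abs_integral_le_of_abs_le hK

theorem intervalIntegrable_transition (hξ : Measurable fun z : ℝ≥0 × Ω => ξ z.1 z.2)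
    (hR : Measurable fun z : ℝ≥0 × E => R z.1 z.2) (hK : ∀ r ≤ t, ∀ y, |R r y| ≤ K) :
    IntervalIntegrable
      (fun s : ℝ => ∫ y, R (t - s.toNNReal) y ∂(transition ξ P s.toNNReal x)) volume 0 t := by
  rw [intervalIntegrable_iff]
  refine Measure.integrableOn_of_bounded (M := K) (by simp)
    (measurable_integral_transition hξ hR t x).aestronglyMeasurable ?_
  exact Eventually.of_forall fun s => abs_integral_transition_le hξ fun y =>
    hK _ tsub_le_self y

theorem integrable_transition (hξ : Measurable fun z : ℝ≥0 × Ω => ξ z.1 z.2)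
    (hR : Measurable fun z : ℝ≥0 × E => R z.1 z.2) (hK : ∀ r ≤ t, ∀ y, |R r y| ≤ K) {r : ℝ≥0}
    (hr : r ≤ t) (s : ℝ≥0) : Integrable (R r) (transition ξ P s x) := by
  have := isProbabilityMeasure_transition (P := P) hξ s x
  exact integrable_of_abs_le (measurable_section hR r) (hK r hr)

theorem potential_add (hξ : Measurable fun z : ℝ≥0 × Ω => ξ z.1 z.2)
    (hR : Measurable fun z : ℝ≥0 × E => R z.1 z.2) (hR' : Measurable fun z : ℝ≥0 × E => R' z.1 z.2)
    (hK : ∀ r ≤ t, ∀ y, |R r y| ≤ K) (hK' : ∀ r ≤ t, ∀ y, |R' r y| ≤ K') :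
    potential ξ P (fun r y => R r y + R' r y) t x = potential ξ P R t x + potential ξ P R' t x := by
  unfold potential
  rw [← intervalIntegral.integral_add (intervalIntegrable_transition hξ hR hK)
    (intervalIntegrable_transition hξ hR' hK')]
  refine intervalIntegral.integral_congr fun s _ => ?_
  exact integral_add (integrable_transition hξ hR hK tsub_le_self _)
    (integrable_transition hξ hR' hK' tsub_le_self _)

theorem potential_sub (hξ : Measurable fun z : ℝ≥0 × Ω => ξ z.1 z.2)
    (hR : Measurable fun z : ℝ≥0 × E => R z.1 z.2) (hR' : Measurable fun z : ℝ≥0 × E => R' z.1 z.2)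
    (hK : ∀ r ≤ t, ∀ y, |R r y| ≤ K) (hK' : ∀ r ≤ t, ∀ y, |R' r y| ≤ K') :
    potential ξ P (fun r y => R r y - R' r y) t x = potential ξ P R t x - potential ξ P R' t x := by
  have h := potential_add (P := P) (x := x) (R' := fun r y => (-1) * R' r y) (K' := K') hξ hR
    (hR'.const_mul _) hK (by simpa using hK')
  rw [potential_const_mul] at h
  simpa [sub_eq_add_neg] using h

/-- A source dominated by a function of time. -/
theorem potential_le_integral (hξ : Measurable fun z : ℝ≥0 × Ω => ξ z.1 z.2)
    (hR : Measurable fun z : ℝ≥0 × E => R z.1 z.2) (hK : ∀ r ≤ t, ∀ y, |R r y| ≤ K) {b : ℝ → ℝ}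
    (hb : Continuous b) (hRb : ∀ r ≤ t, ∀ y, R r y ≤ b r) :
    potential ξ P R t x ≤ ∫ s in (0 : ℝ)..t, b (t - s) := by
  refine intervalIntegral.integral_mono_on t.coe_nonneg (intervalIntegrable_transition hξ hR hK)
    ((hb.comp (continuous_const.sub continuous_id)).intervalIntegrable _ _) fun s hs => ?_
  have hst : s.toNNReal ≤ t := Real.toNNReal_le_iff_le_coe.2 hs.2
  have := isProbabilityMeasure_transition (P := P) hξ s.toNNReal x
  calc _ ≤ ∫ y, b (t - s) ∂(transition ξ P s.toNNReal x) := by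
        refine integral_mono (integrable_transition hξ hR hK tsub_le_self _)
          (integrable_const _) fun y => ?_
        have := hRb (t - s.toNNReal) tsub_le_self y
        rwa [NNReal.coe_sub hst, Real.coe_toNNReal s hs.1] at this
    _ = b (t - s) := by simp

theorem abs_potential_le (hξ : Measurable fun z : ℝ≥0 × Ω => ξ z.1 z.2)
    (hR : Measurable fun z : ℝ≥0 × E => R z.1 z.2) (hK : ∀ r ≤ t, ∀ y, |R r y| ≤ K) :
    |potential ξ P R t x| ≤ t * K := by
  have h1 := potential_le_integral (P := P) (x := x) hξ hR hK (b := fun _ => K) continuous_const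
    fun r hr y => (le_abs_self _).trans (hK r hr y)
  have h2 := potential_le_integral (P := P) (x := x) (R := fun r y => (-1) * R r y) hξ
    (hR.const_mul _) (K := K) (by simpa using hK) (b := fun _ => K) continuous_const
    fun r hr y => by simpa using (neg_le_abs _).trans (hK r hr y)
  rw [potential_const_mul] at h2
  simp only [intervalIntegral.integral_const, sub_zero, smul_eq_mul] at h1 h2
  exact abs_le.2 ⟨by linarith, h1⟩

theorem lintegral_eq_potential (hξ : Measurable fun z : ℝ≥0 × Ω => ξ z.1 z.2)
    (hR : Measurable fun z : ℝ≥0 × E => R z.1 z.2) (h0 : ∀ r y, 0 ≤ R r y)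
    (hK : ∀ r y, R r y ≤ K) :
    ∫⁻ s in Ioc (0 : ℝ) t, ∫⁻ ω, ENNReal.ofReal (R (t - s.toNNReal) (ξ s.toNNReal ω)) ∂(P x) =
      ENNReal.ofReal (potential ξ P R t x) := by
  have habs : ∀ r y, |R r y| ≤ K := fun r y => by rw [abs_of_nonneg (h0 r y)]; exact hK r y
  rw [potential, intervalIntegral.integral_of_le t.coe_nonneg, ofReal_integral_eq_lintegral_ofReal]
  · refine lintegral_congr fun s => ?_
    rw [integral_transition hξ (measurable_section hR _), ofReal_integral_eq_lintegral_ofReal]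
    · exact integrable_of_abs_le ((measurable_section hR _).comp
        (hξ.comp (measurable_prodMk_left (x := s.toNNReal)) :)) fun ω => habs _ _
    · exact Eventually.of_forall fun ω => h0 _ _
  · have := intervalIntegrable_transition (P := P) (x := x) (t := t) hξ hR fun r _ y => habs r y
    rwa [intervalIntegrable_iff_integrableOn_Ioc_of_le t.coe_nonneg] at this
  · exact Eventually.of_forall fun s => integral_nonneg fun y => h0 _ _

end Potential

/-! ### Generating functions -/

section GeneratingFunction

variable {p : ℕ → ℝ} {z z' : ℝ}

theorem summable_mul_pow (hp : ∀ i, 0 ≤ p i) (h1 : HasSum p 1) (hz : z ∈ Icc (0 : ℝ) 1) :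
    Summable fun i => p i * z ^ i :=
  Summable.of_nonneg_of_le (fun i => mul_nonneg (hp i) (pow_nonneg hz.1 i))
    (fun i => mul_le_of_le_one_right (hp i) (pow_le_one₀ hz.1 hz.2)) h1.summable

theorem tsum_mul_pow_mem_Icc (hp : ∀ i, 0 ≤ p i) (h1 : HasSum p 1) (hz : z ∈ Icc (0 : ℝ) 1) :
    ∑' i, p i * z ^ i ∈ Icc (0 : ℝ) 1 := by
  refine ⟨tsum_nonneg fun i => mul_nonneg (hp i) (pow_nonneg hz.1 i), ?_⟩
  rw [← h1.tsum_eq]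
  exact (summable_mul_pow hp h1 hz).tsum_le_tsum
    (fun i => mul_le_of_le_one_right (hp i) (pow_le_one₀ hz.1 hz.2)) h1.summable

theorem tsum_ofReal_mul_pow (hp : ∀ i, 0 ≤ p i) (h1 : HasSum p 1) (hz : z ∈ Icc (0 : ℝ) 1) :
    ∑' i, ENNReal.ofReal (p i) * ENNReal.ofReal z ^ i = ENNReal.ofReal (∑' i, p i * z ^ i) := by
  rw [ENNReal.ofReal_tsum_of_nonneg (fun i => mul_nonneg (hp i) (pow_nonneg hz.1 i))
    (summable_mul_pow hp h1 hz)]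
  refine tsum_congr fun i => ?_
  rw [ENNReal.ofReal_mul (hp i), ENNReal.ofReal_pow hz.1]

theorem abs_pow_sub_pow_le (hz : z ∈ Icc (0 : ℝ) 1) (hz' : z' ∈ Icc (0 : ℝ) 1) (i : ℕ) :
    |z ^ i - z' ^ i| ≤ i * |z - z'| := by
  induction i with
  | zero => simp
  | succ i ih =>
    have e : z ^ (i + 1) - z' ^ (i + 1) = z * (z ^ i - z' ^ i) + (z - z') * z' ^ i := by ring
    rw [e]
    push_cast
    calc _ ≤ |z * (z ^ i - z' ^ i)| + |(z - z') * z' ^ i| := abs_add_le _ _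
      _ ≤ 1 * (i * |z - z'|) + |z - z'| * 1 := by
          rw [abs_mul, abs_mul, abs_of_nonneg hz.1, abs_of_nonneg (pow_nonneg hz'.1 i)]
          gcongr
          · exact hz.2
          · exact pow_le_one₀ hz'.1 hz'.2
      _ = (i + 1) * |z - z'| := by ring

/-- On [0,1] the slope of a generating function is at most the mean, here at most 1. -/
theorem abs_tsum_mul_pow_sub_le (hp : ∀ i, 0 ≤ p i) (h1 : HasSum p 1)
    (hm : ∑' i : ℕ, (i : ℝ≥0∞) * ENNReal.ofReal (p i) ≤ 1) (hz : z ∈ Icc (0 : ℝ) 1)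
    (hz' : z' ∈ Icc (0 : ℝ) 1) :
    |∑' i, p i * z ^ i - ∑' i, p i * z' ^ i| ≤ |z - z'| := by
  have hnn : ∀ i : ℕ, 0 ≤ i * p i := fun i => mul_nonneg i.cast_nonneg (hp i)
  have hm' : ∑' i : ℕ, ENNReal.ofReal (i * p i) ≤ 1 := by
    refine le_trans (le_of_eq (tsum_congr fun i => ?_)) hm
    rw [ENNReal.ofReal_mul i.cast_nonneg, ENNReal.ofReal_natCast]
  have hs : Summable fun i : ℕ => i * p i := by
    have := ENNReal.summable_toReal (hm'.trans_lt ENNReal.one_lt_top).ne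
    simpa only [ENNReal.toReal_ofReal (hnn _)] using this
  have hle : ∑' i : ℕ, i * p i ≤ 1 := by
    rw [← ENNReal.ofReal_tsum_of_nonneg hnn hs] at hm'
    simpa using hm'
  rw [← (summable_mul_pow hp h1 hz).tsum_sub (summable_mul_pow hp h1 hz')]
  have hb : ∀ i, ‖p i * z ^ i - p i * z' ^ i‖ ≤ i * p i * |z - z'| := fun i => by
    rw [← mul_sub, Real.norm_eq_abs, abs_mul, abs_of_nonneg (hp i), mul_comm (i : ℝ), mul_assoc]
    exact mul_le_mul_of_nonneg_left (abs_pow_sub_pow_le hz hz' i) (hp i)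
  calc _ ≤ (∑' i : ℕ, i * p i) * |z - z'| := by
        rw [← tsum_mul_right]
        exact tsum_of_norm_bounded (hs.mul_right _).hasSum hb
    _ ≤ 1 * |z - z'| := by gcongr
    _ = |z - z'| := one_mul _

theorem tsum_mul_pow_convex (hp : ∀ i, 0 ≤ p i) (h1 : HasSum p 1) (hz : z ∈ Icc (0 : ℝ) 1)
    (hz' : z' ∈ Icc (0 : ℝ) 1) {a b : ℝ} (ha : 0 ≤ a) (hb : 0 ≤ b) (hab : a + b = 1) :
    ∑' i, p i * (a * z + b * z') ^ i ≤ a * ∑' i, p i * z ^ i + b * ∑' i, p i * z' ^ i := by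
  have hc : a * z + b * z' ∈ Icc (0 : ℝ) 1 := (convex_Icc (0 : ℝ) 1) hz hz' ha hb hab
  rw [← tsum_mul_left, ← tsum_mul_left,
    ← ((summable_mul_pow hp h1 hz).mul_left a).tsum_add ((summable_mul_pow hp h1 hz').mul_left b)]
  refine (summable_mul_pow hp h1 hc).tsum_le_tsum (fun i => ?_)
    (((summable_mul_pow hp h1 hz).mul_left a).add ((summable_mul_pow hp h1 hz').mul_left b))
  have := (convexOn_pow i).2 hz.1 hz'.1 ha hb hab
  simp only [smul_eq_mul] at this
  calc p i * (a * z + b * z') ^ i ≤ p i * (a * z ^ i + b * z' ^ i) :=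
        mul_le_mul_of_nonneg_left this (hp i)
    _ = _ := by ring

end GeneratingFunction

/-! ### Offspring laws -/

namespace BranchingData

variable {E : Type*} [MeasurableSpace E] (D : BranchingData E)

theorem measurable_α : Measurable D.α := D.α_mem.choose_spec.1

theorem measurable_β : Measurable D.β := D.β_mem.choose_spec.1

theorem α_nonneg (x : E) : 0 ≤ D.α x := (D.α_mem.choose_spec.2 x).1

theorem β_nonneg (x : E) : 0 ≤ D.β x := (D.β_mem.choose_spec.2 x).1

theorem exists_α_le : ∃ C, 0 ≤ C ∧ ∀ x, D.α x ≤ C :=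
  ⟨|D.α_mem.choose|, abs_nonneg _, fun x => (D.α_mem.choose_spec.2 x).2.trans (le_abs_self _)⟩

theorem exists_β_le : ∃ C, 0 ≤ C ∧ ∀ x, D.β x ≤ C :=
  ⟨|D.β_mem.choose|, abs_nonneg _, fun x => (D.β_mem.choose_spec.2 x).2.trans (le_abs_self _)⟩

theorem measurable_γ : Measurable D.γ := D.measurable_α.add D.measurable_β

theorem γ_nonneg (x : E) : 0 ≤ D.γ x := (D.rate_pos x).le

theorem exists_γ_le : ∃ C, 0 ≤ C ∧ ∀ x, D.γ x ≤ C := by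
  obtain ⟨A, hA, hA'⟩ := D.exists_α_le
  obtain ⟨B, hB, hB'⟩ := D.exists_β_le
  exact ⟨A + B, add_nonneg hA hB, fun x => add_le_add (hA' x) (hB' x)⟩

theorem g_mem_Icc (x : E) {z : ℝ} (hz : z ∈ Icc (0 : ℝ) 1) : D.g x z ∈ Icc (0 : ℝ) 1 :=
  tsum_mul_pow_mem_Icc (fun i => D.p_nonneg i x) (D.p_sum x) hz

theorem h_mem_Icc (x : E) (π : ProbabilityMeasure E) {z : ℝ} (hz : z ∈ Icc (0 : ℝ) 1) :
    D.h x π z ∈ Icc (0 : ℝ) 1 :=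
  tsum_mul_pow_mem_Icc (fun i => D.q_nonneg i x π) (D.q_sum x π) hz

theorem g_one (x : E) : D.g x 1 = 1 := by simp [g, (D.p_sum x).tsum_eq]

theorem h_one (x : E) (π : ProbabilityMeasure E) : D.h x π 1 = 1 := by
  simp [h, (D.q_sum x π).tsum_eq]

theorem measurable_g : Measurable fun z : E × ℝ => D.g z.1 z.2 :=
  Measurable.tsum fun i => ((D.p_meas i).comp measurable_fst).mul (measurable_snd.pow_const i)

theorem measurable_h : Measurable fun z : (E × ProbabilityMeasure E) × ℝ => D.h z.1.1 z.1.2 z.2 :=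
  Measurable.tsum fun i => ((D.q_meas i).comp measurable_fst).mul (measurable_snd.pow_const i)

theorem measurable_sigmaMk (i : ℕ) : Measurable (@Sigma.mk ℕ (fun i => Fin i → E) i) :=
  Measurable.of_le_map (iInf_le _ i)

theorem measurable_of_measurable_sigma {B : Type*} [MeasurableSpace B]
    {f : (Σ i : ℕ, (Fin i → E)) → B} (hf : ∀ i, Measurable fun z : Fin i → E => f ⟨i, z⟩) :
    Measurable f := by
  have h := measurable_of_measurable_prod_sigma
    (f := fun z : Unit × (Σ i : ℕ, (Fin i → E)) => f z.2) fun i => (hf i).comp measurable_snd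
  exact (h.comp (measurable_prodMk_left (x := ())) :)

theorem measurable_prod_offspring {w : E → ℝ≥0∞} (hw : Measurable w) :
    Measurable fun o : Σ i : ℕ, (Fin i → E) => ∏ j, w (o.2 j) := by
  refine measurable_of_measurable_sigma fun i => ?_
  change Measurable fun z : Fin i → E => ∏ j, w (z j)
  exact Finset.measurable_fun_prod (f := fun j (z : Fin i → E) => w (z j)) _
    fun j _ => hw.comp (measurable_pi_apply j)

theorem measurable_localOffspring : Measurable D.localOffspring := by
  refine Measure.measurable_of_measurable_coe _ fun S hS => ?_
  simp_rw [localOffspring, Measure.sum_apply _ hS]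
  refine Measurable.tsum fun i => ?_
  have h : Measurable fun x : E => (Measure.dirac (⟨i, fun _ => x⟩ : Σ i : ℕ, (Fin i → E))) S :=
    (Measure.measurable_coe hS).comp (Measure.measurable_dirac.comp
      ((measurable_sigmaMk i).comp (measurable_pi_lambda _ fun _ => measurable_id)))
  exact (D.p_meas i).ennreal_ofReal.mul h

/-- The law of the offspring when the displacement law `π` has been chosen. -/
noncomputable def displacedOffspring (x : E) (π : ProbabilityMeasure E) :
    Measure (Σ i : ℕ, (Fin i → E)) :=
  Measure.sum fun i => ENNReal.ofReal (D.q i x π) •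
    (Measure.pi fun _ : Fin i => (π : Measure E)).map (Sigma.mk i)

theorem measurable_displacedOffspring :
    Measurable fun z : E × ProbabilityMeasure E => D.displacedOffspring z.1 z.2 := by
  refine Measure.measurable_of_measurable_coe _ fun S hS => ?_
  simp_rw [displacedOffspring, Measure.sum_apply _ hS]
  refine Measurable.tsum fun i => ?_
  have hpi : Measurable fun π : ProbabilityMeasure E => Measure.pi fun _ : Fin i => (π : Measure E) :=
    measurable_pi_measure (μ := fun (π : ProbabilityMeasure E) (_ : Fin i) => (π : Measure E))
      fun _ => measurable_subtype_coe
  have h : Measurable fun z : E × ProbabilityMeasure E =>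
      ((Measure.pi fun _ : Fin i => (z.2 : Measure E)).map (Sigma.mk i)) S :=
    ((Measure.measurable_coe hS).comp
      ((Measure.measurable_map _ (measurable_sigmaMk i)).comp (hpi.comp measurable_snd)) :)
  exact (D.q_meas i).ennreal_ofReal.mul h

theorem lintegral_localOffspring {w : E → ℝ≥0∞} (hw : Measurable w) (x : E) :
    ∫⁻ o, ∏ j, w (o.2 j) ∂(D.localOffspring x) = ∑' i, ENNReal.ofReal (D.p i x) * w x ^ i := by
  rw [localOffspring, lintegral_sum_measure]
  refine tsum_congr fun i => ?_
  rw [lintegral_smul_measure, lintegral_dirac' _ (measurable_prod_offspring hw)]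
  simp

theorem lintegral_nonlocalOffspring (G : Kernel E (ProbabilityMeasure E)) {w : E → ℝ≥0∞} (hw : Measurable w) (x : E) :
    ∫⁻ o, ∏ j, w (o.2 j) ∂(D.nonlocalOffspring G x) =
      ∫⁻ π, ∑' i, ENNReal.ofReal (D.q i x π) * (∫⁻ y, w y ∂(π : Measure E)) ^ i ∂(G x) := by
  have hprod := measurable_prod_offspring hw
  have hd : Measurable (D.displacedOffspring x) :=
    (D.measurable_displacedOffspring.comp (measurable_prodMk_left (x := x)) :)
  change ∫⁻ o, ∏ j, w (o.2 j) ∂((G x).bind (D.displacedOffspring x)) = _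
  rw [Measure.lintegral_bind hd.aemeasurable hprod.aemeasurable]
  refine lintegral_congr fun π => ?_
  rw [displacedOffspring, lintegral_sum_measure]
  refine tsum_congr fun i => ?_
  rw [lintegral_smul_measure, lintegral_map hprod (measurable_sigmaMk i)]
  have := lintegral_pi_prod (fun _ : Fin i => (π : Measure E)) w hw
  rw [this]
  simp

theorem lintegral_offspring (G : Kernel E (ProbabilityMeasure E)) {w : E → ℝ≥0∞} (hw : Measurable w) (x : E) :
    ∫⁻ o, ∏ j, w (o.2 j) ∂(D.offspring G x) =
      ENNReal.ofReal (D.α x / D.γ x) * ∑' i, ENNReal.ofReal (D.p i x) * w x ^ i +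
      ENNReal.ofReal (D.β x / D.γ x) *
        ∫⁻ π, ∑' i, ENNReal.ofReal (D.q i x π) * (∫⁻ y, w y ∂(π : Measure E)) ^ i ∂(G x) := by
  rw [offspring, lintegral_add_measure, lintegral_smul_measure, lintegral_smul_measure,
    D.lintegral_localOffspring hw, D.lintegral_nonlocalOffspring G hw]
  rfl

variable (G : Kernel E (ProbabilityMeasure E)) [IsMarkovKernel G]

theorem measurable_nonlocalOffspring : Measurable (D.nonlocalOffspring G) := by
  refine Measure.measurable_of_measurable_coe _ fun S hS => ?_
  have hd := D.measurable_displacedOffspring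
  have e : ∀ x, D.nonlocalOffspring G x S = ∫⁻ π, D.displacedOffspring x π S ∂(G x) := fun x =>
    Measure.bind_apply hS (hd.comp (measurable_prodMk_left (x := x)) :).aemeasurable
  simp_rw [e]
  have h : Measurable fun z : E × ProbabilityMeasure E => D.displacedOffspring z.1 z.2 S :=
    ((Measure.measurable_coe hS).comp hd :)
  exact h.lintegral_kernel_prod_right'

/-- The offspring law as a kernel. -/
noncomputable def offspringKernel : Kernel E (Σ i : ℕ, (Fin i → E)) where
  toFun := D.offspring G
  measurable' := by
    refine Measure.measurable_of_measurable_coe _ fun S hS => ?_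
    have hα : Measurable fun x => ENNReal.ofReal (D.α x / D.γ x) :=
      (D.measurable_α.div D.measurable_γ).ennreal_ofReal
    have hβ : Measurable fun x => ENNReal.ofReal (D.β x / D.γ x) :=
      (D.measurable_β.div D.measurable_γ).ennreal_ofReal
    exact (hα.mul ((Measure.measurable_coe hS).comp D.measurable_localOffspring)).add
      (hβ.mul ((Measure.measurable_coe hS).comp (D.measurable_nonlocalOffspring G)))

/-- The intensity of branching, weighted with a product over the offspring. -/
noncomputable def branchingRate (u : E → ℝ) (x : E) : ℝ :=
  D.α x * D.g x (u x) + D.β x * ∫ π, D.h x π (∫ y, u y ∂(π : Measure E)) ∂(G x)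

variable {G} {u : E → ℝ}

theorem integral_mem_Icc {a : ℝ} (hu : Measurable u) (h01 : ∀ x, u x ∈ Icc (0 : ℝ) a)
    (π : ProbabilityMeasure E) : ∫ y, u y ∂(π : Measure E) ∈ Icc (0 : ℝ) a := by
  refine ⟨integral_nonneg fun y => (h01 y).1, ?_⟩
  have : ∫ y, u y ∂(π : Measure E) ≤ ∫ _, a ∂(π : Measure E) := by
    refine integral_mono (integrable_of_abs_le (K := a) hu fun y => ?_) (integrable_const _)
      fun y => (h01 y).2
    rw [abs_of_nonneg (h01 y).1]
    exact (h01 y).2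
  simpa using this

theorem measurable_integral_prob {A : Type*} [MeasurableSpace A] {v : A → E → ℝ}
    (hv : Measurable fun z : A × E => v z.1 z.2) :
    Measurable fun z : A × ProbabilityMeasure E => ∫ y, v z.1 y ∂(z.2 : Measure E) := by
  -- The identity, read as a Markov kernel, reduces joint measurability in the measure to
  -- measurability of kernel integrals.
  let κ : Kernel (ProbabilityMeasure E) E := ⟨fun π => π, measurable_subtype_coe⟩
  have : IsMarkovKernel κ := ⟨fun π => inferInstanceAs (IsProbabilityMeasure (π : Measure E))⟩
  have h1 : Measurable fun z : (A × ProbabilityMeasure E) × E => v z.1.1 z.2 :=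
    (hv.comp ((measurable_fst.comp measurable_fst).prodMk measurable_snd) :)
  exact (h1.stronglyMeasurable.integral_kernel_prod_right'
    (κ := κ.comap Prod.snd measurable_snd)).measurable

theorem measurable_integral_h {A : Type*} [MeasurableSpace A] {v : A → E → ℝ}
    (hv : Measurable fun z : A × E => v z.1 z.2) :
    Measurable fun z : (A × E) × ProbabilityMeasure E =>
      D.h z.1.2 z.2 (∫ y, v z.1.1 y ∂(z.2 : Measure E)) := by
  have h1 := (measurable_integral_prob hv).comp
    ((measurable_fst.comp measurable_fst).prodMk measurable_snd :
      Measurable fun z : (A × E) × ProbabilityMeasure E => (z.1.1, z.2))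
  exact (D.measurable_h.comp
    (((measurable_snd.comp measurable_fst).prodMk measurable_snd).prodMk h1) :)

theorem measurable_branchingRate {A : Type*} [MeasurableSpace A] {v : A → E → ℝ}
    (hv : Measurable fun z : A × E => v z.1 z.2) :
    Measurable fun z : A × E => D.branchingRate G (v z.1) z.2 := by
  have h1 : Measurable fun z : A × E => D.g z.2 (v z.1 z.2) :=
    (D.measurable_g.comp (measurable_snd.prodMk hv) :)
  have h2 := ((D.measurable_integral_h hv).stronglyMeasurable.integral_kernel_prod_right'
    (κ := G.comap Prod.snd measurable_snd)).measurable
  exact ((D.measurable_α.comp measurable_snd).mul h1).add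
    ((D.measurable_β.comp measurable_snd).mul h2)

theorem integrable_h (hu : Measurable u) (h01 : ∀ x, u x ∈ Icc (0 : ℝ) 1) (x : E) :
    Integrable (fun π => D.h x π (∫ y, u y ∂(π : Measure E))) (G x) := by
  have h1 := D.measurable_integral_h (A := Unit) (v := fun _ => u) (hu.comp measurable_snd)
  refine integrable_of_abs_le (K := 1) (h1.comp (measurable_prodMk_left (x := ((), x))) :)
    fun π => ?_
  have := D.h_mem_Icc x π (integral_mem_Icc hu h01 π)
  rw [abs_of_nonneg this.1]
  exact this.2

theorem integral_h_mem_Icc (hu : Measurable u) (h01 : ∀ x, u x ∈ Icc (0 : ℝ) 1) (x : E) :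
    ∫ π, D.h x π (∫ y, u y ∂(π : Measure E)) ∂(G x) ∈ Icc (0 : ℝ) 1 := by
  have := fun π => D.h_mem_Icc x π (integral_mem_Icc hu h01 π)
  refine ⟨integral_nonneg fun π => (this π).1, ?_⟩
  have h2 : ∫ π, D.h x π (∫ y, u y ∂(π : Measure E)) ∂(G x) ≤ ∫ _, (1 : ℝ) ∂(G x) :=
    integral_mono (D.integrable_h hu h01 x) (integrable_const _) fun π => (this π).2
  simpa using h2

theorem branchingRate_mem_Icc (hu : Measurable u) (h01 : ∀ x, u x ∈ Icc (0 : ℝ) 1) (x : E) :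
    D.branchingRate G u x ∈ Icc (0 : ℝ) (D.γ x) := by
  have hg := D.g_mem_Icc x (h01 x)
  have hh := D.integral_h_mem_Icc (G := G) hu h01 x
  constructor
  · exact add_nonneg (mul_nonneg (D.α_nonneg x) hg.1) (mul_nonneg (D.β_nonneg x) hh.1)
  · exact add_le_add (mul_le_of_le_one_right (D.α_nonneg x) hg.2)
      (mul_le_of_le_one_right (D.β_nonneg x) hh.2)

/-- Multiplication by γ clears the denominators of the branching probabilities α/γ and β/γ, and the
integral over i independent positions is the i-th power of π(u), so that the generating functions g
and h appear. -/
theorem rate_mul_lintegral_offspring (hu : Measurable u) (h01 : ∀ x, u x ∈ Icc (0 : ℝ) 1) (x : E) :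
    ENNReal.ofReal (D.γ x) * ∫⁻ o, ∏ j, ENNReal.ofReal (u (o.2 j)) ∂(D.offspring G x) =
      ENNReal.ofReal (D.branchingRate G u x) := by
  have hγ : 0 < D.γ x := D.rate_pos x
  have hg := D.g_mem_Icc x (h01 x)
  have hh := D.integral_h_mem_Icc (G := G) hu h01 x
  have hloc : ∑' i, ENNReal.ofReal (D.p i x) * ENNReal.ofReal (u x) ^ i =
      ENNReal.ofReal (D.g x (u x)) :=
    tsum_ofReal_mul_pow (fun i => D.p_nonneg i x) (D.p_sum x) (h01 x)
  have hnon : ∫⁻ π, ∑' i, ENNReal.ofReal (D.q i x π) *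
      (∫⁻ y, ENNReal.ofReal (u y) ∂(π : Measure E)) ^ i ∂(G x) =
      ENNReal.ofReal (∫ π, D.h x π (∫ y, u y ∂(π : Measure E)) ∂(G x)) := by
    rw [ofReal_integral_eq_lintegral_ofReal (D.integrable_h hu h01 x)
      (Eventually.of_forall fun π => (D.h_mem_Icc x π (integral_mem_Icc hu h01 π)).1)]
    refine lintegral_congr fun π => ?_
    rw [← ofReal_integral_eq_lintegral_ofReal
      (integrable_of_abs_le (K := 1) hu fun y => by rw [abs_of_nonneg (h01 y).1]; exact (h01 y).2)
      (Eventually.of_forall fun y => (h01 y).1)]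
    exact tsum_ofReal_mul_pow (fun i => D.q_nonneg i x π) (D.q_sum x π) (integral_mem_Icc hu h01 π)
  rw [D.lintegral_offspring G hu.ennreal_ofReal, hloc, hnon,
    ← ENNReal.ofReal_mul (div_nonneg (D.α_nonneg x) hγ.le),
    ← ENNReal.ofReal_mul (div_nonneg (D.β_nonneg x) hγ.le),
    ← ENNReal.ofReal_add (mul_nonneg (div_nonneg (D.α_nonneg x) hγ.le) hg.1)
      (mul_nonneg (div_nonneg (D.β_nonneg x) hγ.le) hh.1), ← ENNReal.ofReal_mul hγ.le]
  congr 1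
  unfold branchingRate
  field_simp

/-- With u = 1 the branching rate is γ(x), which is positive and can be cancelled. -/
instance isMarkovKernel_offspringKernel : IsMarkovKernel (D.offspringKernel G) := by
  refine ⟨fun x => ⟨?_⟩⟩
  have h := D.rate_mul_lintegral_offspring (G := G) (u := fun _ => 1) measurable_const
    (fun _ => ⟨zero_le_one, le_rfl⟩) x
  have hb : D.branchingRate G (fun _ => 1) x = D.γ x := by
    simp [branchingRate, D.g_one, D.h_one, γ]
  rw [hb] at h
  simp only [ENNReal.ofReal_one, Finset.prod_const_one, lintegral_const, one_mul] at h
  have hγ : ENNReal.ofReal (D.γ x) ≠ 0 := (ENNReal.ofReal_pos.2 (D.rate_pos x)).ne'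
  exact (ENNReal.mul_eq_left hγ ENNReal.ofReal_ne_top).1 h

end BranchingData

/-! ### The Laplace functional of the particle system -/

section LaplaceWeight

variable {E : Type*} [MeasurableSpace E] {f : E → ℝ} {a : ℝ}

/-- `exp (-ν(f))` for finite measures `ν`, and `0` for infinite ones. -/
noncomputable def laplaceWeight (f : E → ℝ) : Measure E → ℝ≥0∞ :=
  {ν : Measure E | ν univ < ∞}.indicator fun ν =>
    ENNReal.ofReal (Real.exp (-(∫⁻ y, ENNReal.ofReal (f y) ∂ν).toReal))

theorem laplaceWeight_of_finite (f : E → ℝ) {ν : Measure E} (h : ν univ < ∞) :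
    laplaceWeight f ν = ENNReal.ofReal (Real.exp (-(∫⁻ y, ENNReal.ofReal (f y) ∂ν).toReal)) :=
  indicator_of_mem (s := {ν : Measure E | ν univ < ∞}) h _

theorem laplaceWeight_of_infinite (f : E → ℝ) {ν : Measure E} (h : ¬ ν univ < ∞) :
    laplaceWeight f ν = 0 :=
  indicator_of_notMem (s := {ν : Measure E | ν univ < ∞}) h _

theorem laplaceWeight_le_one (ν : Measure E) : laplaceWeight f ν ≤ 1 := by
  by_cases h : ν univ < ∞
  · rw [laplaceWeight_of_finite f h, ENNReal.ofReal_le_one, Real.exp_le_one_iff]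
    exact neg_nonpos.2 ENNReal.toReal_nonneg
  · rw [laplaceWeight_of_infinite f h]
    exact zero_le

theorem isMultiplicative_laplaceWeight (hf : f ∈ BPlusBall E a) :
    IsMultiplicative (laplaceWeight f) := by
  constructor
  · refine Measurable.indicator ?_
      (measurableSet_lt (Measure.measurable_coe MeasurableSet.univ) measurable_const)
    exact (Measure.measurable_lintegral hf.1.ennreal_ofReal).ennreal_toReal.neg.exp.ennreal_ofReal
  · intro i η
    by_cases h : ∀ j, η j univ < ∞
    · have hsum : (∑ j, η j) univ < ∞ := by
        rw [Measure.finsetSum_apply]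
        exact ENNReal.sum_lt_top.2 fun j _ => h j
      have hfin : ∀ j, ∫⁻ y, ENNReal.ofReal (f y) ∂(η j) ≠ ∞ := fun j => by
        refine ne_of_lt (lt_of_le_of_lt (lintegral_mono fun y =>
          ENNReal.ofReal_le_ofReal (hf.2 y).2) ?_)
        rw [lintegral_const]
        exact ENNReal.mul_lt_top ENNReal.ofReal_lt_top (h j)
      rw [laplaceWeight_of_finite f hsum, Finset.prod_congr rfl fun j _ =>
        laplaceWeight_of_finite f (h j), ← ENNReal.ofReal_prod_of_nonneg fun j _ =>
        Real.exp_nonneg _, ← Real.exp_sum, Finset.sum_neg_distrib,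
        lintegral_finsetSum_measure, ENNReal.toReal_sum fun j _ => hfin j]
    · have hsum : ¬ (∑ j, η j) univ < ∞ := by
        rw [Measure.finsetSum_apply, ENNReal.sum_lt_top]
        simpa using h
      rw [laplaceWeight_of_infinite f hsum]
      push Not at h
      obtain ⟨j, hj⟩ := h
      exact (Finset.prod_eq_zero (Finset.mem_univ j)
        (laplaceWeight_of_infinite f (not_lt.2 hj))).symm

theorem laplaceWeight_dirac (hf : f ∈ BPlusBall E a) (y : E) :
    laplaceWeight f (Measure.dirac y) = ENNReal.ofReal (Real.exp (-f y)) := by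
  rw [laplaceWeight_of_finite f (by simp), lintegral_dirac' _ hf.1.ennreal_ofReal,
    ENNReal.toReal_ofReal (hf.2 y).1]

end LaplaceWeight

namespace BranchingData

variable {E Ω : Type*} [MeasurableSpace E] [MeasurableSpace Ω]

/-- `E_x exp (-X_t(f))` for the particle system. -/
noncomputable def laplace (D : BranchingData E) (G : Kernel E (ProbabilityMeasure E))
    (ξ : ℝ≥0 → Ω → E) (P : Kernel E Ω) (f : E → ℝ) (t : ℝ≥0) (x : E) : ℝ :=
  (∫⁻ ν, laplaceWeight f ν ∂(particleLaw ξ P D.γ (D.offspring G) t x)).toReal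

variable (D : BranchingData E) (G : Kernel E (ProbabilityMeasure E)) [IsMarkovKernel G]
  {ξ : ℝ≥0 → Ω → E} {P : Kernel E Ω} [IsMarkovKernel P] {f : E → ℝ} {a : ℝ}

theorem lintegral_laplaceWeight_le_one (hξ : Measurable fun z : ℝ≥0 × Ω => ξ z.1 z.2) (t : ℝ≥0)
    (x : E) : ∫⁻ ν, laplaceWeight f ν ∂(particleLaw ξ P D.γ (D.offspring G) t x) ≤ 1 := by
  obtain ⟨C, -, hC⟩ := D.exists_γ_le
  exact lintegral_particleLaw_le_one (F := D.offspringKernel G) hξ D.measurable_γ D.γ_nonneg hC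
    laplaceWeight_le_one t x

theorem ofReal_laplace (hξ : Measurable fun z : ℝ≥0 × Ω => ξ z.1 z.2) (t : ℝ≥0) (x : E) :
    ENNReal.ofReal (D.laplace G ξ P f t x) =
      ∫⁻ ν, laplaceWeight f ν ∂(particleLaw ξ P D.γ (D.offspring G) t x) :=
  ENNReal.ofReal_toReal
    ((D.lintegral_laplaceWeight_le_one G hξ t x).trans_lt ENNReal.one_lt_top).ne

theorem laplace_mem_Icc (hξ : Measurable fun z : ℝ≥0 × Ω => ξ z.1 z.2) (t : ℝ≥0) (x : E) :
    D.laplace G ξ P f t x ∈ Icc (0 : ℝ) 1 := by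
  refine ⟨ENNReal.toReal_nonneg, ?_⟩
  have := D.lintegral_laplaceWeight_le_one (P := P) (f := f) G hξ t x
  rw [← D.ofReal_laplace G hξ, ENNReal.ofReal_le_one] at this
  exact this

theorem measurable_laplace (hξ : Measurable fun z : ℝ≥0 × Ω => ξ z.1 z.2)
    (hf : f ∈ BPlusBall E a) : Measurable fun z : ℝ≥0 × E => D.laplace G ξ P f z.1 z.2 := by
  obtain ⟨C, -, hC⟩ := D.exists_γ_le
  exact (measurable_lintegral_particleLaw (F := D.offspringKernel G) hξ D.measurable_γ D.γ_nonneg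
    hC (isMultiplicative_laplaceWeight hf).measurable).ennreal_toReal

/-- Almost sure finiteness of the population lets the multiplicative weight replace the exponential
of the Bochner integral. -/
theorem logLaplace_eq (hξ : Measurable fun z : ℝ≥0 × Ω => ξ z.1 z.2)
    (hf : f ∈ BPlusBall E a) (t : ℝ≥0) (x : E) :
    logLaplace ξ P D.γ (D.offspring G) t x f = -Real.log (D.laplace G ξ P f t x) := by
  obtain ⟨C, -, hC⟩ := D.exists_γ_le
  have hfin := ae_particleLaw_finite (P := P) (F := D.offspringKernel G) hξ D.measurable_γ
    D.γ_nonneg hC t x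
  have hint : ∀ ν : Measure E, ∫ y, f y ∂ν = (∫⁻ y, ENNReal.ofReal (f y) ∂ν).toReal := fun ν =>
    integral_eq_lintegral_of_nonneg_ae (Eventually.of_forall fun y => (hf.2 y).1)
      hf.1.aestronglyMeasurable
  rw [logLaplace, laplace, integral_eq_lintegral_of_nonneg_ae
    (Eventually.of_forall fun ν => Real.exp_nonneg _)]
  · congr 3
    refine lintegral_congr_ae ?_
    filter_upwards [hfin] with ν hν
    rw [laplaceWeight_of_finite f hν, hint]
  · simp_rw [hint]
    exact (Measure.measurable_lintegral
      hf.1.ennreal_ofReal).ennreal_toReal.neg.exp.aestronglyMeasurable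

/-- The equation obtained by conditioning on the first branching. -/
theorem ofReal_laplace_eq (hξ : Measurable fun z : ℝ≥0 × Ω => ξ z.1 z.2)
    (hf : f ∈ BPlusBall E a) (t : ℝ≥0) (x : E) :
    ENNReal.ofReal (D.laplace G ξ P f t x) =
      ∫⁻ ω, (survival ξ D.γ t ω * ENNReal.ofReal (Real.exp (-f (ξ t ω))) +
        ∫⁻ s in Ioc (0 : ℝ) t, survival ξ D.γ s ω * ENNReal.ofReal
          (D.branchingRate G (D.laplace G ξ P f (t - s.toNNReal)) (ξ s.toNNReal ω))) ∂(P x) := by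
  obtain ⟨C, -, hC⟩ := D.exists_γ_le
  have h := lintegral_particleLaw_eq (P := P) (F := D.offspringKernel G) hξ D.measurable_γ
    D.γ_nonneg hC (isMultiplicative_laplaceWeight hf) laplaceWeight_le_one t x
  have hcoe : ⇑(D.offspringKernel G) = D.offspring G := rfl
  rw [hcoe] at h
  rw [ofReal_laplace D G hξ, h]
  refine lintegral_congr fun ω => ?_
  rw [laplaceWeight_dirac hf]
  refine congrArg (_ + ·) (lintegral_congr fun s => ?_)
  simp_rw [← ofReal_laplace D G hξ]
  rw [mul_assoc, D.rate_mul_lintegral_offspring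
    (measurable_section (D.measurable_laplace G hξ hf) _) fun y => D.laplace_mem_Icc G hξ _ y]

/-- Only the event that the ancestor is still alive at time t is kept. This makes the logarithm
legitimate and bounds u for each fixed k. -/
theorem exp_le_laplace (hξ : Measurable fun z : ℝ≥0 × Ω => ξ z.1 z.2)
    (hf : f ∈ BPlusBall E a) {C : ℝ} (hC : ∀ x, D.γ x ≤ C) (t : ℝ≥0) (x : E) :
    Real.exp (-(C * t + a)) ≤ D.laplace G ξ P f t x := by
  rw [← ENNReal.ofReal_le_ofReal_iff (D.laplace_mem_Icc G hξ t x).1, ofReal_laplace_eq D G hξ hf]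
  calc ENNReal.ofReal (Real.exp (-(C * t + a)))
      = ∫⁻ ω, ENNReal.ofReal (Real.exp (-(C * t + a))) ∂(P x) := by simp
    _ ≤ _ := lintegral_mono fun ω => le_add_of_le_of_nonneg ?_ (zero_le)
  rw [survival, ← ENNReal.ofReal_mul (Real.exp_nonneg _), ← Real.exp_add]
  refine ENNReal.ofReal_le_ofReal (Real.exp_le_exp.2 ?_)
  have hpath : Measurable fun s : ℝ => D.γ (ξ s.toNNReal ω) :=
    D.measurable_γ.comp ((measurable_path hξ).comp measurable_prodMk_right)
  have hI : ∫ s in (0 : ℝ)..t, D.γ (ξ s.toNNReal ω) ≤ ∫ _ in (0 : ℝ)..t, C :=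
    intervalIntegral.integral_mono_on t.coe_nonneg
      (intervalIntegrable_of_bdd hpath (fun _ => D.γ_nonneg _) (fun _ => hC _) _ _)
      intervalIntegrable_const fun _ _ => hC _
  rw [intervalIntegral.integral_const, sub_zero, smul_eq_mul] at hI
  linarith [(hf.2 (ξ t ω)).2]

variable {G}

section VK

variable {k : ℕ}

theorem BPlusBall_div (hf : f ∈ BPlusBall E a) :
    (fun y => f y / k) ∈ BPlusBall E (a / k) :=
  ⟨hf.1.div_const _, fun x => ⟨div_nonneg (hf.2 x).1 k.cast_nonneg,
    div_le_div_of_nonneg_right (hf.2 x).2 k.cast_nonneg⟩⟩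

theorem laplace_pos (hξ : Measurable fun z : ℝ≥0 × Ω => ξ z.1 z.2)
    (hf : f ∈ BPlusBall E a) (t : ℝ≥0) (x : E) : 0 < D.laplace G ξ P f t x := by
  obtain ⟨C, -, hC⟩ := D.exists_γ_le
  exact (Real.exp_pos _).trans_le (D.exp_le_laplace G hξ hf hC t x)

theorem uK_eq (hξ : Measurable fun z : ℝ≥0 × Ω => ξ z.1 z.2)
    (hf : f ∈ BPlusBall E a) (t : ℝ≥0) (x : E) :
    D.uK G ξ P k t x f = -Real.log (D.laplace G ξ P (fun y => f y / k) t x) :=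
  D.logLaplace_eq G hξ (BPlusBall_div hf) t x

theorem vK_eq (hξ : Measurable fun z : ℝ≥0 × Ω => ξ z.1 z.2)
    (hf : f ∈ BPlusBall E a) (t : ℝ≥0) (x : E) :
    D.vK G ξ P k t x f = k * (1 - D.laplace G ξ P (fun y => f y / k) t x) := by
  rw [vK, D.uK_eq hξ hf, neg_neg, Real.exp_log (D.laplace_pos hξ (BPlusBall_div hf) t x)]

theorem vK_mem_Icc (hξ : Measurable fun z : ℝ≥0 × Ω => ξ z.1 z.2)
    (hf : f ∈ BPlusBall E a) (t : ℝ≥0) (x : E) : D.vK G ξ P k t x f ∈ Icc (0 : ℝ) k := by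
  have := D.laplace_mem_Icc (f := fun y => f y / k) (P := P) G hξ t x
  rw [D.vK_eq hξ hf]
  exact ⟨mul_nonneg k.cast_nonneg (sub_nonneg.2 this.2),
    mul_le_of_le_one_right k.cast_nonneg (by linarith [this.1])⟩

theorem measurable_vK (hξ : Measurable fun z : ℝ≥0 × Ω => ξ z.1 z.2)
    (hf : f ∈ BPlusBall E a) : Measurable fun z : ℝ≥0 × E => D.vK G ξ P k z.1 z.2 f := by
  simp_rw [D.vK_eq hξ hf]
  exact (measurable_const.sub (D.measurable_laplace G hξ (BPlusBall_div hf))).const_mul _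

theorem uK_bounds (hξ : Measurable fun z : ℝ≥0 × Ω => ξ z.1 z.2) (hk : 1 ≤ k)
    (hf : f ∈ BPlusBall E a) {C : ℝ} (hC : ∀ x, D.γ x ≤ C) (t : ℝ≥0) (x : E) :
    k * D.uK G ξ P k t x f ∈ Icc 0 (k * C * t + a) := by
  have hk0 : (0 : ℝ) < k := by exact_mod_cast hk
  have hf' := BPlusBall_div (k := k) hf
  have h01 := D.laplace_mem_Icc (f := fun y => f y / k) (P := P) G hξ t x
  rw [D.uK_eq hξ hf]
  constructor
  · exact mul_nonneg hk0.le (neg_nonneg.2 (Real.log_nonpos h01.1 h01.2))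
  · have h := (Real.le_log_iff_exp_le (D.laplace_pos (G := G) (P := P) hξ hf' t x)).2
      (D.exp_le_laplace G hξ hf' hC t x)
    calc _ ≤ k * (C * t + a / k) := mul_le_mul_of_nonneg_left (by linarith) hk0.le
      _ = k * C * t + a := by field_simp

/-- With v = k(1 - w), both 1 - v(x)/k = w(x) and 1 - π(v)/k = π(w); the linear parts of the local
and the non-local mechanism add up to -γ w. -/
theorem phi_add_psi (hk : 1 ≤ k) {w : E → ℝ} (hw : Measurable w) (h01 : ∀ x, w x ∈ Icc (0 : ℝ) 1)
    (x : E) :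
    D.phi k x (k * (1 - w x)) + psi D.β (D.zeta G k) x (fun y => k * (1 - w y)) =
      k * (D.branchingRate G w x - D.γ x * w x) := by
  have hk0 : (k : ℝ) ≠ 0 := by
    have : (0 : ℝ) < k := by exact_mod_cast hk
    exact this.ne'
  have e1 : 1 - k * (1 - w x) / k = w x := by field_simp; ring
  have e2 : ∀ π : ProbabilityMeasure E,
      1 - (∫ y, k * (1 - w y) ∂(π : Measure E)) / k = ∫ y, w y ∂(π : Measure E) := by
    intro π
    rw [integral_const_mul, integral_sub (integrable_const _) (integrable_of_abs_le (K := 1) hw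
      fun y => by rw [abs_of_nonneg (h01 y).1]; exact (h01 y).2)]
    simp only [integral_const, probReal_univ, smul_eq_mul, mul_one]
    field_simp
    ring
  have e3 : ∫ π, (k : ℝ) * (1 - D.h x π (∫ y, w y ∂(π : Measure E))) ∂(G x) =
      k * (1 - ∫ π, D.h x π (∫ y, w y ∂(π : Measure E)) ∂(G x)) := by
    rw [integral_const_mul, integral_sub (integrable_const _) (D.integrable_h hw h01 x)]
    simp
  simp only [phi, psi, zeta, branchingRate, γ]
  simp_rw [e1, e2]
  rw [e3]
  ring

end VK

end BranchingData

/-! ### Evolution equations without killing. -/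

section Equation

variable {E Ω : Type*} [TopologicalSpace E] [TopologicalSpace.PseudoMetrizableSpace E]
  [MeasurableSpace E] [BorelSpace E]
  {mΩ : MeasurableSpace Ω} {𝓕 : Filtration ℝ≥0 mΩ} {ξ : ℝ≥0 → Ω → E} {P : Kernel E Ω}
  (D : BranchingData E) {G : Kernel E (ProbabilityMeasure E)} [IsMarkovKernel G] {f : E → ℝ} {a : ℝ}

/-- This is the Feynman–Kac exchange with terminal value exp(-f) and source `branchingRate`. Every
term is finite and nonnegative, so the identity descends to the reals. -/
theorem BranchingData.laplace_equation (hξ : IsRightContStrongMarkov 𝓕 ξ P)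
    (hf : f ∈ BPlusBall E a) (t : ℝ≥0) (x : E) :
    D.laplace G ξ P f t x + potential ξ P (fun r y => D.γ y * D.laplace G ξ P f r y) t x =
      ∫ y, Real.exp (-f y) ∂(transition ξ P t x) +
        potential ξ P (fun r y => D.branchingRate G (D.laplace G ξ P f r) y) t x := by
  have := hξ.isMarkovKernel
  obtain ⟨C, hC0, hC⟩ := D.exists_γ_le
  have hm := hξ.measurable_uncurry
  have hw := D.measurable_laplace (P := P) G hm hf
  have h01 := fun t x => D.laplace_mem_Icc (P := P) (f := f) G hm t x
  have hexp : Measurable fun y => Real.exp (-f y) := hf.1.neg.exp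
  have hH : Measurable fun z : ℝ≥0 × E => D.branchingRate G (D.laplace G ξ P f z.1) z.2 :=
    D.measurable_branchingRate hw
  have hH01 := fun r y => D.branchingRate_mem_Icc (G := G) (measurable_section hw r) (h01 r) y
  have hγw : Measurable fun z : ℝ≥0 × E => D.γ z.2 * D.laplace G ξ P f z.1 z.2 :=
    (D.measurable_γ.comp measurable_snd).mul hw
  have key := hξ.feynmanKac D.measurable_γ D.γ_nonneg hC hexp.ennreal_ofReal hH.ennreal_ofReal
    (W := fun z => ENNReal.ofReal (D.laplace G ξ P f z.1 z.2)) (D.ofReal_laplace_eq G hm hf) t x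
  simp_rw [← ENNReal.ofReal_mul (D.γ_nonneg _)] at key
  rw [lintegral_eq_potential (R := fun r y => D.γ y * D.laplace G ξ P f r y) (K := C) hm hγw
      (fun r y => mul_nonneg (D.γ_nonneg y) (h01 r y).1)
      (fun r y => (mul_le_of_le_one_right (D.γ_nonneg y) (h01 r y).2).trans (hC y)),
    lintegral_eq_potential (R := fun r y => D.branchingRate G (D.laplace G ξ P f r) y) (K := C) hm hH
      (fun r y => (hH01 r y).1) (fun r y => (hH01 r y).2.trans (hC y))] at key
  have hterm : ∫⁻ ω, ENNReal.ofReal (Real.exp (-f (ξ t ω))) ∂(P x) =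
      ENNReal.ofReal (∫ y, Real.exp (-f y) ∂(transition ξ P t x)) := by
    rw [integral_transition hm hexp, ofReal_integral_eq_lintegral_ofReal]
    · refine integrable_of_abs_le (K := 1) (hexp.comp (hξ.measurable_coord t)) fun ω => ?_
      rw [abs_of_nonneg (Real.exp_nonneg _), Real.exp_le_one_iff]
      exact neg_nonpos.2 (hf.2 _).1
    · exact Eventually.of_forall fun ω => Real.exp_nonneg _
  have hpos : ∀ R : ℝ≥0 → E → ℝ, (∀ r y, 0 ≤ R r y) → 0 ≤ potential ξ P R t x := fun R hR =>
    intervalIntegral.integral_nonneg t.coe_nonneg fun s _ => integral_nonneg fun y => hR _ y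
  have hp1 := hpos (fun r y => D.γ y * D.laplace G ξ P f r y)
    fun r y => mul_nonneg (D.γ_nonneg y) (h01 r y).1
  have hp2 := hpos (fun r y => D.branchingRate G (D.laplace G ξ P f r) y) fun r y => (hH01 r y).1
  have hp3 : 0 ≤ ∫ y, Real.exp (-f y) ∂(transition ξ P t x) :=
    integral_nonneg fun y => Real.exp_nonneg _
  rw [hterm, ← ENNReal.ofReal_add (h01 t x).1 hp1, ← ENNReal.ofReal_add hp3 hp2] at key
  exact (ENNReal.ofReal_eq_ofReal_iff (add_nonneg (h01 t x).1 hp1) (add_nonneg hp3 hp2)).1 key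

/-- The evolution equation of the rescaled particle system. -/
theorem BranchingData.vK_equation (hξ : IsRightContStrongMarkov 𝓕 ξ P) {k : ℕ} (hk : 1 ≤ k)
    (hf : f ∈ BPlusBall E a) (t : ℝ≥0) (x : E) :
    D.vK G ξ P k t x f + potential ξ P (fun r y => D.phi k y (D.vK G ξ P k r y f) +
        psi D.β (D.zeta G k) y (fun y => D.vK G ξ P k r y f)) t x =
      ∫ y, k * (1 - Real.exp (-(f y / k))) ∂(transition ξ P t x) := by
  have := hξ.isMarkovKernel
  obtain ⟨C, hC0, hC⟩ := D.exists_γ_le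
  have hm := hξ.measurable_uncurry
  have hf' := BranchingData.BPlusBall_div (k := k) hf
  have hw := D.measurable_laplace (P := P) G hm hf'
  have h01 := fun t x => D.laplace_mem_Icc (P := P) (f := fun y => f y / k) G hm t x
  have hH : Measurable fun z : ℝ≥0 × E =>
      D.branchingRate G (D.laplace G ξ P (fun y => f y / k) z.1) z.2 := D.measurable_branchingRate hw
  have hH01 := fun r y => D.branchingRate_mem_Icc (G := G) (measurable_section hw r) (h01 r) y
  have hγw : Measurable fun z : ℝ≥0 × E => D.γ z.2 * D.laplace G ξ P (fun y => f y / k) z.1 z.2 :=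
    (D.measurable_γ.comp measurable_snd).mul hw
  have e := D.laplace_equation (G := G) hξ hf' t x
  simp_rw [D.vK_eq hm hf]
  simp_rw [D.phi_add_psi hk (measurable_section hw _) (h01 _)]
  rw [potential_const_mul, potential_sub (K := C) (K' := C) hm hH hγw]
  · have hprob := isProbabilityMeasure_transition (P := P) hm t x
    rw [integral_const_mul, integral_sub (integrable_const _)]
    · simp only [integral_const, probReal_univ, smul_eq_mul, mul_one]
      -- As P_t 1 = 1, the constant k cancels, and -k times the equation for the Laplace functional
      -- remains.
      linear_combination (-(k : ℝ)) * e
    · refine integrable_of_abs_le (K := 1) hf'.1.neg.exp fun y => ?_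
      rw [abs_of_nonneg (Real.exp_nonneg _), Real.exp_le_one_iff]
      exact neg_nonpos.2 (hf'.2 _).1
  · intro r _ y
    rw [abs_of_nonneg (hH01 r y).1]
    exact (hH01 r y).2.trans (hC y)
  · intro r _ y
    rw [abs_of_nonneg (mul_nonneg (D.γ_nonneg y) (h01 r y).1)]
    exact (mul_le_of_le_one_right (D.γ_nonneg y) (h01 r y).2).trans (hC y)

end Equation

theorem BPlusBall_mono {E : Type*} [MeasurableSpace E] {a b : ℝ} (h : a ≤ b) {f : E → ℝ}
    (hf : f ∈ BPlusBall E a) : f ∈ BPlusBall E b :=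
  ⟨hf.1, fun x => ⟨(hf.2 x).1, (hf.2 x).2.trans h⟩⟩

theorem abs_le_of_mem_BPlusBall {E : Type*} [MeasurableSpace E] {a : ℝ} {f : E → ℝ}
    (hf : f ∈ BPlusBall E a) (x : E) : |f x| ≤ a := by
  rw [abs_of_nonneg (hf.2 x).1]
  exact (hf.2 x).2

/-- Convergence controls only large k, whereas the bounds are wanted for all k; the finitely many
remaining constants are summed. -/
theorem exists_forall_of_eventually {p : ℕ → ℝ → Prop}
    (hmono : ∀ k C C', C ≤ C' → p k C → p k C') (h : ∀ k, ∃ C, p k C)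
    (h' : ∃ C, ∀ᶠ k in atTop, p k C) : ∃ C, ∀ k, p k C := by
  choose c hc using h
  obtain ⟨C, hC⟩ := h'
  obtain ⟨K, hK⟩ := eventually_atTop.1 hC
  refine ⟨|C| + ∑ i ∈ Finset.range K, |c i|, fun k => ?_⟩
  have hs : 0 ≤ ∑ i ∈ Finset.range K, |c i| := Finset.sum_nonneg fun i _ => abs_nonneg _
  rcases le_or_gt K k with hk | hk
  · exact hmono k _ _ (by linarith [le_abs_self C]) (hK k hk)
  · have := Finset.single_le_sum (f := fun i => |c i|) (fun i _ => abs_nonneg _)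
      (Finset.mem_range.2 hk)
    exact hmono k _ _ (by linarith [le_abs_self (c k), abs_nonneg C]) (hc k)

/-! ### Convergent branching mechanisms -/

/-- Branching mechanisms `H k`, defined on the balls `BPlusBall E k`, which converge to `H'`. -/
structure ConvergentMechanisms {E : Type*} [MeasurableSpace E] (H : ℕ → E → (E → ℝ) → ℝ)
    (H' : E → (E → ℝ) → ℝ) : Prop where
  measurable : ∀ k : ℕ, 1 ≤ k → ∀ v : ℝ≥0 → E → ℝ, (Measurable fun z : ℝ≥0 × E => v z.1 z.2) →
    (∀ r, v r ∈ BPlusBall E k) → Measurable fun z : ℝ≥0 × E => H k z.2 (v z.1)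
  bounded : ∀ k : ℕ, 1 ≤ k → ∃ K, ∀ w ∈ BPlusBall E k, ∀ y, |H k y w| ≤ K
  lower : ∃ c : ℝ, 0 < c ∧ ∀ k : ℕ, 1 ≤ k → ∀ N, ∀ w ∈ BPlusBall E k, (∀ x, w x ≤ N) →
    ∀ y, -(c * N) ≤ H k y w
  lipschitz : ∀ l : ℝ, 0 ≤ l → ∃ C : ℝ, 0 < C ∧ ∀ k : ℕ, 1 ≤ k → l ≤ k →
    ∀ w ∈ BPlusBall E l, ∀ w' ∈ BPlusBall E l, ∀ N, (∀ x, |w x - w' x| ≤ N) →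
      ∀ y, |H k y w - H k y w'| ≤ C * N
  tendsto : ∀ l : ℝ, 0 ≤ l → TendstoUniformlyOn (fun k (z : E × (E → ℝ)) => H k z.1 z.2)
    (fun z => H' z.1 z.2) atTop (univ ×ˢ BPlusBall E l)

namespace BranchingData

variable {E : Type*} [MeasurableSpace E] (D : BranchingData E)
  {G : Kernel E (ProbabilityMeasure E)} [IsMarkovKernel G] {k : ℕ} {w w' : E → ℝ}

theorem one_sub_div_mem_Icc (hk : 1 ≤ k) {z : ℝ} (hz : z ∈ Icc (0 : ℝ) k) :
    1 - z / k ∈ Icc (0 : ℝ) 1 := by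
  have hk0 : (0 : ℝ) < k := by exact_mod_cast hk
  have h1 : z / k ≤ 1 := (div_le_one hk0).2 hz.2
  have h2 : 0 ≤ z / k := div_nonneg hz.1 hk0.le
  exact ⟨by linarith, by linarith⟩

theorem integral_prob_mem_Icc {l : ℝ} (hw : w ∈ BPlusBall E l) (π : ProbabilityMeasure E) :
    ∫ y, w y ∂(π : Measure E) ∈ Icc (0 : ℝ) l :=
  integral_mem_Icc hw.1 hw.2 π

theorem measurable_zeta_integrand {A : Type*} [MeasurableSpace A] {v : A → E → ℝ}
    (hv : Measurable fun z : A × E => v z.1 z.2) :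
    Measurable fun z : (A × E) × ProbabilityMeasure E =>
      k * (1 - D.h z.1.2 z.2 (1 - (∫ y, v z.1.1 y ∂(z.2 : Measure E)) / k)) := by
  have h1 := (measurable_integral_prob hv).comp
    ((measurable_fst.comp measurable_fst).prodMk measurable_snd :
      Measurable fun z : (A × E) × ProbabilityMeasure E => (z.1.1, z.2))
  have h2 : Measurable fun z : (A × E) × ProbabilityMeasure E =>
      1 - (∫ y, v z.1.1 y ∂(z.2 : Measure E)) / k := measurable_const.sub (h1.div_const _)
  have h3 : Measurable fun z : (A × E) × ProbabilityMeasure E =>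
      D.h z.1.2 z.2 (1 - (∫ y, v z.1.1 y ∂(z.2 : Measure E)) / k) :=
    (D.measurable_h.comp (((measurable_snd.comp measurable_fst).prodMk measurable_snd).prodMk h2) :)
  exact (measurable_const.sub h3).const_mul _

theorem measurable_mechanism {v : ℝ≥0 → E → ℝ} (hv : Measurable fun z : ℝ≥0 × E => v z.1 z.2) :
    Measurable fun z : ℝ≥0 × E =>
      D.phi k z.2 (v z.1 z.2) + psi D.β (D.zeta G k) z.2 (v z.1) := by
  have hz : Measurable fun z : ℝ≥0 × E => D.zeta G k z.2 (v z.1) :=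
    ((D.measurable_zeta_integrand (k := k) hv).stronglyMeasurable.integral_kernel_prod_right'
      (κ := G.comap Prod.snd measurable_snd)).measurable
  have hd : Measurable fun z : ℝ≥0 × E => 1 - v z.1 z.2 / k := measurable_const.sub (hv.div_const _)
  have hg : Measurable fun z : ℝ≥0 × E => D.g z.2 (1 - v z.1 z.2 / k) :=
    (D.measurable_g.comp (measurable_snd.prodMk hd) :)
  have hα : Measurable fun z : ℝ≥0 × E => k * D.α z.2 :=
    (D.measurable_α.comp measurable_snd).const_mul _
  exact (hα.mul (hg.sub hd)).add ((D.measurable_β.comp measurable_snd).mul (hv.sub hz))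

theorem integrable_zeta (hk : 1 ≤ k) (hw : w ∈ BPlusBall E k) (x : E) :
    Integrable (fun π => k * (1 - D.h x π (1 - (∫ y, w y ∂(π : Measure E)) / k))) (G x) := by
  have h1 := D.measurable_zeta_integrand (k := k) (A := Unit) (v := fun _ => w)
    (hw.1.comp measurable_snd)
  refine integrable_of_abs_le (K := k) (h1.comp (measurable_prodMk_left (x := ((), x))) :)
    fun π => ?_
  have := D.h_mem_Icc x π (one_sub_div_mem_Icc hk (integral_prob_mem_Icc hw π))
  rw [abs_of_nonneg (mul_nonneg k.cast_nonneg (sub_nonneg.2 this.2))]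
  exact mul_le_of_le_one_right k.cast_nonneg (by linarith [this.1])

/-- The outer factor k cancels the 1/k inside the 1-Lipschitz generating function, so the constant
is independent of k. -/
theorem abs_zeta_integrand_sub_le (hk : 1 ≤ k)
    (hq : ∀ x π, ∑' i : ℕ, (i : ℝ≥0∞) * ENNReal.ofReal (D.q i x π) ≤ 1) (x : E)
    (π : ProbabilityMeasure E) {z z' : ℝ} (hz : z ∈ Icc (0 : ℝ) k) (hz' : z' ∈ Icc (0 : ℝ) k) :
    |k * (1 - D.h x π (1 - z / k)) - k * (1 - D.h x π (1 - z' / k))| ≤ |z - z'| := by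
  have hk0 : (0 : ℝ) < k := by exact_mod_cast hk
  have h : |D.h x π (1 - z' / k) - D.h x π (1 - z / k)| ≤ |(1 - z' / k) - (1 - z / k)| :=
    abs_tsum_mul_pow_sub_le (fun i => D.q_nonneg i x π) (D.q_sum x π) (hq x π)
      (one_sub_div_mem_Icc hk hz') (one_sub_div_mem_Icc hk hz)
  have e1 : k * (1 - D.h x π (1 - z / k)) - k * (1 - D.h x π (1 - z' / k)) =
      k * (D.h x π (1 - z' / k) - D.h x π (1 - z / k)) := by ring
  have e2 : (1 - z' / k) - (1 - z / k) = (z - z') / k := by ring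
  rw [e2, abs_div, abs_of_pos hk0] at h
  rw [e1, abs_mul, abs_of_pos hk0]
  calc _ ≤ k * (|z - z'| / k) := mul_le_mul_of_nonneg_left h hk0.le
    _ = |z - z'| := by field_simp

theorem zeta_mem_Icc (hk : 1 ≤ k)
    (hq : ∀ x π, ∑' i : ℕ, (i : ℝ≥0∞) * ENNReal.ofReal (D.q i x π) ≤ 1)
    (hw : w ∈ BPlusBall E k) {N : ℝ} (hN : ∀ x, w x ≤ N) (x : E) :
    D.zeta G k x w ∈ Icc 0 N := by
  have hwN : w ∈ BPlusBall E N := ⟨hw.1, fun x => ⟨(hw.2 x).1, hN x⟩⟩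
  have hπ := fun π => integral_prob_mem_Icc hw π
  have hh := fun π => D.h_mem_Icc x π (one_sub_div_mem_Icc hk (hπ π))
  refine ⟨integral_nonneg fun π => mul_nonneg k.cast_nonneg (sub_nonneg.2 (hh π).2), ?_⟩
  have : D.zeta G k x w ≤ ∫ _, N ∂(G x) := by
    refine integral_mono (D.integrable_zeta hk hw x) (integrable_const _) fun π => ?_
    have h := D.abs_zeta_integrand_sub_le hk hq x π (hπ π) (left_mem_Icc.2 k.cast_nonneg)
    simp only [zero_div, sub_zero, D.h_one, sub_self, mul_zero] at h
    rw [abs_of_nonneg (hπ π).1] at h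
    exact ((le_abs_self _).trans h).trans (integral_prob_mem_Icc hwN π).2
  simpa using this

theorem abs_zeta_sub_le (hk : 1 ≤ k)
    (hq : ∀ x π, ∑' i : ℕ, (i : ℝ≥0∞) * ENNReal.ofReal (D.q i x π) ≤ 1)
    (hw : w ∈ BPlusBall E k) (hw' : w' ∈ BPlusBall E k) {N : ℝ} (hN : ∀ x, |w x - w' x| ≤ N)
    (x : E) : |D.zeta G k x w - D.zeta G k x w'| ≤ N := by
  rw [zeta, zeta, ← integral_sub (D.integrable_zeta hk hw x) (D.integrable_zeta hk hw' x)]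
  refine abs_integral_le_of_abs_le fun π => ?_
  refine (D.abs_zeta_integrand_sub_le hk hq x π (integral_prob_mem_Icc hw π)
    (integral_prob_mem_Icc hw' π)).trans ?_
  rw [← integral_sub (integrable_of_abs_le hw.1 (abs_le_of_mem_BPlusBall hw))
    (integrable_of_abs_le hw'.1 (abs_le_of_mem_BPlusBall hw'))]
  exact abs_integral_le_of_abs_le hN

theorem phi_zero (x : E) : D.phi k x 0 = 0 := by simp [phi, D.g_one]

theorem abs_phi_le (hk : 1 ≤ k) {A : ℝ} (hA : ∀ x, D.α x ≤ A) (x : E) {z : ℝ}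
    (hz : z ∈ Icc (0 : ℝ) k) : |D.phi k x z| ≤ k * A := by
  have h1 := one_sub_div_mem_Icc hk hz
  have h2 := D.g_mem_Icc x h1
  have h3 : |D.g x (1 - z / k) - (1 - z / k)| ≤ 1 :=
    abs_le.2 ⟨by linarith [h1.2, h2.1], by linarith [h1.1, h2.2]⟩
  have h4 : (0 : ℝ) ≤ k * D.α x := mul_nonneg k.cast_nonneg (D.α_nonneg x)
  rw [phi, abs_mul, abs_of_nonneg h4]
  exact (mul_le_of_le_one_right h4 h3).trans (mul_le_mul_of_nonneg_left (hA x) k.cast_nonneg)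

/-- The local mechanism lies above the lines which are tangent near the origin. -/
theorem neg_mul_le_phi (hk : 1 ≤ k) {L : ℝ} {x : E}
    (hL : ∀ z ∈ Icc (0 : ℝ) 1, |D.phi k x z| ≤ L * z) {z : ℝ} (hz : z ∈ Icc (0 : ℝ) k) :
    -(L * z) ≤ D.phi k x z := by
  rcases le_or_gt z 1 with h1 | h1
  · exact (abs_le.1 (hL z ⟨hz.1, h1⟩)).1
  have hk0 : (0 : ℝ) < k := by exact_mod_cast hk
  have hz0 : 0 < z := one_pos.trans h1
  have hzi : z⁻¹ ≤ 1 := inv_le_one_of_one_le₀ h1.le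
  -- For z > 1, the point 1 - 1/k is the convex combination of 1 - z/k and 1 with weights 1/z and 1
  -- - 1/z. As φ_k vanishes at 0, convexity gives φ_k(x,1) ≤ φ_k(x,z)/z.
  have hc : D.g x (z⁻¹ * (1 - z / k) + (1 - z⁻¹) * 1) ≤
      z⁻¹ * D.g x (1 - z / k) + (1 - z⁻¹) * D.g x 1 :=
    tsum_mul_pow_convex (fun i => D.p_nonneg i x) (D.p_sum x) (one_sub_div_mem_Icc hk hz)
      ⟨zero_le_one, le_rfl⟩ (inv_nonneg.2 hz0.le) (sub_nonneg.2 hzi) (by ring)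
  have e : z⁻¹ * (1 - z / k) + (1 - z⁻¹) * 1 = 1 - 1 / k := by field_simp; ring
  rw [e, D.g_one] at hc
  have h2 := (abs_le.1 (hL 1 ⟨zero_le_one, le_rfl⟩)).1
  have h3 : D.phi k x 1 ≤ z⁻¹ * D.phi k x z := by
    have := mul_le_mul_of_nonneg_left hc (mul_nonneg hk0.le (D.α_nonneg x))
    calc D.phi k x 1 = k * D.α x * D.g x (1 - 1 / k) - k * D.α x * (1 - 1 / k) := by
          rw [phi, mul_sub]
      _ ≤ k * D.α x * (z⁻¹ * D.g x (1 - z / k) + (1 - z⁻¹) * 1) - k * D.α x * (1 - 1 / k) :=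
          sub_le_sub_right this _
      _ = z⁻¹ * D.phi k x z := by rw [phi, ← e]; ring
  have h4 := mul_le_mul_of_nonneg_left h3 hz0.le
  rw [← mul_assoc, mul_inv_cancel₀ hz0.ne', one_mul] at h4
  nlinarith

end BranchingData

/-- The difference splits into a change of argument and mechanism at a fixed rate and a change of
rate at a fixed argument. With equal rates (δ = 0) this is the Lipschitz estimate, with equal
arguments (N = 0) the convergence estimate. -/
theorem abs_psi_sub_le {E : Type*} {β β' : E → ℝ} {ζ ζ' : E → (E → ℝ) → ℝ} {w w' : E → ℝ} {x : E}
    {B N δ δ' l : ℝ} (hβ : |β x| ≤ B) (hββ' : |β x - β' x| ≤ δ) (hN : |w x - w' x| ≤ N)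
    (hζ : |ζ x w - ζ' x w'| ≤ δ') (hl : |w' x - ζ' x w'| ≤ l) :
    |psi β ζ x w - psi β' ζ' x w'| ≤ B * (N + δ') + δ * l := by
  have e : psi β ζ x w - psi β' ζ' x w' =
      β x * ((w x - w' x) - (ζ x w - ζ' x w')) + (β x - β' x) * (w' x - ζ' x w') := by
    unfold psi; ring
  rw [e]
  refine (abs_add_le _ _).trans (add_le_add ?_ ?_)
  · rw [abs_mul]
    exact mul_le_mul hβ ((abs_sub _ _).trans (add_le_add hN hζ)) (abs_nonneg _)
      ((abs_nonneg _).trans hβ)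
  · rw [abs_mul]
    exact mul_le_mul hββ' hl (abs_nonneg _) ((abs_nonneg _).trans hββ')

/-! ### Verification for the rescaled branching mechanisms. -/

section Convergence

variable {E : Type*} [MeasurableSpace E] {G : Kernel E (ProbabilityMeasure E)} [IsMarkovKernel G]
  {D : ℕ → BranchingData E} {ζ : E → (E → ℝ) → ℝ} {φ : E → ℝ → ℝ} {β : E → ℝ}

theorem exists_forall_β_le (hβ : β ∈ BPlus E)
    (hβ_lim : TendstoUniformly (fun k => (D k).β) β atTop) :
    ∃ B, 0 ≤ B ∧ (∀ x, β x ≤ B) ∧ ∀ k x, (D k).β x ≤ B := by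
  obtain ⟨b, hb⟩ := hβ
  obtain ⟨B, hB⟩ := exists_forall_of_eventually (p := fun k C => ∀ x, (D k).β x ≤ C)
    (fun k C C' h hC x => (hC x).trans h)
    (fun k => (D k).exists_β_le.imp fun C hC => hC.2) ⟨b + 1, by
      filter_upwards [Metric.tendstoUniformly_iff.1 hβ_lim 1 one_pos] with k hk x
      have := abs_lt.1 (Real.dist_eq _ _ ▸ hk x)
      linarith [(hb.2 x).2]⟩
  exact ⟨max 0 (max b B), le_max_left _ _, fun x => (hb.2 x).2.trans (by simp),
    fun k x => (hB k x).trans (by simp)⟩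

theorem convergentMechanisms
    (hq : ∀ k, 1 ≤ k → ∀ x π, ∑' i : ℕ, (i : ℝ≥0∞) * ENNReal.ofReal ((D k).q i x π) ≤ 1)
    (hζ : ∀ a : ℝ, 0 ≤ a → TendstoUniformlyOn
      (fun k (z : E × (E → ℝ)) => (D k).zeta G k z.1 z.2) (fun z => ζ z.1 z.2) atTop
      (univ ×ˢ BPlusBall E a))
    (hLip : ∀ l : ℝ, 0 ≤ l → ∃ L : ℝ, ∀ k : ℕ, 1 ≤ k → l ≤ k → ∀ x, ∀ z ∈ Icc 0 l, ∀ z' ∈ Icc 0 l,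
      |(D k).phi k x z - (D k).phi k x z'| ≤ L * |z - z'|)
    (hφ : ∀ l : ℝ, 0 ≤ l → TendstoUniformlyOn
      (fun k (z : E × ℝ) => (D k).phi k z.1 z.2) (fun z => φ z.1 z.2) atTop
      (univ ×ˢ Icc 0 l))
    (hβ : β ∈ BPlus E) (hβ_lim : TendstoUniformly (fun k => (D k).β) β atTop) :
    ConvergentMechanisms
      (fun k y w => (D k).phi k y (w y) + psi (D k).β ((D k).zeta G k) y w)
      (fun y w => φ y (w y) + psi β ζ y w) := by
  obtain ⟨B, hB0, hβB, hB⟩ := exists_forall_β_le hβ hβ_lim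
  refine ⟨fun k hk v hv _ => (D k).measurable_mechanism hv, fun k hk => ?_, ?_, fun l hl => ?_,
    fun l hl => ?_⟩
  · obtain ⟨A, -, hA⟩ := (D k).exists_α_le
    refine ⟨k * A + B * k, fun w hw y => (abs_add_le _ _).trans (add_le_add
      ((D k).abs_phi_le hk hA y (hw.2 y)) ?_)⟩
    have hz := (D k).zeta_mem_Icc (G := G) hk (hq k hk) hw (fun x => (hw.2 x).2) y
    rw [psi, abs_mul, abs_of_nonneg ((D k).β_nonneg y)]
    exact mul_le_mul (hB k y) (abs_le.2 ⟨by linarith [hz.2, (hw.2 y).1],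
      by linarith [hz.1, (hw.2 y).2]⟩) (abs_nonneg _) hB0
  · obtain ⟨L, hL⟩ := hLip 1 zero_le_one
    -- Here `max L 0` stems from the local mechanism on [0,1] and B from ζ_k ≤ N; the summand 1 only
    -- makes the constant positive.
    refine ⟨max L 0 + B + 1, by positivity, fun k hk N w hw hN y => ?_⟩
    have hN0 : 0 ≤ N := (hw.2 y).1.trans (hN y)
    have h1 : -(max L 0 * w y) ≤ (D k).phi k y (w y) := by
      refine (D k).neg_mul_le_phi hk (fun z hz => ?_) (hw.2 y)
      have := hL k hk (by exact_mod_cast hk) y z hz 0 (left_mem_Icc.2 zero_le_one)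
      rw [(D k).phi_zero, sub_zero, sub_zero, abs_of_nonneg hz.1] at this
      exact this.trans (mul_le_mul_of_nonneg_right (le_max_left _ _) hz.1)
    have h2 : max L 0 * w y ≤ max L 0 * N := mul_le_mul_of_nonneg_left (hN y) (le_max_right _ _)
    have hz := (D k).zeta_mem_Icc (G := G) hk (hq k hk) hw hN y
    have h3 : -(B * N) ≤ psi (D k).β ((D k).zeta G k) y w := by
      have h4 : (D k).β y * N ≤ B * N := mul_le_mul_of_nonneg_right (hB k y) hN0
      have h5 : (D k).β y * -N ≤ (D k).β y * (w y - (D k).zeta G k y w) :=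
        mul_le_mul_of_nonneg_left (by linarith [(hw.2 y).1, hz.2]) ((D k).β_nonneg y)
      rw [psi]
      linarith
    linarith
  · obtain ⟨L, hL⟩ := hLip l hl
    -- The factor 2 is due to w and ζ_k(·, w), which both vary by at most N.
    refine ⟨max L 0 + B * 2 + 1, by positivity, fun k hk hlk w hw w' hw' N hN y => ?_⟩
    have hN0 : 0 ≤ N := (abs_nonneg _).trans (hN y)
    have hwk := BPlusBall_mono hlk hw
    have hwk' := BPlusBall_mono hlk hw'
    have hz := (D k).zeta_mem_Icc (G := G) hk (hq k hk) hwk' (fun x => (hw'.2 x).2) y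
    have h1 : |(D k).phi k y (w y) - (D k).phi k y (w' y)| ≤ max L 0 * N :=
      (hL k hk hlk y _ (hw.2 y) _ (hw'.2 y)).trans
        (mul_le_mul (le_max_left _ _) (hN y) (abs_nonneg _) (le_max_right _ _))
    have h2 := abs_psi_sub_le (δ := 0) (l := l) (β' := (D k).β)
      ((abs_of_nonneg ((D k).β_nonneg y)).trans_le (hB k y)) (by simp) (hN y)
      ((D k).abs_zeta_sub_le (G := G) hk (hq k hk) hwk hwk' hN y)
      (abs_le.2 ⟨by linarith [hz.2, (hw'.2 y).1], by linarith [hz.1, (hw'.2 y).2]⟩)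
    rw [add_sub_add_comm]
    refine (abs_add_le _ _).trans ((add_le_add h1 h2).trans ?_)
    linarith
  · rw [Metric.tendstoUniformlyOn_iff]
    intro ε hε
    -- The limit ζ inherits the range [0,l] from the ζ_k with k ≥ l.
    have hζl : ∀ w ∈ BPlusBall E l, ∀ x, ζ x w ∈ Icc 0 l := fun w hw x => by
      refine isClosed_Icc.mem_of_tendsto ((hζ l hl).tendsto_at (x := (x, w)) ⟨mem_univ _, hw⟩) ?_
      filter_upwards [eventually_ge_atTop 1, eventually_ge_atTop ⌈l⌉₊] with k hk hkl
      exact (D k).zeta_mem_Icc hk (hq k hk) (BPlusBall_mono (Nat.ceil_le.1 hkl) hw)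
        (fun x => (hw.2 x).2) x
    -- The local part contributes δ, the non-local mechanism B δ and the rate δ l, in total ε/2.
    have hδ : 0 < ε / (2 * (1 + B + l)) := by positivity
    filter_upwards [Metric.tendstoUniformlyOn_iff.1 (hζ l hl) _ hδ,
      Metric.tendstoUniformlyOn_iff.1 (hφ l hl) _ hδ,
      Metric.tendstoUniformly_iff.1 hβ_lim _ hδ] with k h1 h2 h3 z hz
    obtain ⟨y, w⟩ := z
    have hw : w ∈ BPlusBall E l := hz.2
    have e1 := h1 (y, w) hz
    have e2 := h2 (y, w y) ⟨mem_univ _, hw.2 y⟩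
    have e3 := h3 y
    have hzl := hζl w hw y
    rw [dist_comm, Real.dist_eq] at e1 e2 e3 ⊢
    have e4 := abs_psi_sub_le (w := w) (w' := w) (N := 0) (l := l)
      ((abs_of_nonneg ((D k).β_nonneg y)).trans_le (hB k y)) e3.le (by simp) e1.le
      (abs_le.2 ⟨by linarith [hzl.2, (hw.2 y).1], by linarith [hzl.1, (hw.2 y).2]⟩)
    rw [add_sub_add_comm]
    refine (abs_add_le _ _).trans_lt ((add_le_add e2.le e4).trans_lt ?_)
    have : ε / (2 * (1 + B + l)) + (B * (0 + ε / (2 * (1 + B + l))) + ε / (2 * (1 + B + l)) * l) =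
        ε / 2 := by field_simp; ring
    linarith

end Convergence

/-! ### A comparison theorem -/

section Gronwall

variable {E Ω : Type*} [MeasurableSpace E] [MeasurableSpace Ω] {ξ : ℝ≥0 → Ω → E} {P : Kernel E Ω}
  [IsMarkovKernel P] {R R' : ℝ≥0 → E → ℝ} {K K' : ℝ} {t : ℝ≥0} {x : E}

theorem potential_mono (hξ : Measurable fun z : ℝ≥0 × Ω => ξ z.1 z.2)
    (hR : Measurable fun z : ℝ≥0 × E => R z.1 z.2) (hR' : Measurable fun z : ℝ≥0 × E => R' z.1 z.2)
    (hK : ∀ r ≤ t, ∀ y, |R r y| ≤ K) (hK' : ∀ r ≤ t, ∀ y, |R' r y| ≤ K')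
    (h : ∀ r ≤ t, ∀ y, R r y ≤ R' r y) : potential ξ P R t x ≤ potential ξ P R' t x :=
  intervalIntegral.integral_mono_on t.coe_nonneg (intervalIntegrable_transition hξ hR hK)
    (intervalIntegrable_transition hξ hR' hK') fun _ _ =>
      integral_mono (integrable_transition hξ hR hK tsub_le_self _)
        (integrable_transition hξ hR' hK' tsub_le_self _) (h _ tsub_le_self)

theorem abs_potential_le_potential_abs (hξ : Measurable fun z : ℝ≥0 × Ω => ξ z.1 z.2)
    (hR : Measurable fun z : ℝ≥0 × E => R z.1 z.2) (hK : ∀ r ≤ t, ∀ y, |R r y| ≤ K) :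
    |potential ξ P R t x| ≤ potential ξ P (fun r y => |R r y|) t x := by
  have hR1 : Measurable fun z : ℝ≥0 × E => |R z.1 z.2| := hR.abs
  have hK1 : ∀ r ≤ t, ∀ y, |(|R r y|)| ≤ K := fun r hr y => by rw [abs_abs]; exact hK r hr y
  refine abs_le.2 ⟨?_, potential_mono hξ hR hR1 hK hK1 fun r _ y => le_abs_self _⟩
  have := potential_mono (P := P) (x := x) (R := fun r y => (-1) * R r y) (K := K) hξ
    (hR.const_mul _) hR1 (by simpa using hK) hK1 fun r _ y => by simpa using neg_le_abs (R r y)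
  rw [potential_const_mul] at this
  linarith

/-- Doubling the exponent gains the factor 1/2 that makes the Gronwall step a contraction. -/
theorem integral_mul_exp_add_const (C M ε t : ℝ) :
    ∫ s in (0 : ℝ)..t, (C * (M * Real.exp (2 * C * (t - s))) + ε) =
      M / 2 * (Real.exp (2 * C * t) - 1) + ε * t := by
  rw [intervalIntegral.integral_comp_sub_left
    (fun s => C * (M * Real.exp (2 * C * s)) + ε), sub_self, sub_zero,
    intervalIntegral.integral_eq_sub_of_hasDerivAt
      (f := fun s => M / 2 * Real.exp (2 * C * s) + ε * s)]
  · simp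
    ring
  · intro s _
    have h1 : HasDerivAt (fun s : ℝ => 2 * C * s) (2 * C) s := by
      simpa using (hasDerivAt_id s).const_mul (2 * C)
    have h2 : HasDerivAt (fun s : ℝ => ε * s) ε s := by
      simpa using (hasDerivAt_id s).const_mul ε
    exact ((h1.exp.const_mul (M / 2)).fun_add h2).congr_deriv (by ring)
  · exact Continuous.intervalIntegrable (by fun_prop) _ _

/-- A one-sided Gronwall inequality for the potential operator. -/
theorem le_mul_exp_of_le_potential (hξ : Measurable fun z : ℝ≥0 × Ω => ξ z.1 z.2)
    (hR : Measurable fun z : ℝ≥0 × E => R z.1 z.2) {T : ℝ≥0} (hK : ∀ r ≤ T, ∀ y, |R r y| ≤ K)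
    {u : ℝ≥0 → E → ℝ} (hu : ∀ r ≤ T, ∀ y, u r y ≤ K') {A C ε : ℝ} (hA : 0 ≤ A) (hC : 0 < C)
    (hε : 0 ≤ ε) (hle : ∀ t ≤ T, ∀ x, u t x ≤ A + potential ξ P R t x)
    (hRu : ∀ t ≤ T, ∀ N, 0 ≤ N → (∀ y, u t y ≤ N) → ∀ y, R t y ≤ C * N + ε)
    (ht : t ≤ T) : u t x ≤ 2 * (A + ε * T) * Real.exp (2 * C * t) := by
  -- The supremum of u(t,x) over x need not be measurable in t, so the classical Gronwall argument
  -- is replaced by one on the set of admissible constants for the weight exp(2Ct).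
  set S : Set ℝ := {M | 0 ≤ M ∧ ∀ t ≤ T, ∀ x, u t x ≤ M * Real.exp (2 * C * t)} with hS
  have hone : ∀ t : ℝ≥0, 1 ≤ Real.exp (2 * C * t) := fun t =>
    Real.one_le_exp (by positivity)
  have hne : S.Nonempty := by
    refine ⟨max K' 0, le_max_right _ _, fun t ht x => ((hu t ht x).trans (le_max_left _ 0)).trans ?_⟩
    exact le_mul_of_one_le_right (le_max_right _ _) (hone t)
  have hbdd : BddBelow S := ⟨0, fun M hM => hM.1⟩
  -- Inserting an admissible M into the inequality produces A + εT + M/2, which is again admissible;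
  -- hence the infimum is at most 2(A + εT).
  have hstep : ∀ M ∈ S, A + ε * T + M / 2 ∈ S := by
    intro M hM
    have hM0 : 0 ≤ M := hM.1
    refine ⟨by positivity, fun t ht x => ?_⟩
    have h1 := potential_le_integral (P := P) (x := x) (t := t) hξ hR
      (fun r hr => hK r (hr.trans ht)) (b := fun s => C * (M * Real.exp (2 * C * s)) + ε)
      (by fun_prop) (fun r hr y => hRu r (hr.trans ht) _ (by positivity) (hM.2 r (hr.trans ht)) y)
    rw [integral_mul_exp_add_const] at h1
    have h2 : ε * t ≤ ε * T := mul_le_mul_of_nonneg_left (by exact_mod_cast ht) hε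
    have h3 : A + ε * T ≤ (A + ε * T) * Real.exp (2 * C * t) :=
      le_mul_of_one_le_right (by positivity) (hone t)
    have h4 := hle t ht x
    nlinarith
  have hm : sInf S ≤ 2 * (A + ε * T) := by
    have h : sInf S - (A + ε * T) ≤ sInf S / 2 := by
      rw [le_div_iff₀ two_pos]
      refine le_csInf hne fun M hM => ?_
      have := csInf_le hbdd (hstep M hM)
      linarith
    linarith
  have hus : u t x ≤ sInf S * Real.exp (2 * C * t) := by
    rw [← div_le_iff₀ (Real.exp_pos _)]
    exact le_csInf hne fun M hM => (div_le_iff₀ (Real.exp_pos _)).2 (hM.2 t ht x)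
  exact hus.trans (mul_le_mul_of_nonneg_right hm (Real.exp_nonneg _))

/-- Stability of solutions of evolution equations. -/
theorem abs_sub_le_mul_exp (hξ : Measurable fun z : ℝ≥0 × Ω => ξ z.1 z.2)
    (hR : Measurable fun z : ℝ≥0 × E => R z.1 z.2) (hR' : Measurable fun z : ℝ≥0 × E => R' z.1 z.2)
    {T : ℝ≥0} (hK : ∀ r ≤ T, ∀ y, |R r y| ≤ K) (hK' : ∀ r ≤ T, ∀ y, |R' r y| ≤ K')
    {w w' F F' : ℝ≥0 → E → ℝ} {l : ℝ} (hw : ∀ r ≤ T, ∀ y, |w r y - w' r y| ≤ l) {A C ε : ℝ}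
    (hC : 0 < C) (hε : 0 ≤ ε)
    (hwF : ∀ t ≤ T, ∀ x, w t x + potential ξ P R t x = F t x)
    (hwF' : ∀ t ≤ T, ∀ x, w' t x + potential ξ P R' t x = F' t x)
    (hF : ∀ t ≤ T, ∀ x, |F t x - F' t x| ≤ A)
    (hRw : ∀ r ≤ T, ∀ N, (∀ y, |w r y - w' r y| ≤ N) → ∀ y, |R r y - R' r y| ≤ C * N + ε)
    (ht : t ≤ T) : |w t x - w' t x| ≤ 2 * (A + ε * T) * Real.exp (2 * C * t) := by
  have hA : 0 ≤ A := (abs_nonneg _).trans (hF t ht x)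
  have hd : Measurable fun z : ℝ≥0 × E => R z.1 z.2 - R' z.1 z.2 := hR.sub hR'
  have hdK : ∀ r ≤ T, ∀ y, |R r y - R' r y| ≤ K + K' := fun r hr y =>
    (abs_sub _ _).trans (add_le_add (hK r hr y) (hK' r hr y))
  refine le_mul_exp_of_le_potential (P := P) (R := fun r y => |R r y - R' r y|) (K := K + K')
    (K' := l) (u := fun t x => |w t x - w' t x|) hξ hd.abs
    (fun r hr y => by rw [abs_abs]; exact hdK r hr y) hw hA hC hε (fun t ht x => ?_)
    (fun r hr N _ hN => hRw r hr N hN) ht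
  have h1 := abs_potential_le_potential_abs (P := P) (x := x) (t := t)
    (R := fun r y => R r y - R' r y) hξ hd fun r hr => hdK r (hr.trans ht)
  rw [potential_sub hξ hR hR' (fun r hr => hK r (hr.trans ht)) (fun r hr => hK' r (hr.trans ht))]
    at h1
  have e : w t x - w' t x = (F t x - F' t x) - (potential ξ P R t x - potential ξ P R' t x) := by
    rw [← hwF t ht x, ← hwF' t ht x]; ring
  rw [e]
  refine (abs_sub _ _).trans (add_le_add (hF t ht x) ?_)
  simpa [potential_sub hξ hR hR' (fun r hr => hK r (hr.trans ht))
    (fun r hr => hK' r (hr.trans ht))] using h1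

end Gronwall

/-! ### The limit mechanism -/

namespace ConvergentMechanisms

variable {E : Type*} [MeasurableSpace E] {H : ℕ → E → (E → ℝ) → ℝ} {H' : E → (E → ℝ) → ℝ}

theorem tendsto_at (h : ConvergentMechanisms H H') {l : ℝ} {w : E → ℝ} (hl : 0 ≤ l)
    (hw : w ∈ BPlusBall E l) (y : E) : Tendsto (fun k => H k y w) atTop (𝓝 (H' y w)) :=
  (h.tendsto l hl).tendsto_at (x := (y, w)) ⟨mem_univ _, hw⟩

theorem lipschitz_limit (h : ConvergentMechanisms H H') {l : ℝ} (hl : 0 ≤ l) :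
    ∃ C : ℝ, 0 < C ∧ ∀ w ∈ BPlusBall E l, ∀ w' ∈ BPlusBall E l, ∀ N, (∀ x, |w x - w' x| ≤ N) →
      ∀ y, |H' y w - H' y w'| ≤ C * N := by
  obtain ⟨C, hC, hCk⟩ := h.lipschitz l hl
  refine ⟨C, hC, fun w hw w' hw' N hN y => ?_⟩
  refine le_of_tendsto ((h.tendsto_at hl hw y).sub (h.tendsto_at hl hw' y)).abs ?_
  filter_upwards [eventually_ge_atTop 1, eventually_ge_atTop ⌈l⌉₊] with k hk hkl
  exact hCk k hk (Nat.ceil_le.1 hkl) w hw w' hw' N hN y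

theorem bounded_limit (h : ConvergentMechanisms H H') {l : ℝ} (hl : 0 ≤ l) :
    ∃ K : ℝ, ∀ w ∈ BPlusBall E l, ∀ y, |H' y w| ≤ K := by
  obtain ⟨k, hk1, hkl, hk⟩ := ((eventually_ge_atTop 1).and ((eventually_ge_atTop ⌈l⌉₊).and
    (Metric.tendstoUniformlyOn_iff.1 (h.tendsto l hl) 1 one_pos))).exists
  obtain ⟨K, hK⟩ := h.bounded k hk1
  refine ⟨1 + K, fun w hw y => ?_⟩
  have h1 := hk (y, w) ⟨mem_univ _, hw⟩
  rw [Real.dist_eq] at h1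
  have h2 := hK w (BPlusBall_mono (Nat.ceil_le.1 hkl) hw) y
  calc |H' y w| = |(H' y w - H k y w) + H k y w| := by rw [sub_add_cancel]
    _ ≤ 1 + K := (abs_add_le _ _).trans (add_le_add h1.le h2)

/-- The bound for v r may depend on r, whereas H k is controlled only on the ball of radius k. The
argument is truncated at k + 1, and for each fixed r the truncation is eventually inactive. -/
theorem measurable_limit (h : ConvergentMechanisms H H') {v : ℝ≥0 → E → ℝ}
    (hv : Measurable fun z : ℝ≥0 × E => v z.1 z.2)
    (hvb : ∀ r, ∃ l, 0 ≤ l ∧ v r ∈ BPlusBall E l) :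
    Measurable fun z : ℝ≥0 × E => H' z.2 (v z.1) := by
  have h0 : ∀ r y, 0 ≤ v r y := fun r y => by
    obtain ⟨l, -, hl⟩ := hvb r
    exact (hl.2 y).1
  have hm : ∀ k : ℕ, Measurable fun z : ℝ≥0 × E =>
      H (k + 1) z.2 (fun y => min (v z.1 y) ((k + 1 : ℕ) : ℝ)) := fun k => by
    have hc : Measurable fun z : ℝ≥0 × E => min (v z.1 z.2) ((k + 1 : ℕ) : ℝ) :=
      hv.min measurable_const
    exact h.measurable (k + 1) (by simp) (fun r y => min (v r y) ((k + 1 : ℕ) : ℝ)) hc fun r =>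
      ⟨measurable_section (R := fun r y => min (v r y) ((k + 1 : ℕ) : ℝ)) hc r, fun x => ⟨le_min (h0 r x) (Nat.cast_nonneg _), min_le_right _ _⟩⟩
  refine measurable_of_tendsto_metrizable hm (tendsto_pi_nhds.2 fun z => ?_)
  obtain ⟨l, hl, hlv⟩ := hvb z.1
  refine ((h.tendsto_at hl hlv z.2).comp (tendsto_add_atTop_nat 1)).congr' ?_
  filter_upwards [eventually_ge_atTop ⌈l⌉₊] with k hk
  have hkl : l ≤ k := Nat.ceil_le.1 hk
  have e : (fun y => min (v z.1 y) ((k + 1 : ℕ) : ℝ)) = v z.1 := by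
    funext y
    refine min_eq_left ((hlv.2 y).2.trans (hkl.trans ?_))
    push_cast
    linarith
  rw [e]
  rfl

end ConvergentMechanisms

/-! ### The initial values -/

theorem mul_one_sub_exp_mem_Icc {k : ℕ} (hk : 1 ≤ k) {z : ℝ} (hz : 0 ≤ z) :
    k * (1 - Real.exp (-(z / k))) ∈ Icc (z - z ^ 2 / k) z := by
  have hk0 : (0 : ℝ) < k := by exact_mod_cast hk
  have hy : 0 ≤ z / k := div_nonneg hz hk0.le
  -- For y ≥ 0 one has exp(-y) ≤ 1/(1+y) ≤ 1 - y + y², the last step because (1+y)(1 - y + y²) = 1 +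
  -- y³.
  have h1 : Real.exp (-(z / k)) ≤ 1 - z / k + (z / k) ^ 2 := by
    have h2 : Real.exp (-(z / k)) ≤ (1 + z / k)⁻¹ := by
      rw [Real.exp_neg]
      exact inv_anti₀ (by positivity) (by linarith [Real.add_one_le_exp (z / k)])
    refine h2.trans ((inv_le_iff_one_le_mul₀ (by positivity)).2 ?_)
    nlinarith [pow_nonneg hy 3]
  constructor
  · calc z - z ^ 2 / k = k * (1 - (1 - z / k + (z / k) ^ 2)) := by field_simp; ring
      _ ≤ _ := mul_le_mul_of_nonneg_left (by linarith) hk0.le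
  · calc _ ≤ k * (z / k) :=
          mul_le_mul_of_nonneg_left (by linarith [Real.add_one_le_exp (-(z / k))]) hk0.le
      _ = z := by field_simp

section Initial

variable {E : Type*} [MeasurableSpace E] {f : E → ℝ} {a : ℝ} {k : ℕ}

theorem mul_one_sub_exp_mem_BPlusBall (hk : 1 ≤ k) (hf : f ∈ BPlusBall E a) :
    (fun y => k * (1 - Real.exp (-(f y / k)))) ∈ BPlusBall E a := by
  refine ⟨(measurable_const.sub (hf.1.div_const _).neg.exp).const_mul _, fun y => ⟨?_, ?_⟩⟩
  · refine mul_nonneg k.cast_nonneg (sub_nonneg.2 (Real.exp_le_one_iff.2 ?_))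
    exact neg_nonpos.2 (div_nonneg (hf.2 y).1 k.cast_nonneg)
  · exact (mul_one_sub_exp_mem_Icc hk (hf.2 y).1).2.trans (hf.2 y).2

theorem abs_integral_mul_one_sub_exp_sub_le (hk : 1 ≤ k) (hf : f ∈ BPlusBall E a)
    (μ : Measure E) [IsProbabilityMeasure μ] :
    |∫ y, k * (1 - Real.exp (-(f y / k))) ∂μ - ∫ y, f y ∂μ| ≤ a ^ 2 / k := by
  have hg := mul_one_sub_exp_mem_BPlusBall hk hf
  rw [← integral_sub (integrable_of_abs_le hg.1 (abs_le_of_mem_BPlusBall hg))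
    (integrable_of_abs_le hf.1 (abs_le_of_mem_BPlusBall hf))]
  refine abs_integral_le_of_abs_le fun y => ?_
  have h := mul_one_sub_exp_mem_Icc hk (hf.2 y).1
  have h2 : f y ^ 2 / k ≤ a ^ 2 / k :=
    div_le_div_of_nonneg_right (pow_le_pow_left₀ (hf.2 y).1 (hf.2 y).2 2) k.cast_nonneg
  have h3 : 0 ≤ a ^ 2 / (k : ℝ) := by positivity
  exact abs_le.2 ⟨by linarith [h.1], by linarith [h.2]⟩

end Initial

/-! ### Convergence of solutions -/

/-- Solutions `v k f`, started from `k (1 - exp (-f / k))`, of the evolution equations with the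
mechanisms `H k`. -/
structure ApproximateSolutions {E Ω : Type*} [MeasurableSpace E] [MeasurableSpace Ω]
    (ξ : ℝ≥0 → Ω → E) (P : Kernel E Ω) (H : ℕ → E → (E → ℝ) → ℝ)
    (v : ℕ → (E → ℝ) → ℝ≥0 → E → ℝ) : Prop where
  mem : ∀ k : ℕ, 1 ≤ k → ∀ a, ∀ f ∈ BPlusBall E a, ∀ t, v k f t ∈ BPlusBall E k
  measurable : ∀ k : ℕ, 1 ≤ k → ∀ a, ∀ f ∈ BPlusBall E a,
    Measurable fun z : ℝ≥0 × E => v k f z.1 z.2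
  equation : ∀ k : ℕ, 1 ≤ k → ∀ a, ∀ f ∈ BPlusBall E a, ∀ t x,
    v k f t x + potential ξ P (fun r y => H k y (v k f r)) t x =
      ∫ y, k * (1 - Real.exp (-(f y / k))) ∂(transition ξ P t x)

namespace ApproximateSolutions

variable {E Ω : Type*} [MeasurableSpace E] [MeasurableSpace Ω] {ξ : ℝ≥0 → Ω → E} {P : Kernel E Ω}
  {H : ℕ → E → (E → ℝ) → ℝ} {H' : E → (E → ℝ) → ℝ} {v : ℕ → (E → ℝ) → ℝ≥0 → E → ℝ} {a : ℝ}

theorem measurable_source (hv : ApproximateSolutions ξ P H v) (h : ConvergentMechanisms H H')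
    {k : ℕ} (hk : 1 ≤ k) {f : E → ℝ} (hf : f ∈ BPlusBall E a) :
    Measurable fun z : ℝ≥0 × E => H k z.2 (v k f z.1) :=
  h.measurable k hk _ (hv.measurable k hk a f hf) (hv.mem k hk a f hf)

variable [IsMarkovKernel P]

/-- The a priori bound v ≤ k is used only to start the Gronwall argument and leaves no trace in the
result. The source is -H_k, so a lower bound of H_k that is linear in the supremum suffices. -/
theorem exists_bound (hv : ApproximateSolutions ξ P H v) (h : ConvergentMechanisms H H')
    (hξ : Measurable fun z : ℝ≥0 × Ω => ξ z.1 z.2) (ha : 0 ≤ a) (T : ℝ≥0) :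
    ∃ l, 0 ≤ l ∧ ∀ k, 1 ≤ k → ∀ f ∈ BPlusBall E a, ∀ t ≤ T, v k f t ∈ BPlusBall E l := by
  obtain ⟨c, hc, hlow⟩ := h.lower
  refine ⟨2 * a * Real.exp (2 * c * T), by positivity, fun k hk f hf t ht =>
    ⟨(hv.mem k hk a f hf t).1, fun x => ⟨((hv.mem k hk a f hf t).2 x).1, ?_⟩⟩⟩
  obtain ⟨K, hK⟩ := h.bounded k hk
  have hmem := hv.mem k hk a f hf
  have hg := mul_one_sub_exp_mem_BPlusBall hk hf
  have key := le_mul_exp_of_le_potential (P := P) (R := fun r y => (-1) * H k y (v k f r)) (K := K)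
    (K' := k) (u := v k f) (A := a) (ε := 0) (T := T) (x := x) hξ
    ((hv.measurable_source h hk hf).const_mul _)
    (fun r _ y => by simpa using hK _ (hmem r) y) (fun r _ y => ((hmem r).2 y).2) ha hc le_rfl
    (fun t _ x => ?_) (fun r _ N _ hN y => ?_) ht
  · refine key.trans ?_
    rw [zero_mul, add_zero]
    gcongr
  · have e := hv.equation k hk a f hf t x
    have := isProbabilityMeasure_transition (P := P) hξ t x
    have h1 := (le_abs_self _).trans
      (abs_integral_transition_le (P := P) (t := t) (x := x) hξ (abs_le_of_mem_BPlusBall hg))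
    rw [potential_const_mul]
    linarith
  · have := hlow k hk N _ (hmem r) hN y
    linarith

/-- The sources of two approximations are compared through H': each H_k is close to H' on the common
ball, and H' is Lipschitz there. -/
theorem uniformCauchySeqOn (hv : ApproximateSolutions ξ P H v) (h : ConvergentMechanisms H H')
    (hξ : Measurable fun z : ℝ≥0 × Ω => ξ z.1 z.2) (ha : 0 ≤ a) (T : ℝ≥0) :
    UniformCauchySeqOn (fun k (z : ℝ≥0 × E × (E → ℝ)) => v k z.2.2 z.1 z.2.1) atTop
      (Icc 0 T ×ˢ univ ×ˢ BPlusBall E a) := by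
  obtain ⟨l, hl, hvl⟩ := hv.exists_bound h hξ ha T
  obtain ⟨C, hC, hLip⟩ := h.lipschitz_limit hl
  rw [Metric.uniformCauchySeqOn_iff]
  intro τ hτ
  -- Chosen so that 2(δ + δT) exp(2CT) = τ/2. The indices j and k each contribute at most δ/2 to the
  -- error in the initial values and in the mechanisms.
  set δ : ℝ := τ / (4 * (1 + T) * Real.exp (2 * C * T)) with hδ
  have hδ0 : 0 < δ := by positivity
  have ha2 : ∀ᶠ k : ℕ in atTop, a ^ 2 / (k : ℝ) < δ / 2 :=
    (tendsto_const_div_atTop_nhds_zero_nat _).eventually_lt_const (by positivity)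
  obtain ⟨K, hK⟩ := eventually_atTop.1 ((eventually_ge_atTop 1).and (ha2.and
    (Metric.tendstoUniformlyOn_iff.1 (h.tendsto l hl) (δ / 2) (by positivity))))
  refine ⟨K, fun j hj k hk z hz => ?_⟩
  obtain ⟨t, x, f⟩ := z
  obtain ⟨ht, -, hf⟩ := hz
  replace hf : f ∈ BPlusBall E a := hf
  replace ht : t ≤ T := ht.2
  obtain ⟨hj1, hja, hjH⟩ := hK j hj
  obtain ⟨hk1, hka, hkH⟩ := hK k hk
  obtain ⟨Kj, hKj⟩ := h.bounded j hj1
  obtain ⟨Kk, hKk⟩ := h.bounded k hk1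
  have key := abs_sub_le_mul_exp (P := P) (R := fun r y => H j y (v j f r))
    (R' := fun r y => H k y (v k f r)) (K := Kj) (K' := Kk) (w := v j f) (w' := v k f) (T := T)
    (l := l) (A := δ) (ε := δ) (x := x) hξ (hv.measurable_source h hj1 hf)
    (hv.measurable_source h hk1 hf) (fun r _ y => hKj _ (hv.mem j hj1 a f hf r) y)
    (fun r _ y => hKk _ (hv.mem k hk1 a f hf r) y)
    (fun r hr y => ?_) hC hδ0.le
    (fun t _ x => hv.equation j hj1 a f hf t x) (fun t _ x => hv.equation k hk1 a f hf t x)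
    (fun t _ x => ?_) (fun r hr N hN y => ?_) ht
  · rw [Real.dist_eq]
    refine key.trans_lt ?_
    have h1 : Real.exp (2 * C * t) ≤ Real.exp (2 * C * T) := by gcongr
    have h2 : 2 * (δ + δ * T) * Real.exp (2 * C * T) = τ / 2 := by
      rw [hδ]
      field_simp
      ring
    calc _ ≤ 2 * (δ + δ * T) * Real.exp (2 * C * T) := by gcongr
      _ < τ := by linarith
  · have h1 := (hvl j hj1 f hf r hr).2 y
    have h2 := (hvl k hk1 f hf r hr).2 y
    exact abs_le.2 ⟨by linarith [h1.1, h2.2], by linarith [h1.2, h2.1]⟩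
  · have := isProbabilityMeasure_transition (P := P) hξ t x
    have h1 := abs_integral_mul_one_sub_exp_sub_le hj1 hf (transition ξ P t x)
    have h2 := abs_integral_mul_one_sub_exp_sub_le hk1 hf (transition ξ P t x)
    rw [abs_sub_comm] at h2
    refine (abs_sub_le _ (∫ y, f y ∂(transition ξ P t x)) _).trans ?_
    linarith
  · have hwj := hvl j hj1 f hf r hr
    have hwk := hvl k hk1 f hf r hr
    have h1 := hjH (y, v j f r) ⟨mem_univ _, hwj⟩
    have h2 := hkH (y, v k f r) ⟨mem_univ _, hwk⟩
    have h3 := hLip _ hwj _ hwk N hN y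
    rw [Real.dist_eq] at h1 h2
    rw [abs_sub_comm] at h1
    have h4 := abs_sub_le (H j y (v j f r)) (H' y (v j f r)) (H k y (v k f r))
    have h5 := abs_sub_le (H' y (v j f r)) (H' y (v k f r)) (H k y (v k f r))
    simp only at h1 h2
    linarith

/-- The limit of the approximate solutions. -/
noncomputable def limit (v : ℕ → (E → ℝ) → ℝ≥0 → E → ℝ) (f : E → ℝ) (t : ℝ≥0) (x : E) : ℝ :=
  limUnder atTop fun k => v k f t x

theorem tendsto_limit (hv : ApproximateSolutions ξ P H v) (h : ConvergentMechanisms H H')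
    (hξ : Measurable fun z : ℝ≥0 × Ω => ξ z.1 z.2) (ha : 0 ≤ a) {f : E → ℝ}
    (hf : f ∈ BPlusBall E a) (t : ℝ≥0) (x : E) :
    Tendsto (fun k => v k f t x) atTop (𝓝 (limit v f t x)) :=
  ((hv.uniformCauchySeqOn h hξ ha t).cauchySeq (x := (t, x, f))
    ⟨⟨zero_le, le_rfl⟩, mem_univ _, hf⟩).tendsto_limUnder

theorem tendstoUniformlyOn_limit (hv : ApproximateSolutions ξ P H v)
    (h : ConvergentMechanisms H H') (hξ : Measurable fun z : ℝ≥0 × Ω => ξ z.1 z.2) (ha : 0 ≤ a)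
    (T : ℝ≥0) :
    TendstoUniformlyOn (fun k (z : ℝ≥0 × E × (E → ℝ)) => v k z.2.2 z.1 z.2.1)
      (fun z => limit v z.2.2 z.1 z.2.1) atTop (Icc 0 T ×ˢ univ ×ˢ BPlusBall E a) :=
  (hv.uniformCauchySeqOn h hξ ha T).tendstoUniformlyOn_of_tendsto fun z hz =>
    hv.tendsto_limit h hξ ha hz.2.2 z.1 z.2.1

theorem measurable_limit (hv : ApproximateSolutions ξ P H v) (h : ConvergentMechanisms H H')
    (hξ : Measurable fun z : ℝ≥0 × Ω => ξ z.1 z.2) (ha : 0 ≤ a) {f : E → ℝ}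
    (hf : f ∈ BPlusBall E a) : Measurable fun z : ℝ≥0 × E => limit v f z.1 z.2 :=
  measurable_of_tendsto_metrizable (fun k => hv.measurable (k + 1) (by simp) a f hf)
    (tendsto_pi_nhds.2 fun z =>
      (hv.tendsto_limit h hξ ha hf z.1 z.2).comp (tendsto_add_atTop_nat 1))

theorem exists_bound_limit (hv : ApproximateSolutions ξ P H v) (h : ConvergentMechanisms H H')
    (hξ : Measurable fun z : ℝ≥0 × Ω => ξ z.1 z.2) (ha : 0 ≤ a) (T : ℝ≥0) :
    ∃ l, 0 ≤ l ∧ (∀ k, 1 ≤ k → ∀ f ∈ BPlusBall E a, ∀ t ≤ T, v k f t ∈ BPlusBall E l) ∧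
      ∀ f ∈ BPlusBall E a, ∀ t ≤ T, limit v f t ∈ BPlusBall E l := by
  obtain ⟨l, hl, hvl⟩ := hv.exists_bound h hξ ha T
  refine ⟨l, hl, hvl, fun f hf t ht => ⟨measurable_section (hv.measurable_limit h hξ ha hf) t,
    fun x => ?_⟩⟩
  refine isClosed_Icc.mem_of_tendsto (hv.tendsto_limit h hξ ha hf t x) ?_
  filter_upwards [eventually_ge_atTop 1] with k hk
  exact (hvl k hk f hf t ht).2 x

theorem limit_equation (hv : ApproximateSolutions ξ P H v) (h : ConvergentMechanisms H H')
    (hξ : Measurable fun z : ℝ≥0 × Ω => ξ z.1 z.2) (ha : 0 ≤ a) {f : E → ℝ}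
    (hf : f ∈ BPlusBall E a) (t : ℝ≥0) (x : E) :
    limit v f t x + potential ξ P (fun r y => H' y (limit v f r)) t x =
      ∫ y, f y ∂(transition ξ P t x) := by
  obtain ⟨l, hl, hvl, hVl⟩ := hv.exists_bound_limit h hξ ha t
  obtain ⟨C, hC, hLip⟩ := h.lipschitz_limit hl
  obtain ⟨K', hK'⟩ := h.bounded_limit hl
  have hmeas : Measurable fun z : ℝ≥0 × E => H' z.2 (limit v f z.1) :=
    h.measurable_limit (hv.measurable_limit h hξ ha hf) fun r => by
      obtain ⟨l, hl, -, hVl⟩ := hv.exists_bound_limit h hξ ha r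
      exact ⟨l, hl, hVl f hf r le_rfl⟩
  -- On [0,t] the sources differ by at most δ from the mechanism and Cδ from the argument, hence
  -- their potentials by at most tδ(1 + C), which is below τ.
  have hpot : Tendsto (fun k => potential ξ P (fun r y => H k y (v k f r)) t x) atTop
      (𝓝 (potential ξ P (fun r y => H' y (limit v f r)) t x)) := by
    rw [Metric.tendsto_atTop']
    intro τ hτ
    set δ : ℝ := τ / (2 * (1 + t) * (1 + C)) with hδ
    have hδ0 : 0 < δ := by positivity
    obtain ⟨k₀, hk₀⟩ := eventually_atTop.1 ((eventually_ge_atTop 1).and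
      ((Metric.tendstoUniformlyOn_iff.1 (h.tendsto l hl) δ hδ0).and
      (Metric.tendstoUniformlyOn_iff.1 (hv.tendstoUniformlyOn_limit h hξ ha t) δ hδ0)))
    refine ⟨k₀, fun k hk => ?_⟩
    obtain ⟨hk1, hkH, hkv⟩ := hk₀ k hk.le
    obtain ⟨K, hK⟩ := h.bounded k hk1
    have hb : ∀ r ≤ t, ∀ y, |H k y (v k f r) - H' y (limit v f r)| ≤ δ * (1 + C) := by
      intro r hr y
      have h1 := hkH (y, v k f r) ⟨mem_univ _, hvl k hk1 f hf r hr⟩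
      have h2 := hLip _ (hvl k hk1 f hf r hr) _ (hVl f hf r hr) δ (fun x => by
        have := hkv (r, x, f) ⟨⟨zero_le, hr⟩, mem_univ _, hf⟩
        rw [dist_comm, Real.dist_eq] at this
        exact this.le) y
      rw [dist_comm, Real.dist_eq] at h1
      simp only at h1
      have h3 := abs_sub_le (H k y (v k f r)) (H' y (v k f r)) (H' y (limit v f r))
      linarith
    have hs := hv.measurable_source h hk1 hf
    have h1 := abs_potential_le (P := P) (x := x) (t := t)
      (R := fun r y => H k y (v k f r) - H' y (limit v f r)) hξ (hs.sub hmeas) hb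
    rw [potential_sub (K := K) (K' := K') (R := fun r y => H k y (v k f r))
      (R' := fun r y => H' y (limit v f r)) hξ hs hmeas
      (fun r _ y => hK _ (hv.mem k hk1 a f hf r) y) (fun r hr y => hK' _ (hVl f hf r hr) y)] at h1
    rw [Real.dist_eq]
    refine h1.trans_lt ?_
    have h2 : (1 + t) * (δ * (1 + C)) = τ / 2 := by
      rw [hδ]
      field_simp
    have h3 : 0 < δ * (1 + C) := by positivity
    linarith
  have hinit : Tendsto (fun k : ℕ => ∫ y, k * (1 - Real.exp (-(f y / k))) ∂(transition ξ P t x))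
      atTop (𝓝 (∫ y, f y ∂(transition ξ P t x))) := by
    have := isProbabilityMeasure_transition (P := P) hξ t x
    rw [tendsto_iff_norm_sub_tendsto_zero]
    refine squeeze_zero' (Eventually.of_forall fun k => norm_nonneg _) ?_
      (tendsto_const_div_atTop_nhds_zero_nat (a ^ 2))
    filter_upwards [eventually_ge_atTop 1] with k hk
    exact abs_integral_mul_one_sub_exp_sub_le hk hf _
  refine tendsto_nhds_unique (((hv.tendsto_limit h hξ ha hf t x).add hpot).congr' ?_) hinit
  filter_upwards [eventually_ge_atTop 1] with k hk
  exact hv.equation k hk a f hf t x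

end ApproximateSolutions

/-- Bounded positive solutions of the limit equation are determined by their initial values. -/
theorem ConvergentMechanisms.solution_unique {E Ω : Type*} [MeasurableSpace E] [MeasurableSpace Ω]
    {ξ : ℝ≥0 → Ω → E} {P : Kernel E Ω} [IsMarkovKernel P] {H : ℕ → E → (E → ℝ) → ℝ}
    {φ : E → ℝ → ℝ} {ψ : E → (E → ℝ) → ℝ}
    (h : ConvergentMechanisms H fun y w => φ y (w y) + ψ y w)
    (hξ : Measurable fun z : ℝ≥0 × Ω => ξ z.1 z.2) {f : E → ℝ} {V W : ℝ≥0 → E → ℝ}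
    (hV : IsBoundedPositiveSolution ξ P φ ψ f V) (hW : IsBoundedPositiveSolution ξ P φ ψ f W) :
    W = V := by
  have hball : ∀ {U : ℝ≥0 → E → ℝ}, IsBoundedPositiveSolution ξ P φ ψ f U → ∀ T : ℝ≥0,
      ∃ l, 0 ≤ l ∧ ∀ r ≤ T, U r ∈ BPlusBall E l := fun hU T => by
    obtain ⟨C, hC⟩ := hU.bounded T
    exact ⟨max C 0, le_max_right _ _, fun r hr => ⟨measurable_section hU.measurable r, fun x =>
      ⟨hU.nonneg r x, (hC r hr x).trans (le_max_left _ _)⟩⟩⟩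
  have hmeas : ∀ {U : ℝ≥0 → E → ℝ}, IsBoundedPositiveSolution ξ P φ ψ f U →
      Measurable fun z : ℝ≥0 × E => φ z.2 (U z.1 z.2) + ψ z.2 (U z.1) := fun hU =>
    h.measurable_limit hU.measurable fun r => (hball hU r).imp fun l hl => ⟨hl.1, hl.2 r le_rfl⟩
  funext t x
  obtain ⟨l, hl, hVl⟩ := hball hV t
  obtain ⟨l', -, hWl⟩ := hball hW t
  have hm : 0 ≤ max l l' := hl.trans (le_max_left _ _)
  have hVm := fun r hr => BPlusBall_mono (le_max_left l l') (hVl r hr)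
  have hWm := fun r hr => BPlusBall_mono (le_max_right l l') (hWl r hr)
  obtain ⟨C, hC, hLip⟩ := h.lipschitz_limit hm
  obtain ⟨K, hK⟩ := h.bounded_limit hm
  have key := abs_sub_le_mul_exp (P := P) (R := fun r y => φ y (W r y) + ψ y (W r))
    (R' := fun r y => φ y (V r y) + ψ y (V r)) (K := K) (K' := K) (w := W) (w' := V) (T := t)
    (l := max l l') (A := 0) (ε := 0) (x := x) hξ (hmeas hW) (hmeas hV)
    (fun r hr y => hK _ (hWm r hr) y) (fun r hr y => hK _ (hVm r hr) y)
    (fun r hr y => abs_le.2 ⟨by linarith [((hWm r hr).2 y).1, ((hVm r hr).2 y).2],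
      by linarith [((hWm r hr).2 y).2, ((hVm r hr).2 y).1]⟩) hC le_rfl
    (fun t _ x => hW.equation t x) (fun t _ x => hV.equation t x) (fun t _ x => by simp)
    (fun r hr N hN y => by
      rw [add_zero]
      exact hLip _ (hWm r hr) _ (hVm r hr) N hN y) le_rfl
  -- Equal initial values and the same mechanism leave no error term, so the stability bound is 0.
  rw [zero_mul, add_zero, mul_zero, zero_mul] at key
  exact sub_eq_zero.1 (abs_eq_zero.1 (le_antisymm key (abs_nonneg _)))

namespace ApproximateSolutions

variable {E Ω : Type*} [MeasurableSpace E] [MeasurableSpace Ω] {ξ : ℝ≥0 → Ω → E} {P : Kernel E Ω}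
  [IsMarkovKernel P] {H : ℕ → E → (E → ℝ) → ℝ} {H' : E → (E → ℝ) → ℝ} {φ : E → ℝ → ℝ}
  {ψ : E → (E → ℝ) → ℝ} {v : ℕ → (E → ℝ) → ℝ≥0 → E → ℝ}

theorem isBoundedPositiveSolution_limit (hv : ApproximateSolutions ξ P H v)
    (h : ConvergentMechanisms H fun y w => φ y (w y) + ψ y w)
    (hξ : Measurable fun z : ℝ≥0 × Ω => ξ z.1 z.2) {f : E → ℝ} (hf : f ∈ BPlus E) :
    IsBoundedPositiveSolution ξ P φ ψ f (limit v f) := by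
  obtain ⟨b, hb⟩ := hf
  have hf : f ∈ BPlusBall E |b| := BPlusBall_mono (le_abs_self b) hb
  have hball := hv.exists_bound_limit h hξ (abs_nonneg b)
  refine ⟨hv.measurable_limit h hξ (abs_nonneg b) hf, fun t x => ?_, fun T => ?_, fun t x =>
    hv.limit_equation h hξ (abs_nonneg b) hf t x⟩
  · obtain ⟨l, -, -, hl⟩ := hball t
    exact ((hl f hf t le_rfl).2 x).1
  · obtain ⟨l, -, -, hl⟩ := hball T
    exact ⟨l, fun t ht x => ((hl f hf t ht).2 x).2⟩

theorem convergesBoundedlyUniformlyOn_limit (hv : ApproximateSolutions ξ P H v)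
    (h : ConvergentMechanisms H H') (hξ : Measurable fun z : ℝ≥0 × Ω => ξ z.1 z.2) {a : ℝ}
    (ha : 0 ≤ a) (T : ℝ≥0) :
    ConvergesBoundedlyUniformlyOn (fun k (z : ℝ≥0 × E × (E → ℝ)) => v k z.2.2 z.1 z.2.1)
      (fun z => limit v z.2.2 z.1 z.2.1) (Icc 0 T ×ˢ univ ×ˢ BPlusBall E a) := by
  obtain ⟨l, -, hl⟩ := hv.exists_bound h hξ ha T
  exact ⟨⟨l, fun k hk z hz =>
    abs_le_of_mem_BPlusBall (hl k hk z.2.2 hz.2.2 z.1 hz.1.2) z.2.1⟩,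
    hv.tendstoUniformlyOn_limit h hξ ha T⟩

end ApproximateSolutions

/-! ### From v to k u. -/

section Particles

variable {E Ω : Type*} [MeasurableSpace E] {mΩ : MeasurableSpace Ω} {ξ : ℝ≥0 → Ω → E}
  {P : Kernel E Ω} {G : Kernel E (ProbabilityMeasure E)} [IsMarkovKernel G]
  (D : ℕ → BranchingData E)

theorem approximateSolutions_vK [TopologicalSpace E] [TopologicalSpace.PseudoMetrizableSpace E]
    [BorelSpace E] {𝓕 : Filtration ℝ≥0 mΩ} (hξ : IsRightContStrongMarkov 𝓕 ξ P) :
    ApproximateSolutions ξ P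
      (fun k y w => (D k).phi k y (w y) + psi (D k).β ((D k).zeta G k) y w)
      (fun k f t x => (D k).vK G ξ P k t x f) := by
  have := hξ.isMarkovKernel
  have hm := hξ.measurable_uncurry
  exact ⟨fun k _ a f hf t => ⟨measurable_section
      (R := fun t x => (D k).vK G ξ P k t x f) ((D k).measurable_vK hm hf) t,
    fun x => (D k).vK_mem_Icc hm hf t x⟩, fun k _ a f hf => (D k).measurable_vK hm hf,
    fun k hk a f hf t x => (D k).vK_equation hξ hk hf t x⟩

theorem abs_neg_log_sub_le {z : ℝ} (hz : z ∈ Icc (1 / 2 : ℝ) 1) :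
    |-Real.log z - (1 - z)| ≤ 2 * (1 - z) ^ 2 := by
  have hz0 : 0 < z := by linarith [hz.1]
  have h1 := Real.log_le_sub_one_of_pos hz0
  have h2 := Real.one_sub_inv_le_log_of_pos hz0
  -- With d = 1 - z one has 1/z = 1 + d + d²/z, and z ≥ 1/2.
  have h3 : z⁻¹ ≤ 1 + (1 - z) + 2 * (1 - z) ^ 2 := by
    rw [inv_le_iff_one_le_mul₀ hz0]
    nlinarith [mul_nonneg (sq_nonneg (1 - z)) (sub_nonneg.2 hz.1)]
  exact abs_le.2 ⟨by nlinarith [sq_nonneg (1 - z)], by linarith⟩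

variable [IsMarkovKernel P]

theorem BranchingData.abs_mul_uK_sub_vK_le (D : BranchingData E)
    (hξ : Measurable fun z : ℝ≥0 × Ω => ξ z.1 z.2) {f : E → ℝ} {a l : ℝ} {k : ℕ} (hk : 1 ≤ k)
    (hf : f ∈ BPlusBall E a) {t : ℝ≥0} {x : E} (hl : D.vK G ξ P k t x f ≤ l) (hkl : 2 * l ≤ k) :
    |k * D.uK G ξ P k t x f - D.vK G ξ P k t x f| ≤ 2 * l ^ 2 / k := by
  have hk0 : (0 : ℝ) < k := by exact_mod_cast hk
  have h01 := D.laplace_mem_Icc (f := fun y => f y / k) (P := P) G hξ t x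
  have hv0 := (D.vK_mem_Icc (G := G) (P := P) (k := k) hξ hf t x).1
  have hvk := pow_le_pow_left₀ hv0 hl 2
  rw [D.uK_eq hξ hf]
  rw [D.vK_eq hξ hf] at hl hvk ⊢
  set z := D.laplace G ξ P (fun y => f y / k) t x
  -- Here z = 1 - v/k with v ≤ l ≤ k/2. The second-order error k · 2(1 - z)² equals 2v²/k.
  have hz : 1 / 2 ≤ z := by
    by_contra! hz
    nlinarith
  have h := mul_le_mul_of_nonneg_left (abs_neg_log_sub_le ⟨hz, h01.2⟩) hk0.le
  rw [← mul_sub, abs_mul, abs_of_pos hk0, le_div_iff₀ hk0]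
  nlinarith

theorem convergesBoundedlyUniformlyOn_uK (hξ : Measurable fun z : ℝ≥0 × Ω => ξ z.1 z.2) {a : ℝ}
    {T : ℝ≥0} {W : ℝ≥0 × E × (E → ℝ) → ℝ}
    (hv : ConvergesBoundedlyUniformlyOn
      (fun k (z : ℝ≥0 × E × (E → ℝ)) => (D k).vK G ξ P k z.1 z.2.1 z.2.2) W
      (Icc 0 T ×ˢ univ ×ˢ BPlusBall E a)) :
    ConvergesBoundedlyUniformlyOn
      (fun k (z : ℝ≥0 × E × (E → ℝ)) => k * (D k).uK G ξ P k z.1 z.2.1 z.2.2) W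
      (Icc 0 T ×ˢ univ ×ˢ BPlusBall E a) := by
  obtain ⟨⟨l, hl⟩, hlim⟩ := hv
  have hdiff : ∀ k : ℕ, 1 ≤ k → 2 * l ≤ k → ∀ z ∈ Icc 0 T ×ˢ univ ×ˢ BPlusBall E a,
      |k * (D k).uK G ξ P k z.1 z.2.1 z.2.2 - (D k).vK G ξ P k z.1 z.2.1 z.2.2| ≤
        2 * l ^ 2 / k := fun k hk hkl z hz =>
    (D k).abs_mul_uK_sub_vK_le hξ hk hz.2.2 ((le_abs_self _).trans (hl k hk z hz)) hkl
  constructor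
  · refine exists_forall_of_eventually
      (p := fun k C => 1 ≤ k → ∀ z ∈ Icc 0 T ×ˢ univ ×ˢ BPlusBall E a,
        |k * (D k).uK G ξ P k z.1 z.2.1 z.2.2| ≤ C)
      (fun k C C' h hC hk z hz => (hC hk z hz).trans h) (fun k => ?_) ⟨2 * l ^ 2 + l, ?_⟩
    -- This bound, from the survival of the ancestor, grows with k and serves only for the finitely
    -- many k below 2l.
    · obtain ⟨C, hC0, hC⟩ := (D k).exists_γ_le
      refine ⟨k * C * T + a, fun hk z hz => ?_⟩
      have h := (D k).uK_bounds (G := G) (P := P) hξ hk hz.2.2 hC z.1 z.2.1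
      rw [abs_of_nonneg h.1]
      have hzT : (z.1 : ℝ) ≤ T := hz.1.2
      exact h.2.trans (by gcongr)
    · filter_upwards [eventually_ge_atTop ⌈2 * l⌉₊] with k hkl hk z hz
      have hk1 : (1 : ℝ) ≤ k := by exact_mod_cast hk
      have h1 := hdiff k hk (Nat.ceil_le.1 hkl) z hz
      have h2 : 2 * l ^ 2 / k ≤ 2 * l ^ 2 := div_le_self (by positivity) hk1
      have h3 := hl k hk z hz
      rw [← sub_add_cancel (k * (D k).uK G ξ P k z.1 z.2.1 z.2.2)
        ((D k).vK G ξ P k z.1 z.2.1 z.2.2)]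
      exact (abs_add_le _ _).trans (add_le_add (h1.trans h2) h3)
  · rw [Metric.tendstoUniformlyOn_iff] at hlim ⊢
    intro ε hε
    have h0 : ∀ᶠ k : ℕ in atTop, 2 * l ^ 2 / (k : ℝ) < ε / 2 :=
      (tendsto_const_div_atTop_nhds_zero_nat _).eventually_lt_const (half_pos hε)
    filter_upwards [hlim (ε / 2) (half_pos hε), h0, eventually_ge_atTop 1,
      eventually_ge_atTop ⌈2 * l⌉₊] with k h1 h2 hk hkl z hz
    have h3 := hdiff k hk (Nat.ceil_le.1 hkl) z hz
    have h4 := h1 z hz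
    rw [← Real.dist_eq, dist_comm] at h3
    exact (dist_triangle _ _ _).trans_lt (by linarith)

end Particles

end NonlocalBranching

/-! ### The convergence theorem. -/

theorem lemma3p3 {E : Type*} [TopologicalSpace E] [MeasurableSpace E] [BorelSpace E]
    (hE : NonlocalBranching.IsLusin E)
    -- the underlying process
    {Ω : Type*} [mΩ : MeasurableSpace Ω] (𝓕 : Filtration ℝ≥0 mΩ) (ξ : ℝ≥0 → Ω → E)
    (P : Kernel E Ω) (hξ : NonlocalBranching.IsRightContStrongMarkov 𝓕 ξ P)
    -- the sequence of particle systems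
    (G : Kernel E (ProbabilityMeasure E)) (hG : IsMarkovKernel G)
    (D : ℕ → NonlocalBranching.BranchingData E)
    -- the non-local branching is subcritical, and its mechanisms converge
    (hq : ∀ k, 1 ≤ k → ∀ x π, ∑' i : ℕ, (i : ℝ≥0∞) * ENNReal.ofReal ((D k).q i x π) ≤ 1)
    (ζ : E → (E → ℝ) → ℝ)
    (hζ : ∀ a : ℝ, 0 ≤ a → TendstoUniformlyOn
      (fun k (z : E × (E → ℝ)) => (D k).zeta G k z.1 z.2) (fun z => ζ z.1 z.2) atTop
      (univ ×ˢ NonlocalBranching.BPlusBall E a))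
    -- the local branching mechanisms are uniformly Lipschitz and converge
    (hLip : ∀ l : ℝ, 0 ≤ l → ∃ L : ℝ, ∀ k : ℕ, 1 ≤ k → l ≤ k → ∀ x, ∀ z ∈ Icc 0 l, ∀ z' ∈ Icc 0 l,
      |(D k).phi k x z - (D k).phi k x z'| ≤ L * |z - z'|)
    (φ : E → ℝ → ℝ)
    (hφ : ∀ l : ℝ, 0 ≤ l → TendstoUniformlyOn
      (fun k (z : E × ℝ) => (D k).phi k z.1 z.2) (fun z => φ z.1 z.2) atTop
      (univ ×ˢ Icc 0 l))
    -- the non-local branching rates converge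
    (β : E → ℝ) (hβ : β ∈ NonlocalBranching.BPlus E)
    (hβ_lim : TendstoUniformly (fun k => (D k).β) β atTop) :
    ∃ V : (E → ℝ) → ℝ≥0 → E → ℝ,
      (∀ f ∈ NonlocalBranching.BPlus E,
        NonlocalBranching.IsBoundedPositiveSolution ξ P φ (NonlocalBranching.psi β ζ) f (V f) ∧
        ∀ W, NonlocalBranching.IsBoundedPositiveSolution ξ P φ (NonlocalBranching.psi β ζ) f W →
          W = V f) ∧
      ∀ a : ℝ≥0,
        NonlocalBranching.ConvergesBoundedlyUniformlyOn
          (fun k (z : ℝ≥0 × E × (E → ℝ)) => (D k).vK G ξ P k z.1 z.2.1 z.2.2)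
          (fun z => V z.2.2 z.1 z.2.1)
          (Icc 0 a ×ˢ univ ×ˢ NonlocalBranching.BPlusBall E a) ∧
        NonlocalBranching.ConvergesBoundedlyUniformlyOn
          (fun k (z : ℝ≥0 × E × (E → ℝ)) => k * (D k).uK G ξ P k z.1 z.2.1 z.2.2)
          (fun z => V z.2.2 z.1 z.2.1)
          (Icc 0 a ×ˢ univ ×ˢ NonlocalBranching.BPlusBall E a) := by
  obtain ⟨_, _, _, e, he, -⟩ := hE
  -- The embedding into a metric space makes E metrizable; pointwise limits of measurable E-valued
  -- maps are then measurable, as joint measurability of right continuous processes requires.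
  have := he.metrizableSpace
  have := hξ.isMarkovKernel
  have hm := hξ.measurable_uncurry
  have hM := NonlocalBranching.convergentMechanisms hq hζ hLip hφ hβ hβ_lim
  have hv := NonlocalBranching.approximateSolutions_vK (G := G) D hξ
  refine ⟨NonlocalBranching.ApproximateSolutions.limit fun k f t x => (D k).vK G ξ P k t x f,
    fun f hf => ?_, fun a => ?_⟩
  · have hsol := hv.isBoundedPositiveSolution_limit hM hm hf
    exact ⟨hsol, fun W hW => hM.solution_unique hm hsol hW⟩
  · have hvconv := hv.convergesBoundedlyUniformlyOn_limit hM hm a.coe_nonneg a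
    exact ⟨hvconv, NonlocalBranching.convergesBoundedlyUniformlyOn_uK D hm hvconv⟩
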